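/- Let $k$ be a field; algebras are associative unital $k$-algebras, modules are right modules, and paths in a quiver are composed from left to right. A *gentle algebra* is a finite-dimensional algebra $A$ with an isomorphism $A\cong kQ/I$, where $Q$ is a finite quiver in which at most two arrows start and at most two arrows end at each vertex, $I$ is an ideal generated by paths of length two, and for every arrow $a$ there is, among the arrows $b$ with $ab$ a path, at most one with $ab\in I$ and at most one with $ab\notin I$, and, among the arrows $c$ with $ca$ a path, at most one with $ca\in I$ and at most one with $ca\notin I$. A path $p$ in $Q$ is a *maximal path* of $A$ if $p\neq 0$ in $A$ and $pa=ap=0$ in $A$ for every arrow $a$. If $A$ has exactly one maximal path $p$, and $p$ passes successively through the vertices $v_1,\dots,v_n$ (with repetitions), then each vertex occurs at most twice among them; the *quasi-diagram* associated to $A$ is the involution $\alpha\in\mathfrak S_n$ with $\alpha(i)=j$ if $v_i=v_j$ for some $j\ne i$, and $\alpha(i)=i$ otherwise. Fixed points of $\alpha$ are called *isolated points*, its $2$-cycles are called *chords*, and the *faces* of $\alpha$ are the cycles (including those of length one) of $\zeta\alpha$, where $\zeta=(1\,2\cdots n)$ and $\alpha$ is applied first; $\alpha$ is *maximal* if it has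 exactly one face. The *Koszul dual* of $A$ is the Yoneda algebra $A^!=\operatorname{Ext}_A(A_0,A_0)$, where $A_0$ is the degree-zero part of $A=kQ/I$ for the grading by path length, that is, the right module $A/A_{\geq 1}$. **Theorem.** Let $A$ be a gentle algebra with exactly one maximal path, and let $\alpha\in\mathfrak S_n$ be the associated quasi-diagram. Then the following are equivalent: 1. the Koszul dual $A^!$ is again a gentle algebra with exactly one maximal path (so that it has an associated quasi-diagram, denoted $\alpha^!$); 2. $\operatorname{gldim} A=n-1$; 3. $\alpha$ is of one of the following types: - Type A: $\alpha$ is maximal and has no isolated point; - Type B: $\alpha$ is maximal and has at least one isolated point, and every isolated point of $\alpha$ is $1$ or $n$; - Type C: $n\geq 2$, $(1,n)$ is a chord of $\alpha$, and $\alpha$ has exactly one isolated point and exactly two faces. Moreover, if $\alpha^!$ exists, then it has the same type (A, B or C) as $\alpha$. -/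

import Mathlib

open CategoryTheory
open scoped DirectSum

universe w v u

/-! ## Path algebras -/

/-- The path algebra `kQ` of a quiver `Q` with vertex type `V`: the `k`-vector space with basis
the paths of `Q` (including a trivial path at each vertex), multiplied by concatenation.  Paths
are composed from left to right. -/
def PathAlgebra (k : Type*) [Field k] (V : Type) [Quiver.{0} V] :=
  (Σ a b : V, Quiver.Path a b) →₀ k

namespace PathAlgebra

variable {k : Type*} [Field k] {V : Type} [Quiver.{0} V]

noncomputable instance : AddCommGroup (PathAlgebra k V) :=
  inferInstanceAs (AddCommGroup ((Σ a b : V, Quiver.Path a b) →₀ k))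

noncomputable instance : Module k (PathAlgebra k V) :=
  inferInstanceAs (Module k ((Σ a b : V, Quiver.Path a b) →₀ k))

/-- The basis of `kQ` given by the paths. -/
noncomputable def basis : Module.Basis (Σ a b : V, Quiver.Path a b) k (PathAlgebra k V) :=
  Module.Basis.ofRepr (LinearEquiv.refl k ((Σ a b : V, Quiver.Path a b) →₀ k))

/-- The basis element of `kQ` given by a path. -/
noncomputable def ofPath {a b : V} (p : Quiver.Path a b) : PathAlgebra k V :=
  basis (⟨a, b, p⟩ : Σ a b : V, Quiver.Path a b)

open Classical in
/-- The product of two paths in `kQ`: their concatenation if the first ends where the second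
starts, and `0` otherwise. -/
noncomputable def pathMul (p q : Σ a b : V, Quiver.Path a b) : PathAlgebra k V :=
  if h : q.1 = p.2.1 then ofPath (p.2.2.comp (q.2.2.cast h rfl)) else 0

/-- The multiplication of `kQ`: the bilinear extension of the product of paths. -/
noncomputable def mulHom : PathAlgebra k V →ₗ[k] PathAlgebra k V →ₗ[k] PathAlgebra k V :=
  basis.constr k fun p => basis.constr k fun q => pathMul p q

noncomputable instance : Mul (PathAlgebra k V) := ⟨fun x y => mulHom x y⟩

theorem mul_def (x y : PathAlgebra k V) : x * y = mulHom x y := rfl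

theorem ofPath_mul_ofPath {a b c : V} (p : Quiver.Path a b) (q : Quiver.Path b c) :
    (ofPath p * ofPath q : PathAlgebra k V) = ofPath (p.comp q) := by
  rw [mul_def, mulHom, ofPath, ofPath, Module.Basis.constr_basis, Module.Basis.constr_basis]
  simp [pathMul]

theorem ofPath_mul_ofPath_of_ne {a b c d : V} (p : Quiver.Path a b) (q : Quiver.Path c d)
    (h : c ≠ b) : (ofPath p * ofPath q : PathAlgebra k V) = 0 := by
  rw [mul_def, mulHom, ofPath, ofPath, Module.Basis.constr_basis, Module.Basis.constr_basis]
  simp [pathMul, h]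

theorem induction {P : PathAlgebra k V → Prop} (x : PathAlgebra k V)
    (path : ∀ (a b : V) (p : Quiver.Path a b), P (ofPath p)) (zero : P 0)
    (add : ∀ x y, P x → P y → P (x + y)) (smul : ∀ (r : k) x, P x → P (r • x)) : P x := by
  have hx : x ∈ Submodule.span k (Set.range (basis (k := k) (V := V))) := by
    rw [basis.span_eq]; trivial
  induction hx using Submodule.span_induction with
  | mem x h => obtain ⟨⟨a, b, p⟩, rfl⟩ := h; exact path a b p
  | zero => exact zero
  | add x y _ _ hx hy => exact add x y hx hy
  | smul r x _ hx => exact smul r x hx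

noncomputable instance : NonUnitalRing (PathAlgebra k V) where
  left_distrib x y z := by simp [mul_def]
  right_distrib x y z := by simp [mul_def]
  zero_mul x := by simp [mul_def]
  mul_zero x := by simp [mul_def]
  mul_assoc x y z := by
    induction x using induction with
    | zero => simp [mul_def]
    | add x x' hx hx' => simp only [mul_def, map_add, LinearMap.add_apply] at *; rw [hx, hx']
    | smul r x hx => simp only [mul_def, map_smul, LinearMap.smul_apply] at *; rw [hx]
    | path a b p =>
    induction y using induction with
    | zero => simp [mul_def]
    | add x x' hx hx' => simp only [mul_def, map_add, LinearMap.add_apply] at *; rw [hx, hx']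
    | smul r x hx => simp only [mul_def, map_smul, LinearMap.smul_apply] at *; rw [hx]
    | path c d q =>
    induction z using induction with
    | zero => simp [mul_def]
    | add x x' hx hx' => simp only [mul_def, map_add] at *; rw [hx, hx']
    | smul r x hx => simp only [mul_def, map_smul] at *; rw [hx]
    | path e f r =>
    have zl (x : PathAlgebra k V) : 0 * x = 0 := by simp [mul_def]
    have zr (x : PathAlgebra k V) : x * 0 = 0 := by simp [mul_def]
    by_cases h : c = b
    · subst h
      by_cases h' : e = d
      · subst h'
        simp only [ofPath_mul_ofPath, Quiver.Path.comp_assoc]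
      · rw [ofPath_mul_ofPath, ofPath_mul_ofPath_of_ne _ _ h', ofPath_mul_ofPath_of_ne _ _ h', zr]
    · rw [ofPath_mul_ofPath_of_ne _ _ h, zl]
      by_cases h' : e = d
      · subst h'
        rw [ofPath_mul_ofPath, ofPath_mul_ofPath_of_ne _ _ h]
      · rw [ofPath_mul_ofPath_of_ne _ _ h', zr]

variable [Fintype V]

/-- The unit of `kQ` is the sum of the trivial paths. -/
noncomputable instance : One (PathAlgebra k V) :=
  ⟨∑ v : V, ofPath (Quiver.Path.nil : Quiver.Path v v)⟩

theorem one_def :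
    (1 : PathAlgebra k V) = ∑ v : V, ofPath (Quiver.Path.nil : Quiver.Path v v) := rfl

noncomputable instance : Ring (PathAlgebra k V) where
  __ := (inferInstance : NonUnitalRing (PathAlgebra k V))
  one_mul x := by
    induction x using induction with
    | zero => exact mul_zero _
    | add x y hx hy => rw [mul_add, hx, hy]
    | smul r x hx => rw [mul_def, map_smul, ← mul_def, hx]
    | path a b p =>
      rw [one_def, Finset.sum_mul, Finset.sum_eq_single a]
      · rw [ofPath_mul_ofPath, Quiver.Path.nil_comp]
      · intro v _ hv
        exact ofPath_mul_ofPath_of_ne _ _ hv.symm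
      · simp
  mul_one x := by
    induction x using induction with
    | zero => exact zero_mul _
    | add x y hx hy => rw [add_mul, hx, hy]
    | smul r x hx => rw [mul_def, map_smul, LinearMap.smul_apply, ← mul_def, hx]
    | path a b p =>
      rw [one_def, Finset.mul_sum, Finset.sum_eq_single b]
      · rw [ofPath_mul_ofPath, Quiver.Path.comp_nil]
      · intro v _ hv
        exact ofPath_mul_ofPath_of_ne _ _ hv
      · simp

noncomputable instance : Algebra k (PathAlgebra k V) :=
  Algebra.ofModule
    (fun r x y => by simp only [mul_def, map_smul, LinearMap.smul_apply])
    (fun r x y => by simp only [mul_def, map_smul])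

end PathAlgebra

/-! ## Gentle algebras -/

/-- A presentation `A ≅ kQ/I` of a `k`-algebra by a finite quiver `Q`: a surjective algebra
homomorphism `kQ → A`, whose kernel is the ideal `I`. -/
structure QuiverPresentation (k A : Type*) [Field k] [Ring A] [Algebra k A] where
  /-- the vertices of `Q` -/
  V : Type
  /-- the arrows of `Q` -/
  [quiver : Quiver.{0} V]
  [fintypeV : Fintype V]
  [finiteHom : ∀ i j : V, Finite (i ⟶ j)]
  /-- the projection `kQ → A` -/
  π : PathAlgebra k V →ₐ[k] A
  surjective : Function.Surjective π

namespace QuiverPresentation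

attribute [instance] quiver fintypeV finiteHom

variable {k A : Type*} [Field k] [Ring A] [Algebra k A] (P : QuiverPresentation k A)

/-- The class in `A` of a path of `Q`. -/
noncomputable def ofPath {i j : P.V} (p : Quiver.Path i j) : A :=
  P.π (PathAlgebra.ofPath p)

/-- The class in `A` of an arrow of `Q`. -/
noncomputable def ofArrow {i j : P.V} (a : i ⟶ j) : A :=
  P.ofPath a.toPath

/-- The presentation exhibits `A = kQ/I` as a locally gentle algebra. -/
structure IsLocallyGentle : Prop where
  /-- at most two arrows end at each vertex -/
  card_in : ∀ i : P.V, Nat.card (Σ j : P.V, (j ⟶ i)) ≤ 2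
  /-- at most two arrows start at each vertex -/
  card_out : ∀ i : P.V, Nat.card (Σ j : P.V, (i ⟶ j)) ≤ 2
  /-- the ideal `I` is generated by paths of length two -/
  quadratic : ∃ R : Set (Σ i j : P.V, Quiver.Path i j), (∀ p ∈ R, p.2.2.length = 2) ∧
    ∀ x : PathAlgebra k P.V, P.π x = 0 ↔
      x ∈ TwoSidedIdeal.span ((fun p => PathAlgebra.ofPath p.2.2) '' R)
  /-- for each arrow `a` there is at most one arrow `b` composable with `a` with `ab ∈ I` -/
  right_mem : ∀ {i j : P.V} (a : i ⟶ j),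
    {b : Σ l : P.V, (j ⟶ l) | P.ofArrow a * P.ofArrow b.2 = 0}.Subsingleton
  /-- for each arrow `a` there is at most one arrow `c` composable with `a` with `ca ∈ I` -/
  left_mem : ∀ {i j : P.V} (a : i ⟶ j),
    {c : Σ l : P.V, (l ⟶ i) | P.ofArrow c.2 * P.ofArrow a = 0}.Subsingleton
  /-- for each arrow `a` there is at most one arrow `b` with `ab ∉ I` -/
  right_notMem : ∀ {i j : P.V} (a : i ⟶ j),
    {b : Σ l : P.V, (j ⟶ l) | P.ofArrow a * P.ofArrow b.2 ≠ 0}.Subsingleton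
  /-- for each arrow `a` there is at most one arrow `c` with `ca ∉ I` -/
  left_notMem : ∀ {i j : P.V} (a : i ⟶ j),
    {c : Σ l : P.V, (l ⟶ i) | P.ofArrow c.2 * P.ofArrow a ≠ 0}.Subsingleton

/-- The presentation exhibits `A` as a gentle algebra. -/
structure IsGentle : Prop extends P.IsLocallyGentle where
  finiteDimensional : Module.Finite k A

/-- A path `p` of `Q` is a maximal path of `A` if `p ≠ 0` in `A`, and `pa = ap = 0` in `A` for
every arrow `a`. -/
def IsMaximalPath (p : Σ i j : P.V, Quiver.Path i j) : Prop :=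
  P.ofPath p.2.2 ≠ 0 ∧
    ∀ {i j : P.V} (a : i ⟶ j), P.ofPath p.2.2 * P.ofArrow a = 0 ∧ P.ofArrow a * P.ofPath p.2.2 = 0

/-- The presentation exhibits `A` as a gentle algebra with exactly one maximal path `p`, the path
`p` has `n` vertices (counted with repetitions), and `α` is the permutation of the positions
along `p` such that `α i = j` if `i ≠ j` and `p` has the same vertex at positions `i` and `j`,
and `α i = i` if there is no such `j`.  (The positions `1, …, n` are indexed by `Fin n`, starting
from `0`.) -/
def HasQuasiDiagram {n : ℕ} (α : Equiv.Perm (Fin n)) : Prop :=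
  P.IsGentle ∧ ∃ p : Σ i j : P.V, Quiver.Path i j,
    P.IsMaximalPath p ∧ (∀ q, P.IsMaximalPath q → q = p) ∧
    ∃ h : p.2.2.vertices.length = n,
      (∀ i j : Fin n, i ≠ j →
        p.2.2.vertices.get (i.cast h.symm) = p.2.2.vertices.get (j.cast h.symm) → α i = j) ∧
      (∀ i : Fin n, (∀ j : Fin n, i ≠ j →
        p.2.2.vertices.get (i.cast h.symm) ≠ p.2.2.vertices.get (j.cast h.symm)) → α i = i)

end QuiverPresentation

/-! ## The Yoneda algebra, Koszul duals and global dimension -/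

/-- The Yoneda algebra `Ext(X, X) = ⨁ₙ Extⁿ(X, X)` of an object of an abelian category.  The
product is the Yoneda product, written in the order of composition of maps (from right to left):
`x * y` is "first `y`, then `x`". -/
def YonedaAlgebra {C : Type*} [Category* C] [Abelian C] [HasExt.{w} C] (X : C) : Type w :=
  ⨁ n : ℕ, Abelian.Ext.{w} X X n

namespace YonedaAlgebra

open Abelian

variable {C : Type*} [Category* C] [Abelian C] [HasExt.{w} C] (X : C)

theorem mk_comp_eq {a b c c' : ℕ} (x : Ext.{w} X X a) (y : Ext.{w} X X b) (h : a + b = c)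
    (h' : a + b = c') :
    (GradedMonoid.mk c (x.comp y h) : GradedMonoid fun n => Ext.{w} X X n) =
      GradedMonoid.mk c' (x.comp y h') := by
  subst h; subst h'; rfl

noncomputable instance gOne : GradedMonoid.GOne fun n : ℕ => Ext.{w} X X n where
  one := Ext.mk₀ (𝟙 X)

noncomputable instance gMul : GradedMonoid.GMul fun n : ℕ => Ext.{w} X X n where
  mul x y := y.comp x (Nat.add_comm _ _)

noncomputable instance gMonoid : GradedMonoid.GMonoid fun n : ℕ => Ext.{w} X X n where
  one_mul := by
    rintro ⟨n, x⟩
    refine (mk_comp_eq X _ _ _ (Nat.add_zero n)).trans ?_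
    exact congrArg _ (Ext.comp_mk₀_id x)
  mul_one := by
    rintro ⟨n, x⟩
    refine (mk_comp_eq X _ _ _ (Nat.zero_add n)).trans ?_
    exact congrArg _ (Ext.mk₀_id_comp x)
  mul_assoc := by
    rintro ⟨a, x⟩ ⟨b, y⟩ ⟨c, z⟩
    have hab : b + a = a + b := Nat.add_comm _ _
    have hbc : c + b = b + c := Nat.add_comm _ _
    have habc : c + b + a = a + (b + c) := by omega
    exact (mk_comp_eq X z (y.comp x hab) (Nat.add_comm _ _)
      (by omega : c + (a + b) = a + (b + c))).trans
        (congrArg _ (Ext.comp_assoc z y x hbc hab habc).symm)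

noncomputable instance gRing : DirectSum.GRing fun n : ℕ => Ext.{w} X X n where
  __ := gMonoid X
  mul_zero _ := Ext.zero_comp _ _ _ _ _
  zero_mul _ := Ext.comp_zero _ _ _ _ _
  mul_add _ _ _ := Ext.add_comp _ _ _ _
  add_mul _ _ _ := Ext.comp_add _ _ _ _
  natCast n := n • Ext.mk₀ (𝟙 X)
  natCast_zero := zero_smul _ _
  natCast_succ n := by exact succ_nsmul _ _
  intCast n := n • Ext.mk₀ (𝟙 X)
  intCast_ofNat n := natCast_zsmul _ _
  intCast_negSucc_ofNat n := negSucc_zsmul _ _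

noncomputable instance : Ring (YonedaAlgebra.{w} X) :=
  inferInstanceAs (Ring (⨁ n : ℕ, Ext.{w} X X n))

variable {k : Type*} [Field k] [Linear k C]

noncomputable instance gAlgebra : DirectSum.GAlgebra k fun n : ℕ => Ext.{w} X X n where
  toFun := (LinearMap.toSpanSingleton k (Ext.{w} X X 0) (Ext.mk₀ (𝟙 X))).toAddMonoidHom
  map_one := one_smul k (Ext.mk₀ (𝟙 X))
  map_mul r s := by
    refine congrArg (GradedMonoid.mk 0) ?_
    change (r * s) • Ext.mk₀ (𝟙 X) = (s • Ext.mk₀ (𝟙 X)).comp (r • Ext.mk₀ (𝟙 X)) _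
    rw [Ext.comp_smul, Ext.smul_comp, Ext.mk₀_id_comp, mul_smul]
  commutes := by
    rintro r ⟨n, x⟩
    refine (mk_comp_eq X _ _ _ (Nat.add_zero n)).trans
      (Eq.trans ?_ (mk_comp_eq X _ _ (Nat.zero_add n) _))
    refine congrArg (GradedMonoid.mk n) ?_
    change x.comp (r • Ext.mk₀ (𝟙 X)) _ = (r • Ext.mk₀ (𝟙 X)).comp x _
    rw [Ext.comp_smul, Ext.smul_comp, Ext.mk₀_id_comp, Ext.comp_mk₀_id]
  smul_def := by
    rintro r ⟨n, x⟩
    refine Eq.trans ?_ (mk_comp_eq X _ _ (Nat.add_zero n) _)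
    refine congrArg (GradedMonoid.mk n) ?_
    change r • x = x.comp (r • Ext.mk₀ (𝟙 X)) _
    rw [Ext.comp_smul, Ext.comp_mk₀_id]

noncomputable instance : Algebra k (YonedaAlgebra.{w} X) :=
  inferInstanceAs (Algebra k (⨁ n : ℕ, Ext.{w} X X n))

end YonedaAlgebra

namespace QuiverPresentation

variable {k : Type v} {A : Type u} [Field k] [Ring A] [Algebra k A] (P : QuiverPresentation k A)

/-- The span of the classes of all paths of positive length, as a right ideal `A₊` of `A = kQ/I`.
Right `A`-modules are modules over the opposite ring `Aᵐᵒᵖ`. -/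
def positivePart : Submodule Aᵐᵒᵖ A :=
  Submodule.span Aᵐᵒᵖ {x | ∃ (i j : P.V) (p : Quiver.Path i j), 0 < p.length ∧ x = P.ofPath p}

/-- The right `A`-module `A₀ = A / A₊`, the degree zero part of `A = kQ/I` with respect to the
grading by path length. -/
abbrev degreeZero : ModuleCat.{u} Aᵐᵒᵖ :=
  ModuleCat.of Aᵐᵒᵖ (A ⧸ P.positivePart)

/-- The Koszul dual `A^! = Ext_A(A₀, A₀)`, as a `k`-algebra. -/
abbrev KoszulDual : Type u :=
  YonedaAlgebra.{u} P.degreeZero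

/-- The Koszul dual `A^!` is a gentle algebra with exactly one maximal path, and its associated
quasi-diagram is `β`. -/
def HasKoszulDualQuasiDiagram {m : ℕ} (β : Equiv.Perm (Fin m)) : Prop :=
  ∃ P' : QuiverPresentation k P.KoszulDual, P'.HasQuasiDiagram β

end QuiverPresentation

/-- The (right) global dimension of a ring: the supremum of the projective dimensions of all right
modules. -/
noncomputable def gldim (A : Type u) [Ring A] : WithBot ℕ∞ :=
  ⨆ M : ModuleCat.{u} Aᵐᵒᵖ, projectiveDimension M

/-! ## Quasi-diagrams -/

namespace QuasiDiagram

variable {n : ℕ} (α : Equiv.Perm (Fin n))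

/-- The faces of `α`: the cycles of `ζα` (trivial ones included), where `ζ = (1 2 ⋯ n)`. -/
def Face : Type :=
  Quotient (Equiv.Perm.SameCycle.setoid (finRotate n * α))

/-- `α` is maximal if it has exactly one face. -/
def IsMaximal : Prop := Nat.card (Face α) = 1

/-- Type A: a maximal quasi-diagram without isolated points. -/
def TypeA : Prop := IsMaximal α ∧ ∀ i, α i ≠ i

/-- Type B: a maximal quasi-diagram whose set of isolated points is non-empty and contained in
`{1, n}`. -/
def TypeB : Prop :=
  IsMaximal α ∧ (∃ i, α i = i) ∧ ∀ i : Fin n, α i = i → i.val = 0 ∨ i.val + 1 = n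

/-- Type C: `(1, n)` is a chord, there is exactly one isolated point, and there are exactly two
faces. -/
def TypeC : Prop :=
  (∃ i j : Fin n, i.val = 0 ∧ j.val + 1 = n ∧ i ≠ j ∧ α i = j ∧ α j = i) ∧
    (∃! i, α i = i) ∧ Nat.card (Face α) = 2

end QuasiDiagram

/-! The vertex idempotents and the paths containing no relation form a basis of a gentle algebra.
Everything then depends on two relations between arrows: `Nz a b` (nonzero product) and `Rel a b`
(composable with product zero). In each of them an arrow has at most one successor and at most one
predecessor. A `GentleFrame` records this data inside the algebra, and `IsLocallyGentle.frame` and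
`toPres` pass between frames and presentations.

Homological side. Let J be the radical. It is the direct sum of the right ideals aA, and the kernel
of the projective cover of aA is bA if `Rel a b`, and zero if there is no such b (`syzygy_exact`,
`cover_injective`). Hence minimal resolutions follow chains for `Rel`: the global dimension is the
length of a longest such chain (`gldim_le`, `le_gldim`), and Ext(A/J, A/J) has as basis the
idempotents and the Yoneda products of degree one classes along such chains. So the Koszul dual has
a frame with reversed arrows in which `Nz` and `Rel` are exchanged (`dual`, `dual_nz`, `dual_rel`).

Combinatorial side. If there is only one maximal path, it runs through each arrow exactly once
(`UniqueMax.isThread`), so that with n = N + 1 the arrows are numbered by `Fin N`. A `Rel`-step goes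
from the end of an arrow to the other position of the same vertex, so a `Rel`-chain follows an orbit
of αζ, a conjugate of ζα (`rel_iff`, `getElem_castSucc_eq`). Global dimension N means that some
chain has N arrows and none has more; bounded chains do not repeat, so such a chain contains every
arrow. The orbit breaks off either at the last position, which starts no arrow (one face, types A
and B), or at an isolated point, the last position being then a face of its own for αζ (type C).
This is `type_iff`.

Duality. A `Rel`-chain through all arrows is, read backwards, a maximal path of the dual frame, and
it is the only one (`uniqueMax_of_chain`). For the converse the presentation of the dual is
arbitrary. Since J is the set of nilpotent elements, it does not depend on the presentation; hence
neither do the uniqueness of the maximal path (`UniqueMax.of_J_eq`) and the lengths of nonzero words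
(`exists_chain_of_J_eq`). The dual diagram therefore has the same size n. The longest `Rel`-chain of
the dual is the maximal path of A, so the dual also has global dimension N, and its diagram is of
one of the three types.

Preservation of the type is then a parity matter: comparing signs in αζ shows that n is 0 modulo 4
in type A, 1 or 2 in type B, and 3 in type C, so the type can be read off from n. -/

/-! ## Frames: monomial bases of gentle algebras -/

/-- A basis of a `k`-algebra consisting of orthogonal idempotents `e v` and of the nonzero products
of elements `x a`, where `x a` is an arrow from `s a` to `t a`, subject to the combinatorial
conditions defining locally gentle algebras. -/
structure GentleFrame (k : Type v) (A : Type u) [Field k] [Ring A] [Algebra k A] where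
  /-- the vertices -/
  V : Type
  /-- the arrows -/
  E : Type
  [fintypeV : Fintype V]
  [finiteE : Finite E]
  /-- the source of an arrow -/
  s : E → V
  /-- the target of an arrow -/
  t : E → V
  /-- the idempotents -/
  e : V → A
  /-- the arrows as elements of the algebra -/
  x : E → A
  e_mul_self : ∀ i, e i * e i = e i
  e_mul_e : ∀ i j, i ≠ j → e i * e j = 0
  sum_e : ∑ i, e i = 1
  e_mul_x : ∀ a, e (s a) * x a = x a
  x_mul_e : ∀ a, x a * e (t a) = x a
  linearIndependent : LinearIndependent k (Sum.elim e
    (fun l : {l : List E // l ≠ [] ∧ l.IsChain (fun a b => x a * x b ≠ 0)} => (l.1.map x).prod))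
  span_eq_top : ⊤ ≤ Submodule.span k (Set.range (Sum.elim e
    (fun l : {l : List E // l ≠ [] ∧ l.IsChain (fun a b => x a * x b ≠ 0)} => (l.1.map x).prod)))
  card_in : ∀ i, Nat.card {a // t a = i} ≤ 2
  card_out : ∀ i, Nat.card {a // s a = i} ≤ 2
  nz_right : ∀ {a b c}, x a * x b ≠ 0 → x a * x c ≠ 0 → b = c
  nz_left : ∀ {a b c}, x a * x c ≠ 0 → x b * x c ≠ 0 → a = b
  rel_right : ∀ {a b c}, t a = s b → x a * x b = 0 → t a = s c → x a * x c = 0 → b = c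
  rel_left : ∀ {a b c}, t a = s c → x a * x c = 0 → t b = s c → x b * x c = 0 → a = b

namespace GentleFrame

attribute [instance] fintypeV finiteE

variable {k : Type v} {A : Type u} [Field k] [Ring A] [Algebra k A] (G : GentleFrame k A)

/-- The product of two arrows is nonzero. -/
def Nz (a b : G.E) : Prop := G.x a * G.x b ≠ 0

/-- Two arrows are composable with product zero. -/
def Rel (a b : G.E) : Prop := G.t a = G.s b ∧ G.x a * G.x b = 0

/-- Index type of the nonempty words which are nonzero in the algebra. -/
abbrev Word : Type := {l : List G.E // l ≠ [] ∧ l.IsChain (fun a b => G.x a * G.x b ≠ 0)}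

/-- The product of a list of arrows. -/
def W (l : List G.E) : A := (l.map G.x).prod

@[simp] lemma W_nil : G.W [] = 1 := rfl

@[simp] lemma W_cons (a : G.E) (l : List G.E) : G.W (a :: l) = G.x a * G.W l := by simp [W]

lemma W_append (l m : List G.E) : G.W (l ++ m) = G.W l * G.W m := by simp [W]

lemma x_mul_e_of_ne {a : G.E} {i : G.V} (h : G.t a ≠ i) : G.x a * G.e i = 0 := by
  rw [← G.x_mul_e, mul_assoc, G.e_mul_e _ _ h, mul_zero]

lemma e_mul_x_of_ne {a : G.E} {i : G.V} (h : G.s a ≠ i) : G.e i * G.x a = 0 := by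
  rw [← G.e_mul_x, ← mul_assoc, G.e_mul_e _ _ (Ne.symm h), zero_mul]

lemma Nz.t_eq_s {a b : G.E} (h : G.Nz a b) : G.t a = G.s b := by
  by_contra hne
  apply h
  rw [← G.e_mul_x b, ← mul_assoc, G.x_mul_e_of_ne hne, zero_mul]

lemma nz_or_rel {a b : G.E} (h : G.t a = G.s b) : G.Nz a b ∨ G.Rel a b := by
  by_cases h0 : G.x a * G.x b = 0
  · exact Or.inr ⟨h, h0⟩
  · exact Or.inl h0

lemma W_eq_zero {l : List G.E} (h : ¬ l.IsChain G.Nz) : G.W l = 0 := by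
  induction l with
  | nil => exact absurd List.IsChain.nil h
  | cons a l ih =>
    cases l with
    | nil => exact absurd (List.IsChain.singleton a) h
    | cons b l =>
      rw [List.isChain_cons_cons, not_and_or] at h
      rcases h with h | h
      · have : G.x a * G.x b = 0 := by simpa [Nz] using h
        rw [W_cons, W_cons, ← mul_assoc, this, zero_mul]
      · rw [W_cons, ih h, mul_zero]

lemma W_mul_e_getLast {l : List G.E} (h : l ≠ []) : G.W l * G.e (G.t (l.getLast h)) = G.W l := by
  obtain ⟨m, a, rfl⟩ : ∃ m a, l = m ++ [a] :=
    ⟨_, _, (List.dropLast_append_getLast h).symm⟩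
  simp [W_append, mul_assoc, x_mul_e]

lemma W_mul_e_of_ne {l : List G.E} (h : l ≠ []) {i : G.V} (hi : G.t (l.getLast h) ≠ i) :
    G.W l * G.e i = 0 := by
  rw [← W_mul_e_getLast G h, mul_assoc, G.e_mul_e _ _ hi, mul_zero]

/-- The basis of the algebra. -/
noncomputable def basis : Module.Basis (G.V ⊕ G.Word) k A :=
  Module.Basis.mk G.linearIndependent G.span_eq_top

@[simp] lemma basis_inl (i : G.V) : G.basis (Sum.inl i) = G.e i := by simp [basis]

@[simp] lemma basis_inr (l : G.Word) : G.basis (Sum.inr l) = G.W l.1 := by simp [basis, W]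

lemma W_ne_zero {l : List G.E} (h : l ≠ []) (hl : l.IsChain G.Nz) : G.W l ≠ 0 := by
  have := G.basis.ne_zero (Sum.inr ⟨l, h, hl⟩)
  simpa using this

lemma e_ne_zero (i : G.V) : G.e i ≠ 0 := by
  have := G.basis.ne_zero (Sum.inl i)
  simpa using this

lemma isChain_of_W_ne_zero {l : List G.E} (h : G.W l ≠ 0) : l.IsChain G.Nz := by
  by_contra hl; exact h (G.W_eq_zero hl)

theorem induction {p : A → Prop} (zero : p 0) (add : ∀ y z, p y → p z → p (y + z))
    (smul : ∀ (c : k) y, p y → p (c • y)) (idem : ∀ i, p (G.e i))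
    (word : ∀ l, l ≠ [] → l.IsChain G.Nz → p (G.W l)) (y : A) : p y := by
  have hy : y ∈ Submodule.span k (Set.range G.basis) := by rw [G.basis.span_eq]; trivial
  induction hy using Submodule.span_induction with
  | mem y h =>
    obtain ⟨i | l, rfl⟩ := h
    · rw [basis_inl]; exact idem i
    · rw [basis_inr]; exact word _ l.2.1 l.2.2
  | zero => exact zero
  | add y z _ _ hy hz => exact add y z hy hz
  | smul c y _ hy => exact smul c y hy

/-- The coefficient of an idempotent. -/
noncomputable def coordV (i : G.V) : A →ₗ[k] k := G.basis.coord (Sum.inl i)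

open Classical in
/-- The coefficient of a word. -/
noncomputable def coordW (l : List G.E) : A →ₗ[k] k :=
  if h : l ≠ [] ∧ l.IsChain (fun a b => G.x a * G.x b ≠ 0) then G.basis.coord (Sum.inr ⟨l, h⟩) else 0

open Classical in
lemma coordV_e (i j : G.V) : G.coordV i (G.e j) = if i = j then 1 else 0 := by
  rw [← basis_inl, coordV, Module.Basis.coord_apply, Module.Basis.repr_self, Finsupp.single_apply]
  simp [eq_comm]

@[simp] lemma coordV_W (i : G.V) {l : List G.E} (h : l ≠ []) : G.coordV i (G.W l) = 0 := by
  classical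
  by_cases hl : l.IsChain G.Nz
  · rw [show G.W l = G.basis (Sum.inr ⟨l, h, hl⟩) by simp, coordV, Module.Basis.coord_apply,
      Module.Basis.repr_self, Finsupp.single_apply]
    simp
  · rw [G.W_eq_zero hl, map_zero]

@[simp] lemma coordW_e (l : List G.E) (i : G.V) : G.coordW l (G.e i) = 0 := by
  classical
  unfold coordW
  split_ifs
  · rw [← basis_inl, Module.Basis.coord_apply, Module.Basis.repr_self, Finsupp.single_apply]
    simp
  · rfl

open Classical in
lemma coordW_W {l m : List G.E} (hm : m ≠ []) (hm' : m.IsChain G.Nz) :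
    G.coordW l (G.W m) = if l = m then 1 else 0 := by
  unfold coordW
  rw [show G.W m = G.basis (Sum.inr ⟨m, hm, hm'⟩) by simp]
  split_ifs with h1 h2 h2
  · subst h2
    rw [Module.Basis.coord_apply, Module.Basis.repr_self, Finsupp.single_eq_same]
  · rw [Module.Basis.coord_apply, Module.Basis.repr_self, Finsupp.single_apply, if_neg]
    simpa [eq_comm] using h2
  · subst h2; exact absurd ⟨hm, hm'⟩ h1
  · rfl

theorem ext_coord {y z : A} (hV : ∀ i, G.coordV i y = G.coordV i z)
    (hW : ∀ l, l ≠ [] → l.IsChain G.Nz → G.coordW l y = G.coordW l z) : y = z := by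
  apply G.basis.ext_elem
  rintro (i | l)
  · exact hV i
  · have := hW l.1 l.2.1 l.2.2
    rwa [coordW, dif_pos l.2] at this

lemma coordV_one (i : G.V) : G.coordV i 1 = 1 := by
  classical
  rw [← G.sum_e, map_sum]
  simp [coordV_e]

lemma e_mul_W {a : G.E} {l : List G.E} {i : G.V} (h : G.s a = i) :
    G.e i * G.W (a :: l) = G.W (a :: l) := by
  subst h
  rw [W_cons, ← mul_assoc, e_mul_x]

lemma e_mul_W_of_ne {a : G.E} {l : List G.E} {i : G.V} (h : G.s a ≠ i) :
    G.e i * G.W (a :: l) = 0 := by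
  rw [W_cons, ← mul_assoc, G.e_mul_x_of_ne h, zero_mul]

/-- Every product of a word with an element of the algebra has no idempotent component. -/
lemma coordV_W_mul (i : G.V) {l : List G.E} (h : l ≠ []) (z : A) : G.coordV i (G.W l * z) = 0 := by
  induction z using G.induction with
  | zero => simp
  | add y z hy hz => rw [mul_add, map_add, hy, hz, add_zero]
  | smul c y hy => rw [mul_smul_comm, map_smul, hy, smul_zero]
  | idem j =>
    by_cases hj : G.t (l.getLast h) = j
    · subst hj; rw [W_mul_e_getLast, coordV_W _ _ h]
    · rw [W_mul_e_of_ne _ h hj, map_zero]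
  | word m hm _ =>
    rw [← W_append, coordV_W]
    simp [h]

/-- The words span an ideal with quotient k^V, and this coefficient is the projection to one factor.
Being multiplicative, these characters make their common kernel `J` a two-sided ideal. -/
theorem coordV_mul (i : G.V) (y z : A) : G.coordV i (y * z) = G.coordV i y * G.coordV i z := by
  induction y using G.induction with
  | zero => simp
  | add y z hy hz => simp only [add_mul, map_add, hy, hz]
  | smul c y hy => rw [smul_mul_assoc, map_smul, hy, map_smul, smul_mul_assoc]
  | word l hl _ => rw [coordV_W_mul _ _ hl, coordV_W _ _ hl, zero_mul]
  | idem j =>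
  induction z using G.induction with
  | zero => simp
  | add y z hy hz => simp only [mul_add, map_add, hy, hz]
  | smul c y hy => rw [mul_smul_comm, map_smul, hy, map_smul, mul_smul_comm]
  | word l hl _ =>
    rw [coordV_W _ _ hl, mul_zero]
    obtain ⟨a, l, rfl⟩ := List.exists_cons_of_ne_nil hl
    by_cases h : G.s a = j
    · rw [e_mul_W _ h, coordV_W _ _ hl]
    · rw [e_mul_W_of_ne _ h, map_zero]
  | idem l =>
    classical
    by_cases h : j = l
    · subst h; rw [e_mul_self, coordV_e]; split_ifs <;> simp
    · rw [G.e_mul_e _ _ h, map_zero, coordV_e, coordV_e]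
      split_ifs with h1 h2
      · exact absurd (h1.symm.trans h2) h
      all_goals simp

/-- The radical: elements without idempotent component, as a right ideal. -/
def J : Submodule Aᵐᵒᵖ A where
  carrier := {y | ∀ i, G.coordV i y = 0}
  add_mem' hy hz i := by rw [map_add, hy i, hz i, add_zero]
  zero_mem' i := map_zero _
  smul_mem' c y hy i := by
    rw [MulOpposite.smul_eq_mul_unop, coordV_mul, hy i, zero_mul]

lemma mem_J {y : A} : y ∈ G.J ↔ ∀ i, G.coordV i y = 0 := Iff.rfl

lemma W_mem_J {l : List G.E} (h : l ≠ []) : G.W l ∈ G.J := fun i => G.coordV_W i h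

lemma x_mem_J (a : G.E) : G.x a ∈ G.J := by
  have := G.W_mem_J (l := [a]) (by simp)
  simpa using this

lemma mul_mem_J_left (y : A) {z : A} (hz : z ∈ G.J) : y * z ∈ G.J := fun i => by
  rw [coordV_mul, hz i, mul_zero]

lemma mul_mem_J_right {y : A} (hy : y ∈ G.J) (z : A) : y * z ∈ G.J := fun i => by
  rw [coordV_mul, hy i, zero_mul]

lemma sub_sum_mem_J (y : A) : y - ∑ i, G.coordV i y • G.e i ∈ G.J := fun i => by
  classical
  rw [map_sub, map_sum]
  simp [coordV_e]

theorem J_induction {p : A → Prop} (zero : p 0) (add : ∀ y z, p y → p z → p (y + z))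
    (smul : ∀ (c : k) y, p y → p (c • y))
    (word : ∀ l, l ≠ [] → l.IsChain G.Nz → p (G.W l)) {y : A} (hy : y ∈ G.J) : p y := by
  -- Induction over the basis runs through all of A, so the claim is proved for every element after
  -- subtracting its idempotent part, which is zero on `J`.
  have key : ∀ z : A, p (z - ∑ i, G.coordV i z • G.e i) := by
    intro z
    induction z using G.induction with
    | zero => simpa using zero
    | add y z hy hz =>
      have := add _ _ hy hz
      simpa [add_smul, Finset.sum_add_distrib, add_sub_add_comm] using this
    | smul c y hy =>
      have := smul c _ hy
      simpa [smul_sub, Finset.smul_sum, mul_smul] using this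
    | idem j =>
      classical
      simpa [coordV_e] using zero
    | word l hl hl' =>
      simpa [coordV_W _ _ hl] using word l hl hl'
  have := key y
  simpa [show ∀ i, G.coordV i y = 0 from hy] using this

/-! ### The projection to the words with a given first letter -/

open Classical in
/-- The projection to the span of the words with first letter `a`. -/
noncomputable def pr (a : G.E) : A →ₗ[k] A :=
  G.basis.constr k (Sum.elim (fun _ => 0) fun l => if l.1.head? = some a then G.W l.1 else 0)

@[simp] lemma pr_e (a : G.E) (i : G.V) : G.pr a (G.e i) = 0 := by
  rw [← basis_inl, pr, Module.Basis.constr_basis]; rfl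

open Classical in
lemma pr_W (a b : G.E) (l : List G.E) :
    G.pr a (G.W (b :: l)) = if b = a then G.W (b :: l) else 0 := by
  by_cases hl : (b :: l).IsChain G.Nz
  · rw [show G.W (b :: l) = G.basis (Sum.inr ⟨b :: l, by simp, hl⟩) by simp [-W_cons], pr,
      Module.Basis.constr_basis]
    simp [-W_cons]
  · rw [G.W_eq_zero hl, map_zero, ite_self]

lemma pr_x_of_ne {a b : G.E} (h : a ≠ b) : G.pr b (G.x a) = 0 := by
  classical
  have := G.pr_W b a []
  simpa [h] using this

lemma pr_W_mul (a : G.E) (b : G.E) (l : List G.E) (z : A) :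
    G.pr a (G.W (b :: l) * z) = G.pr a (G.W (b :: l)) * z := by
  classical
  induction z using G.induction with
  | zero => simp
  | add y z hy hz => rw [mul_add, map_add, hy, hz, mul_add]
  | smul c y hy => rw [mul_smul_comm, map_smul, hy, mul_smul_comm]
  | idem j =>
    by_cases hj : G.t ((b :: l).getLast (by simp)) = j
    · subst hj; rw [W_mul_e_getLast, pr_W, ite_mul, W_mul_e_getLast, zero_mul]
    · rw [W_mul_e_of_ne _ _ hj, map_zero, pr_W, ite_mul, W_mul_e_of_ne _ _ hj, zero_mul, ite_self]
  | word m hm _ =>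
    rw [← W_append, List.cons_append, pr_W, pr_W, ite_mul, ← W_append, zero_mul, List.cons_append]

/-- Right multiplication only changes a word at its end and so preserves its first letter.
Idempotents have no first letter to preserve, hence the restriction to `J`. -/
theorem pr_mul (a : G.E) {y : A} (hy : y ∈ G.J) (z : A) : G.pr a (y * z) = G.pr a y * z := by
  refine G.J_induction (p := fun y => G.pr a (y * z) = G.pr a y * z) (by simp) ?_ ?_ ?_ hy
  · intro y z hy hz; simp only [add_mul, map_add, hy, hz]
  · intro c y hy; rw [smul_mul_assoc, map_smul, hy, map_smul, smul_mul_assoc]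
  · intro l hl _
    obtain ⟨b, l, rfl⟩ := List.exists_cons_of_ne_nil hl
    exact pr_W_mul ..

lemma pr_x_mul_of_ne {a b : G.E} (h : a ≠ b) (z : A) : G.pr b (G.x a * z) = 0 := by
  rw [G.pr_mul _ (G.x_mem_J a), pr_x_of_ne _ h, zero_mul]

lemma exists_pr_eq (a : G.E) (y : A) : ∃ z, G.pr a y = G.x a * z := by
  classical
  induction y using G.induction with
  | zero => exact ⟨0, by simp⟩
  | add y z hy hz =>
    obtain ⟨y', hy⟩ := hy
    obtain ⟨z', hz⟩ := hz
    exact ⟨y' + z', by rw [map_add, hy, hz, mul_add]⟩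
  | smul c y hy =>
    obtain ⟨y', hy⟩ := hy
    exact ⟨c • y', by rw [map_smul, hy, mul_smul_comm]⟩
  | idem j => exact ⟨0, by simp⟩
  | word l hl _ =>
    obtain ⟨b, l, rfl⟩ := List.exists_cons_of_ne_nil hl
    by_cases h : b = a
    · exact ⟨G.W l, by rw [pr_W, if_pos h, W_cons, h]⟩
    · exact ⟨0, by rw [pr_W, if_neg h, mul_zero]⟩

lemma sum_pr [Fintype G.E] {y : A} (hy : y ∈ G.J) : ∑ a, G.pr a y = y := by
  classical
  refine G.J_induction (p := fun y => ∑ a, G.pr a y = y) (by simp) ?_ ?_ ?_ hy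
  · intro y z hy hz; simp only [map_add, Finset.sum_add_distrib, hy, hz]
  · intro c y hy; simp only [map_smul, ← Finset.smul_sum, hy]
  · intro l hl _
    obtain ⟨b, l, rfl⟩ := List.exists_cons_of_ne_nil hl
    simp [pr_W, -W_cons]

lemma coordV_pr (i : G.V) (a : G.E) (y : A) : G.coordV i (G.pr a y) = 0 := by
  obtain ⟨z, hz⟩ := G.exists_pr_eq a y
  rw [hz, coordV_mul, G.x_mem_J a i, zero_mul]

open Classical in
lemma coordW_pr (a b : G.E) (l : List G.E) (y : A) :
    G.coordW (b :: l) (G.pr a y) = if b = a then G.coordW (b :: l) y else 0 := by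
  induction y using G.induction with
  | zero => simp
  | add y z hy hz => simp only [map_add, hy, hz]; split_ifs <;> simp
  | smul c y hy => simp only [map_smul, hy]; split_ifs <;> simp
  | idem j => simp
  | word m hm hm' =>
    obtain ⟨c, m, rfl⟩ := List.exists_cons_of_ne_nil hm
    rw [pr_W, apply_ite (G.coordW (b :: l)), coordW_W _ hm hm', map_zero]
    simp only [List.cons.injEq]
    split_ifs <;> simp_all

/-! ### Left multiplication by an arrow -/

lemma coordW_singleton_x_mul (a : G.E) (y : A) :
    G.coordW [a] (G.x a * y) = G.coordV (G.t a) y := by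
  classical
  induction y using G.induction with
  | zero => simp
  | add y z hy hz => rw [mul_add, map_add, hy, hz, map_add]
  | smul c y hy => rw [mul_smul_comm, map_smul, hy, map_smul]
  | idem j =>
    rw [coordV_e]
    split_ifs with h
    · rw [← h, x_mul_e, show G.x a = G.W [a] by simp, coordW_W _ (by simp) (by simp), if_pos rfl]
    · rw [x_mul_e_of_ne _ h, map_zero]
  | word l hl _ =>
    rw [coordV_W _ _ hl, ← W_cons]
    by_cases h : (a :: l).IsChain G.Nz
    · rw [coordW_W _ (by simp) h, if_neg]
      simpa [eq_comm] using hl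
    · rw [W_eq_zero _ h, map_zero]

lemma coordW_cons_x_mul {a : G.E} {l : List G.E} (hl : l ≠ []) (h : (a :: l).IsChain G.Nz) (y : A) :
    G.coordW (a :: l) (G.x a * y) = G.coordW l y := by
  classical
  induction y using G.induction with
  | zero => simp
  | add y z hy hz => rw [mul_add, map_add, hy, hz, map_add]
  | smul c y hy => rw [mul_smul_comm, map_smul, hy, map_smul]
  | idem j =>
    rw [coordW_e]
    by_cases hj : G.t a = j
    · rw [← hj, x_mul_e, show G.x a = G.W [a] by simp, coordW_W _ (by simp) (by simp), if_neg]
      simpa using hl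
    · rw [x_mul_e_of_ne _ hj, map_zero]
  | word m hm hm' =>
    rw [coordW_W _ hm hm', ← W_cons]
    by_cases h' : (a :: m).IsChain G.Nz
    · rw [coordW_W _ (by simp) h']
      simp
    · rw [W_eq_zero _ h', map_zero, if_neg]
      rintro rfl; exact h' h

lemma coordV_e_mul_of_ne {i j : G.V} (h : i ≠ j) (y : A) : G.coordV i (G.e j * y) = 0 := by
  classical
  rw [coordV_mul, coordV_e, if_neg h, zero_mul]

lemma coordW_e_mul_of_ne {i : G.V} {a : G.E} (h : G.s a ≠ i) (l : List G.E) (y : A) :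
    G.coordW (a :: l) (G.e i * y) = 0 := by
  classical
  induction y using G.induction with
  | zero => simp
  | add y z hy hz => rw [mul_add, map_add, hy, hz, add_zero]
  | smul c y hy => rw [mul_smul_comm, map_smul, hy, smul_zero]
  | idem j =>
    by_cases hj : i = j
    · rw [← hj, e_mul_self, coordW_e]
    · rw [e_mul_e _ _ _ hj, map_zero]
  | word m hm hm' =>
    obtain ⟨c, m, rfl⟩ := List.exists_cons_of_ne_nil hm
    by_cases hc : G.s c = i
    · rw [e_mul_W _ hc, coordW_W _ hm hm', if_neg]
      intro h'
      apply h
      rw [← hc, (List.cons.inj h').1]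
    · rw [e_mul_W_of_ne _ hc, map_zero]

/-- Coordinates of an element annihilated by an arrow. -/
lemma coord_eq_zero_of_x_mul {a : G.E} {y : A} (hy : G.e (G.t a) * y = y) (h : G.x a * y = 0) :
    (∀ i, G.coordV i y = 0) ∧
      ∀ b l, (b :: l).IsChain G.Nz → ¬ G.Rel a b → G.coordW (b :: l) y = 0 := by
  constructor
  · intro i
    by_cases hi : i = G.t a
    · rw [hi, ← coordW_singleton_x_mul, h, map_zero]
    · rw [← hy, coordV_e_mul_of_ne _ hi]
  · intro b l hl hb
    by_cases hs : G.s b = G.t a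
    · have hnz : G.Nz a b := (G.nz_or_rel hs.symm).resolve_right hb
      rw [← G.coordW_cons_x_mul (a := a) (by simp) (List.isChain_cons_cons.2 ⟨hnz, hl⟩), h, map_zero]
    · rw [← hy, coordW_e_mul_of_ne _ hs]

/-- Left multiplication by `a` is injective on the words it does not kill. Among the words starting
at `t a` it kills exactly those whose first letter is a `Rel`-successor of `a`, and `b` is the only
one. -/
lemma pr_eq_of_x_mul_eq_zero {a b : G.E} (hab : G.Rel a b) {y : A} (hy : G.e (G.t a) * y = y)
    (h : G.x a * y = 0) : G.pr b y = y := by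
  classical
  obtain ⟨h1, h2⟩ := G.coord_eq_zero_of_x_mul hy h
  apply G.ext_coord
  · intro i; rw [coordV_pr, h1]
  · intro l hl hl'
    obtain ⟨c, l, rfl⟩ := List.exists_cons_of_ne_nil hl
    rw [coordW_pr]
    split_ifs with hc
    · rfl
    · rw [h2 _ _ hl']
      intro hac
      exact hc (G.rel_right hac.1 hac.2 hab.1 hab.2)

lemma eq_zero_of_x_mul_eq_zero {a : G.E} (ha : ∀ b, ¬ G.Rel a b) {y : A}
    (hy : G.e (G.t a) * y = y) (h : G.x a * y = 0) : y = 0 := by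
  obtain ⟨h1, h2⟩ := G.coord_eq_zero_of_x_mul hy h
  apply G.ext_coord
  · intro i; rw [h1, map_zero]
  · intro l hl hl'
    obtain ⟨c, l, rfl⟩ := List.exists_cons_of_ne_nil hl
    rw [h2 _ _ hl' (ha c), map_zero]

/-- The coefficient of an arrow is right linear on the radical. -/
lemma coordW_singleton_mul (a : G.E) {y : A} (hy : y ∈ G.J) (z : A) :
    G.coordW [a] (y * z) = G.coordW [a] y * G.coordV (G.t a) z := by
  classical
  have h1 : ∀ y : A, G.coordW [a] y = G.coordW [a] (G.pr a y) := fun y => by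
    rw [coordW_pr, if_pos rfl]
  rw [h1 (y * z), pr_mul _ _ hy, h1 y]
  obtain ⟨w, hw⟩ := G.exists_pr_eq a y
  rw [hw, mul_assoc, coordW_singleton_x_mul, coordW_singleton_x_mul, coordV_mul]

end GentleFrame

/-! ## Right ideals generated by arrows and short exact sequences -/

namespace GentleFrame

open Abelian MulOpposite

variable {k : Type v} {A : Type u} [Field k] [Ring A] [Algebra k A] (G : GentleFrame k A)

instance projective_op_self : Module.Projective Aᵐᵒᵖ A :=
  Module.Projective.of_equiv
    ({ toFun := fun r => r.unop
       invFun := fun y => op y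
       map_add' := fun _ _ => rfl
       map_smul' := fun r s => by simp
       left_inv := fun _ => rfl
       right_inv := fun _ => rfl } : Aᵐᵒᵖ ≃ₗ[Aᵐᵒᵖ] A)

/-- The right ideal generated by an arrow. -/
def M (a : G.E) : Submodule Aᵐᵒᵖ A := LinearMap.range (LinearMap.mulLeft Aᵐᵒᵖ (G.x a))

/-- The projective right ideal generated by an idempotent. -/
def Pe (i : G.V) : Submodule Aᵐᵒᵖ A := LinearMap.range (LinearMap.mulLeft Aᵐᵒᵖ (G.e i))

lemma x_mul_mem_M (a : G.E) (z : A) : G.x a * z ∈ G.M a := ⟨z, rfl⟩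

lemma x_mem_M (a : G.E) : G.x a ∈ G.M a := ⟨1, by simp⟩

lemma pr_mem_M (a : G.E) (z : A) : G.pr a z ∈ G.M a := by
  obtain ⟨w, hw⟩ := G.exists_pr_eq a z
  exact ⟨w, hw.symm⟩

lemma pr_eq_zero_of_mem_M {a b : G.E} (h : a ≠ b) {y : A} (hy : y ∈ G.M a) : G.pr b y = 0 := by
  obtain ⟨z, rfl⟩ := hy
  exact G.pr_x_mul_of_ne h z

lemma M_le_J (a : G.E) : G.M a ≤ G.J := by
  rintro _ ⟨z, rfl⟩
  exact G.mul_mem_J_right (G.x_mem_J a) z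

lemma mem_Pe {i : G.V} {y : A} : y ∈ G.Pe i ↔ G.e i * y = y := by
  constructor
  · rintro ⟨z, rfl⟩
    rw [LinearMap.mulLeft_apply, ← mul_assoc, e_mul_self]
  · intro h; exact ⟨y, h⟩

lemma M_le_Pe (b : G.E) : G.M b ≤ G.Pe (G.s b) := by
  rintro _ ⟨z, rfl⟩
  rw [mem_Pe, LinearMap.mulLeft_apply, ← mul_assoc, e_mul_x]

instance projective_Pe (i : G.V) : Module.Projective Aᵐᵒᵖ (G.Pe i) :=
  Module.Projective.of_split (G.Pe i).subtype (LinearMap.mulLeft Aᵐᵒᵖ (G.e i)).rangeRestrict (by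
    ext ⟨y, hy⟩
    exact G.mem_Pe.1 hy)

/-- The projective cover of the right ideal generated by an arrow. -/
def cover (a : G.E) : G.Pe (G.t a) →ₗ[Aᵐᵒᵖ] G.M a :=
  (LinearMap.mulLeft Aᵐᵒᵖ (G.x a)).rangeRestrict ∘ₗ (G.Pe (G.t a)).subtype

@[simp] lemma coe_cover (a : G.E) (y : G.Pe (G.t a)) : (G.cover a y : A) = G.x a * y := rfl

lemma cover_surjective (a : G.E) : Function.Surjective (G.cover a) := by
  rintro ⟨_, z, rfl⟩
  refine ⟨⟨G.e (G.t a) * z, z, rfl⟩, Subtype.ext ?_⟩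
  rw [coe_cover, ← mul_assoc, x_mul_e]
  rfl

lemma cover_injective {a : G.E} (ha : ∀ b, ¬ G.Rel a b) : Function.Injective (G.cover a) := by
  rw [injective_iff_map_eq_zero]
  rintro ⟨y, hy⟩ h
  exact Subtype.ext (G.eq_zero_of_x_mul_eq_zero ha (G.mem_Pe.1 hy) (congrArg Subtype.val h))

/-- The inclusion of the kernel of `cover`. -/
def syzygy {a b : G.E} (h : G.Rel a b) : G.M b →ₗ[Aᵐᵒᵖ] G.Pe (G.t a) :=
  Submodule.inclusion (h.1 ▸ G.M_le_Pe b)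

@[simp] lemma coe_syzygy {a b : G.E} (h : G.Rel a b) (y : G.M b) : (G.syzygy h y : A) = y := rfl

lemma syzygy_injective {a b : G.E} (h : G.Rel a b) : Function.Injective (G.syzygy h) :=
  Submodule.inclusion_injective _

/-- As `Rel`-successors are unique, the syzygy of aA is again generated by one arrow: the resolution
never branches. -/
lemma syzygy_exact {a b : G.E} (h : G.Rel a b) : Function.Exact (G.syzygy h) (G.cover a) := by
  rintro ⟨y, hy⟩
  constructor
  · intro h0
    have := G.pr_eq_of_x_mul_eq_zero h (G.mem_Pe.1 hy) (congrArg Subtype.val h0)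
    exact ⟨⟨y, this ▸ G.pr_mem_M b y⟩, rfl⟩
  · rintro ⟨⟨w, hw⟩, h'⟩
    obtain ⟨z, rfl⟩ : ∃ z, G.x b * z = w := hw
    rw [← h']
    refine Subtype.ext ?_
    rw [coe_cover, coe_syzygy]
    change G.x a * (G.x b * z) = 0
    rw [← mul_assoc, h.2, zero_mul]

/-- The inclusion of a right ideal generated by an arrow into the radical. -/
def inclJ (a : G.E) : G.M a →ₗ[Aᵐᵒᵖ] G.J := Submodule.inclusion (G.M_le_J a)

@[simp] lemma coe_inclJ (a : G.E) (y : G.M a) : (G.inclJ a y : A) = y := rfl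

/-- The projection of the radical to a right ideal generated by an arrow. -/
noncomputable def prJ (a : G.E) : G.J →ₗ[Aᵐᵒᵖ] G.M a where
  toFun y := ⟨G.pr a y, G.pr_mem_M a y⟩
  map_add' y z := by simp
  map_smul' r y := Subtype.ext (G.pr_mul a y.2 r.unop)

@[simp] lemma coe_prJ (a : G.E) (y : G.J) : (G.prJ a y : A) = G.pr a y := rfl

/-- Each nonempty word has exactly one first letter, so the radical splits into the right ideals aA.
-/
lemma sum_inclJ_prJ [Fintype G.E] : ∑ a, G.inclJ a ∘ₗ G.prJ a = LinearMap.id := by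
  ext ⟨y, hy⟩
  simpa [LinearMap.sum_apply] using G.sum_pr hy

end GentleFrame

/-! ### Projective dimension of arbitrary direct sums of copies of a module -/

section Finsupp

open Abelian

variable {R : Type u} [Ring R] (ι : Type u) {X Y Z : Type u} [AddCommGroup X] [AddCommGroup Y]
  [AddCommGroup Z] [Module R X] [Module R Y] [Module R Z]

/-- The functor `ι →₀ -` preserves exactness. -/
lemma finsupp_exact {f : X →ₗ[R] Y} {g : Y →ₗ[R] Z} (h : Function.Exact f g) :
    Function.Exact (Finsupp.mapRange.linearMap (α := ι) f) (Finsupp.mapRange.linearMap (α := ι) g) := by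
  classical
  intro y
  constructor
  · intro hy
    -- Preimages are chosen pointwise, with value 0 at 0 so that applying them entrywise preserves
    -- finite support.
    let h' : Y → X := fun y => if hy : g y = 0 ∧ y ≠ 0 then ((h y).1 hy.1).choose else 0
    have h0 : h' 0 = 0 := by simp [h']
    have h1 : ∀ y, g y = 0 → f (h' y) = y := by
      intro y hy
      by_cases h0 : y = 0
      · rw [h0]; simp [h']
      · simp only [h', dif_pos (⟨hy, h0⟩ : g y = 0 ∧ y ≠ 0)]
        exact ((h y).1 hy).choose_spec
    refine ⟨y.mapRange h' h0, ?_⟩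
    ext i
    simpa using h1 (y i) (by simpa using DFunLike.congr_fun hy i)
  · rintro ⟨x, rfl⟩
    ext i
    simpa using h.apply_apply_eq_zero (x i)

lemma projective_finsupp [Module.Projective R Y] : Module.Projective R (ι →₀ Y) := by
  classical
  exact Module.Projective.of_equiv (finsuppLequivDFinsupp R).symm

lemma hasProjectiveDimensionLT_finsupp_of_exact [Module.Projective R Y] {f : X →ₗ[R] Y}
    {g : Y →ₗ[R] Z} (h : Function.Exact f g) (hf : Function.Injective f)
    (hg : Function.Surjective g) (m : ℕ)
    (hX : HasProjectiveDimensionLT (ModuleCat.of R (ι →₀ X)) m) :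
    HasProjectiveDimensionLT (ModuleCat.of R (ι →₀ Z)) (m + 1) := by
  have hfg := finsupp_exact ι h
  have hS := ModuleCat.shortComplex_shortExact
    (ModuleCat.shortComplexOfCompEqZero (Finsupp.mapRange.linearMap (α := ι) f)
      (Finsupp.mapRange.linearMap (α := ι) g) hfg.linearMap_comp_eq_zero) hfg
    (Finsupp.mapRange_injective _ (map_zero _) hf) (Finsupp.mapRange_surjective _ (map_zero _) hg)
  refine hS.hasProjectiveDimensionLT_X₃ m hX ?_
  have : Projective (ModuleCat.of R (ι →₀ Y)) :=
    (IsProjective.iff_projective _).1 (projective_finsupp ι)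
  exact hasProjectiveDimensionLT_of_ge _ 1 _ (by omega)

lemma hasProjectiveDimensionLT_finsupp_of_projective [Module.Projective R Y] :
    HasProjectiveDimensionLT (ModuleCat.of R (ι →₀ Y)) 1 := by
  have : Projective (ModuleCat.of R (ι →₀ Y)) :=
    (IsProjective.iff_projective _).1 (projective_finsupp ι)
  infer_instance

/-- Every Ext class equals its composite with the identity, here a sum of maps factoring through the
`M a`, where the class vanishes. Orthogonality of the maps plays no role. -/
lemma hasProjectiveDimensionLT_finsupp_of_sum {κ : Type} [Fintype κ] {M : κ → Type u}
    [∀ a, AddCommGroup (M a)] [∀ a, Module R (M a)] (p : ∀ a, X →ₗ[R] M a) (i : ∀ a, M a →ₗ[R] X)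
    (h : ∑ a, i a ∘ₗ p a = LinearMap.id) (m : ℕ)
    (hM : ∀ a, HasProjectiveDimensionLT (ModuleCat.of R (ι →₀ M a)) m) :
    HasProjectiveDimensionLT (ModuleCat.of R (ι →₀ X)) m := by
  rw [hasProjectiveDimensionLT_iff.{u}]
  intro j hj Y y
  have hid : (∑ a, (ModuleCat.ofHom (Finsupp.mapRange.linearMap (α := ι) (p a)) ≫
      ModuleCat.ofHom (Finsupp.mapRange.linearMap (α := ι) (i a)))) =
      𝟙 (ModuleCat.of R (ι →₀ X)) := by
    apply ModuleCat.hom_ext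
    simp only [ModuleCat.hom_sum, ModuleCat.hom_comp, ModuleCat.hom_ofHom, ModuleCat.hom_id]
    refine LinearMap.ext fun y => Finsupp.ext fun j => ?_
    have := LinearMap.congr_fun h (y j)
    simpa [LinearMap.sum_apply, Finsupp.finsetSum_apply] using this
  rw [← Ext.mk₀_id_comp y, ← hid, Ext.mk₀_sum, Ext.sum_comp]
  refine Finset.sum_eq_zero fun a _ => ?_
  have := hM a
  rw [← Ext.mk₀_comp_mk₀_assoc, Ext.eq_zero_of_hasProjectiveDimensionLT
    ((Ext.mk₀ (ModuleCat.ofHom (Finsupp.mapRange.linearMap (α := ι) (i a)))).comp y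
      (zero_add j)) m hj, Ext.comp_zero]

end Finsupp

/-! ### Upper bound for the global dimension -/

namespace GentleFrame

open Abelian MulOpposite

variable {k : Type v} {A : Type u} [Field k] [Ring A] [Algebra k A] (G : GentleFrame k A)

/-- Each `Rel`-step costs one projective term, and aA is projective when no step is left. The case
`m = 0` is vacuous, since `[a]` is always a chain. Arbitrary multiples are allowed because the
modules to be resolved later need not be finitely generated. -/
lemma hasProjectiveDimensionLT_finsupp_M (ι : Type u) (m : ℕ) (a : G.E)
    (h : ∀ l : List G.E, l.length = m → ¬ (a :: l).IsChain G.Rel) :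
    HasProjectiveDimensionLT (ModuleCat.of Aᵐᵒᵖ (ι →₀ G.M a)) m := by
  induction m generalizing a with
  | zero => exact absurd (List.IsChain.singleton a) (h [] rfl)
  | succ m ih =>
    by_cases hb : ∃ b, G.Rel a b
    · obtain ⟨b, hb⟩ := hb
      exact hasProjectiveDimensionLT_finsupp_of_exact ι (G.syzygy_exact hb) (G.syzygy_injective hb)
        (G.cover_surjective a) m (ih b fun l hl hc => h (b :: l) (by simpa using hl)
          (List.isChain_cons_cons.2 ⟨hb, hc⟩))
    · push Not at hb
      have e := LinearEquiv.ofBijective (G.cover a) ⟨G.cover_injective hb, G.cover_surjective a⟩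
      have : Module.Projective Aᵐᵒᵖ (G.M a) := Module.Projective.of_equiv e
      have := hasProjectiveDimensionLT_finsupp_of_projective (R := Aᵐᵒᵖ) ι (Y := G.M a)
      exact hasProjectiveDimensionLT_of_ge _ 1 _ (by omega)

lemma hasProjectiveDimensionLT_finsupp_degreeZero (ι : Type u) (m : ℕ)
    (h : ∀ l : List G.E, l.length = m + 1 → ¬ l.IsChain G.Rel) :
    HasProjectiveDimensionLT (ModuleCat.of Aᵐᵒᵖ (ι →₀ A ⧸ G.J)) (m + 1) := by
  have := Fintype.ofFinite G.E
  refine hasProjectiveDimensionLT_finsupp_of_exact ι (LinearMap.exact_subtype_mkQ G.J)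
    G.J.injective_subtype G.J.mkQ_surjective m ?_
  exact hasProjectiveDimensionLT_finsupp_of_sum ι G.prJ G.inclJ G.sum_inclJ_prJ m fun a =>
    G.hasProjectiveDimensionLT_finsupp_M ι m a fun l hl => h (a :: l) (by simp [hl])

/-! ### Modules annihilated by the radical -/

/-- The semisimple subalgebra spanned by the idempotents. -/
noncomputable def diag : (G.V → k) →+* Aᵐᵒᵖ where
  toFun f := op (∑ i, f i • G.e i)
  map_one' := by simp [G.sum_e]
  map_zero' := by simp
  map_add' f g := by simp [add_smul, Finset.sum_add_distrib]
  map_mul' f g := by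
    classical
    rw [← op_mul]
    congr 1
    rw [Finset.sum_mul]
    refine Finset.sum_congr rfl fun i _ => ?_
    rw [Finset.mul_sum, Finset.sum_eq_single i]
    · rw [smul_mul_smul_comm, e_mul_self, Pi.mul_apply, mul_comm]
    · intro j _ hj
      rw [smul_mul_smul_comm, G.e_mul_e _ _ hj.symm, smul_zero]
    · simp

lemma smul_eq_diag_smul {X : Type*} [AddCommGroup X] [Module Aᵐᵒᵖ X]
    (hX : ∀ y ∈ G.J, ∀ m : X, op y • m = 0) (r : Aᵐᵒᵖ) (m : X) :
    r • m = G.diag (fun i => G.coordV i r.unop) • m := by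
  rw [← sub_eq_zero, ← sub_smul]
  exact hX _ (G.sub_sum_mem_J r.unop) m

/-- A module killed by J is a module over the semisimple ring k^V, so its canonical cover by copies
of A/J splits over k^V. Since A acts on both sides through k^V, the splitting is A-linear. -/
lemma exists_retraction {X : Type u} [AddCommGroup X] [Module Aᵐᵒᵖ X]
    (hX : ∀ y ∈ G.J, ∀ m : X, op y • m = 0) :
    ∃ (p : (X →₀ A ⧸ G.J) →ₗ[Aᵐᵒᵖ] X) (q : X →ₗ[Aᵐᵒᵖ] (X →₀ A ⧸ G.J)), p ∘ₗ q = LinearMap.id := by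
  let act (m : X) : A →ₗ[Aᵐᵒᵖ] X :=
    { toFun := fun y => op y • m
      map_add' := fun y z => by simp [add_smul]
      map_smul' := fun r y => by simp [mul_smul] }
  let p : (X →₀ A ⧸ G.J) →ₗ[Aᵐᵒᵖ] X :=
    Finsupp.lsum ℕ fun m => G.J.liftQ (act m) (fun y hy => hX y hy m)
  have hp : Function.Surjective p := fun m => ⟨Finsupp.single m (G.J.mkQ 1), by
    simp only [p, Finsupp.lsum_single]
    change op (1 : A) • m = m
    simp⟩
  have hF : ∀ y ∈ G.J, ∀ z : X →₀ A ⧸ G.J, op y • z = 0 := by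
    intro y hy z
    ext m
    obtain ⟨w, hw⟩ := G.J.mkQ_surjective (z m)
    rw [Finsupp.smul_apply, ← hw, ← map_smul, Finsupp.zero_apply, Submodule.mkQ_apply,
      Submodule.Quotient.mk_eq_zero]
    exact G.mul_mem_J_left w hy
  let : Module (G.V → k) X := Module.compHom X G.diag
  let : Module (G.V → k) (X →₀ A ⧸ G.J) := Module.compHom _ G.diag
  let p' : (X →₀ A ⧸ G.J) →ₗ[G.V → k] X :=
    { toFun := p
      map_add' := map_add p
      map_smul' := fun f z => p.map_smul (G.diag f) z }
  have := Module.projective_of_isSemisimpleRing (G.V → k) X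
  obtain ⟨q', hq⟩ := Module.projective_lifting_property p' LinearMap.id hp
  refine ⟨p, { toFun := q', map_add' := map_add q', map_smul' := fun r m => ?_ }, ?_⟩
  · rw [RingHom.id_apply, G.smul_eq_diag_smul hX, G.smul_eq_diag_smul hF]
    exact q'.map_smul (fun i => G.coordV i r.unop) m
  · ext m
    exact LinearMap.congr_fun hq m

lemma hasProjectiveDimensionLT_of_annihilated {m : ℕ}
    (h : ∀ l : List G.E, l.length = m + 1 → ¬ l.IsChain G.Rel)
    {X : Type u} [AddCommGroup X] [Module Aᵐᵒᵖ X]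
    (hX : ∀ y ∈ G.J, ∀ m : X, op y • m = 0) :
    HasProjectiveDimensionLT (ModuleCat.of Aᵐᵒᵖ X) (m + 1) := by
  obtain ⟨p, q, hpq⟩ := G.exists_retraction hX
  have := G.hasProjectiveDimensionLT_finsupp_degreeZero X m h
  refine Retract.hasProjectiveDimensionLT (Y := ModuleCat.of Aᵐᵒᵖ (X →₀ A ⧸ G.J))
    ⟨ModuleCat.ofHom q, ModuleCat.ofHom p, ?_⟩ (m + 1)
  rw [← ModuleCat.ofHom_comp, hpq, ModuleCat.ofHom_id]

/-- The submodule annihilated by the radical. -/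
def socle (X : Type u) [AddCommGroup X] [Module Aᵐᵒᵖ X] : Submodule Aᵐᵒᵖ X where
  carrier := {m | ∀ y ∈ G.J, op y • m = 0}
  add_mem' hm hn y hy := by rw [smul_add, hm y hy, hn y hy, add_zero]
  zero_mem' y _ := smul_zero _
  smul_mem' r m hm y hy := by
    rw [← mul_smul]
    exact hm _ (G.mul_mem_J_left r.unop hy)

lemma mem_socle {X : Type u} [AddCommGroup X] [Module Aᵐᵒᵖ X] {m : X}
    (h : ∀ a, op (G.x a) • m = 0) : m ∈ G.socle X := by
  intro y hy
  refine G.J_induction (p := fun y => op y • m = 0) (by simp) ?_ ?_ ?_ hy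
  · intro y z hy hz; rw [MulOpposite.op_add, add_smul, hy, hz, add_zero]
  · intro c y hy
    rw [← mul_one (c • y), smul_mul_assoc, ← mul_smul_comm, op_mul, mul_smul, hy, smul_zero]
  · intro l hl _
    obtain ⟨b, l, rfl⟩ := List.exists_cons_of_ne_nil hl
    rw [W_cons, op_mul, mul_smul, h, smul_zero]

/-- Induction on the Loewy length: the socle is killed by J, and the quotient by the socle is killed
by words shorter by one. -/
lemma hasProjectiveDimensionLT_of_words {m : ℕ}
    (h : ∀ l : List G.E, l.length = m + 1 → ¬ l.IsChain G.Rel) (j : ℕ) :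
    ∀ (X : Type u) [AddCommGroup X] [Module Aᵐᵒᵖ X],
      (∀ l : List G.E, l.length = j → ∀ m : X, op (G.W l) • m = 0) →
      HasProjectiveDimensionLT (ModuleCat.of Aᵐᵒᵖ X) (m + 1) := by
  induction j with
  | zero =>
    intro X _ _ hX
    have : Subsingleton X := subsingleton_of_forall_eq 0 fun m => by
      simpa using hX [] rfl m
    have h0 := (ModuleCat.isZero_of_subsingleton (ModuleCat.of Aᵐᵒᵖ X)).hasProjectiveDimensionLT_zero
    exact hasProjectiveDimensionLT_of_ge _ 0 _ (by omega)
  | succ j ih =>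
    intro X _ _ hX
    have hS := ModuleCat.shortComplex_shortExact
      (ModuleCat.shortComplexOfCompEqZero (G.socle X).subtype (G.socle X).mkQ
        (LinearMap.exact_subtype_mkQ _).linearMap_comp_eq_zero) (LinearMap.exact_subtype_mkQ _)
      (G.socle X).injective_subtype (G.socle X).mkQ_surjective
    refine hS.hasProjectiveDimensionLT_X₂ (m + 1)
      (G.hasProjectiveDimensionLT_of_annihilated h fun y hy m => Subtype.ext (m.2 y hy))
      (ih _ fun l hl q => ?_)
    obtain ⟨m, rfl⟩ := (G.socle X).mkQ_surjective q
    rw [← map_smul, Submodule.mkQ_apply, Submodule.Quotient.mk_eq_zero]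
    refine G.mem_socle fun a => ?_
    have := hX (l ++ [a]) (by simp [hl]) m
    rwa [W_append, op_mul, mul_smul, W_cons, W_nil, mul_one] at this

theorem gldim_le {m L : ℕ} (hL : ∀ l : List G.E, l.length = L → ¬ l.IsChain G.Nz)
    (h : ∀ l : List G.E, l.length = m + 1 → ¬ l.IsChain G.Rel) :
    gldim A ≤ (m : WithBot ℕ∞) := by
  refine iSup_le fun X => ?_
  rw [projectiveDimension_le_iff]
  refine G.hasProjectiveDimensionLT_of_words h L X fun l hl m => ?_
  rw [G.W_eq_zero (hL l hl), op_zero, zero_smul]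

end GentleFrame

/-! ## The Yoneda algebra of the degree zero part -/

namespace GentleFrame

open Abelian MulOpposite

variable {k : Type v} {A : Type u} [Field k] [Ring A] [Algebra k A] (G : GentleFrame k A)

/-- The degree zero part as a right module. -/
abbrev D : ModuleCat.{u} Aᵐᵒᵖ := ModuleCat.of Aᵐᵒᵖ (A ⧸ G.J)

lemma mk_eq_mk {y z : A} : G.J.mkQ y = G.J.mkQ z ↔ ∀ i, G.coordV i y = G.coordV i z := by
  rw [← sub_eq_zero, ← map_sub, Submodule.mkQ_apply, Submodule.Quotient.mk_eq_zero, mem_J]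
  simp [sub_eq_zero]

lemma op_smul_mkQ (y z : A) : op z • G.J.mkQ y = G.J.mkQ (y * z) := rfl

lemma mul_algebraMap (c : k) (y : A) : y * algebraMap k A c = c • y := by
  rw [← Algebra.commutes, Algebra.smul_def]

/-- The homomorphism from the radical to the degree zero part given by the coefficient of an
arrow. -/
noncomputable def φ (a : G.E) : G.J →ₗ[Aᵐᵒᵖ] A ⧸ G.J where
  toFun y := G.J.mkQ (G.coordW [a] (y : A) • G.e (G.t a))
  map_add' y z := by simp [add_smul]
  map_smul' r y := by
    classical
    obtain ⟨z, rfl⟩ := op_surjective r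
    change G.J.mkQ (G.coordW [a] ((y : A) * z) • G.e (G.t a)) =
      G.J.mkQ ((G.coordW [a] (y : A) • G.e (G.t a)) * z)
    rw [G.coordW_singleton_mul a y.2, mk_eq_mk]
    intro i
    rw [coordV_mul, map_smul, map_smul, coordV_e]
    split_ifs with h
    · subst h; simp
    · simp

lemma φ_apply (a : G.E) (y : G.J) :
    G.φ a y = G.J.mkQ (G.coordW [a] (y : A) • G.e (G.t a)) := rfl

lemma φ_inclJ_of_ne {a b : G.E} (h : a ≠ b) : G.φ b ∘ₗ G.inclJ a = 0 := by
  classical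
  ext y
  have h0 := G.coordW_pr b b [] (y : A)
  rw [G.pr_eq_zero_of_mem_M h y.2, if_pos rfl, map_zero] at h0
  rw [LinearMap.comp_apply, φ_apply, coe_inclJ, ← h0]
  simp

lemma φ_inclJ_prJ (a : G.E) : (G.φ a ∘ₗ G.inclJ a) ∘ₗ G.prJ a = G.φ a := by
  classical
  ext y
  simp only [LinearMap.comp_apply, φ_apply, coe_inclJ, coe_prJ]
  rw [coordW_pr, if_pos rfl]

/-- Left multiplication on the degree zero part by an idempotent. -/
def ψ (i : G.V) : A ⧸ G.J →ₗ[Aᵐᵒᵖ] A ⧸ G.J :=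
  G.J.mapQ G.J (LinearMap.mulLeft Aᵐᵒᵖ (G.e i)) fun _ hy => G.mul_mem_J_left _ hy

lemma ψ_mkQ (i : G.V) (y : A) : G.ψ i (G.J.mkQ y) = G.J.mkQ (G.e i * y) := rfl

/-- Left multiplication on the radical by an idempotent. -/
def ψJ (i : G.V) : G.J →ₗ[Aᵐᵒᵖ] G.J :=
  (LinearMap.mulLeft Aᵐᵒᵖ (G.e i)).restrict fun _ hy => G.mul_mem_J_left _ hy

lemma coordW_singleton_e_mul (a : G.E) (y : A) :
    G.coordW [a] (G.e (G.s a) * y) = G.coordW [a] y := by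
  conv_rhs => rw [← one_mul y, ← G.sum_e, Finset.sum_mul, map_sum]
  rw [Finset.sum_eq_single (G.s a)]
  · intro i _ hi
    exact G.coordW_e_mul_of_ne hi.symm _ _
  · simp

lemma φ_ψJ (a : G.E) : G.φ a ∘ₗ G.ψJ (G.s a) = G.φ a := by
  ext y
  rw [LinearMap.comp_apply, φ_apply, φ_apply, ← G.coordW_singleton_e_mul a y]
  rfl

lemma ψ_φ (a : G.E) : G.ψ (G.t a) ∘ₗ G.φ a = G.φ a := by
  ext y
  rw [LinearMap.comp_apply, φ_apply, ψ_mkQ, mul_smul_comm, e_mul_self]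

/-- The short exact sequence `0 → J → A → A/J → 0`. -/
abbrev sesJ : ShortComplex (ModuleCat.{u} Aᵐᵒᵖ) :=
  ModuleCat.shortComplexOfCompEqZero G.J.subtype G.J.mkQ
    (LinearMap.exact_subtype_mkQ G.J).linearMap_comp_eq_zero

lemma sesJ_shortExact : G.sesJ.ShortExact :=
  ModuleCat.shortComplex_shortExact _ (LinearMap.exact_subtype_mkQ G.J) G.J.injective_subtype
    G.J.mkQ_surjective

instance : Projective G.sesJ.X₂ := (IsProjective.iff_projective A).1 inferInstance

/-- The short exact sequence `0 → bA → e_{t(a)}A → aA → 0`, where `ab = 0`. -/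
abbrev sesM {a b : G.E} (h : G.Rel a b) : ShortComplex (ModuleCat.{u} Aᵐᵒᵖ) :=
  ModuleCat.shortComplexOfCompEqZero (G.syzygy h) (G.cover a)
    (G.syzygy_exact h).linearMap_comp_eq_zero

lemma sesM_shortExact {a b : G.E} (h : G.Rel a b) : (G.sesM h).ShortExact :=
  ModuleCat.shortComplex_shortExact _ (G.syzygy_exact h) (G.syzygy_injective h)
    (G.cover_surjective a)

instance {a b : G.E} (h : G.Rel a b) : Projective (G.sesM h).X₂ :=
  (IsProjective.iff_projective (G.Pe (G.t a))).1 inferInstance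

/-- The right ideal generated by an arrow, as an object of the module category. -/
abbrev MC (a : G.E) : ModuleCat.{u} Aᵐᵒᵖ := ModuleCat.of Aᵐᵒᵖ (G.M a)

/-- The radical as an object of the module category. -/
abbrev JC : ModuleCat.{u} Aᵐᵒᵖ := ModuleCat.of Aᵐᵒᵖ G.J

lemma projective_MC {a : G.E} (h : ∀ b, ¬ G.Rel a b) : Projective (G.MC a) :=
  have := Module.Projective.of_equiv
    (LinearEquiv.ofBijective (G.cover a) ⟨G.cover_injective h, G.cover_surjective a⟩)
  (IsProjective.iff_projective (G.M a)).1 this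

/-- The extension class of `0 → J → A → A/J → 0`. -/
noncomputable def δ : Ext.{u} G.D G.JC 1 := G.sesJ_shortExact.extClass

/-- The extension class of `0 → bA → e_{t(a)}A → aA → 0`. -/
noncomputable def η {a b : G.E} (h : G.Rel a b) : Ext.{u} (G.MC a) (G.MC b) 1 :=
  (G.sesM_shortExact h).extClass

/-- The top of the right ideal generated by an arrow. -/
noncomputable def π (a : G.E) : G.MC a ⟶ G.D := ModuleCat.ofHom (G.φ a ∘ₗ G.inclJ a)

/-- The degree one class attached to an arrow. -/
noncomputable def ξ (a : G.E) : Ext.{u} G.D G.D 1 :=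
  G.δ.comp (Ext.mk₀ (ModuleCat.ofHom (G.φ a) : G.JC ⟶ G.D)) (add_zero 1)

lemma π_apply_x_mul (a : G.E) (z : A) (h : G.x a * z ∈ G.M a) :
    (G.π a).hom ⟨G.x a * z, h⟩ = G.J.mkQ (G.coordV (G.t a) z • G.e (G.t a)) := by
  change G.J.mkQ (G.coordW [a] (G.x a * z) • G.e (G.t a)) = _
  rw [coordW_singleton_x_mul]

/-- The inclusion of `Pe (t a)` into A is the middle term of a morphism between the two short exact
sequences; naturality of extension classes does the rest. -/
lemma η_comp_inclJ {a b : G.E} (h : G.Rel a b) :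
    (G.η h).comp (Ext.mk₀ (ModuleCat.ofHom (G.inclJ b) : G.MC b ⟶ G.JC)) (add_zero 1) =
      (Ext.mk₀ (G.π a)).comp G.δ (zero_add 1) := by
  classical
  let f : G.sesM h ⟶ G.sesJ :=
    { τ₁ := ModuleCat.ofHom (G.inclJ b)
      τ₂ := ModuleCat.ofHom (G.Pe (G.t a)).subtype
      τ₃ := G.π a
      comm₁₂ := rfl
      comm₂₃ := by
        apply ModuleCat.hom_ext
        refine LinearMap.ext fun (y : G.Pe (G.t a)) => ?_
        change G.J.mkQ (y : A) = (G.π a).hom ⟨G.x a * (y : A), G.x_mul_mem_M a y⟩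
        rw [π_apply_x_mul, mk_eq_mk]
        intro i
        rw [map_smul, coordV_e]
        split_ifs with hi
        · rw [hi]; simp
        · rw [← G.mem_Pe.1 y.2, coordV_e_mul_of_ne _ hi]; simp }
  exact ShortComplex.ShortExact.extClass_naturality (G.sesM_shortExact h) G.sesJ_shortExact f

/-- The exchange rule that turns products of degree one classes into iterated syzygies: the map on
the right is `π b` if `c = b`, and zero otherwise. -/
lemma π_comp_ξ_of_rel {a b : G.E} (h : G.Rel a b) (c : G.E) :
    (Ext.mk₀ (G.π a)).comp (G.ξ c) (zero_add 1) =
      (G.η h).comp (Ext.mk₀ (ModuleCat.ofHom (G.φ c ∘ₗ G.inclJ b) : G.MC b ⟶ G.D))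
        (add_zero 1) := by
  rw [ξ, ← Ext.comp_assoc _ _ _ (zero_add 1) (add_zero 1) (by omega), ← η_comp_inclJ G h,
    Ext.comp_assoc _ _ _ (add_zero 1) (add_zero 0) (by omega), Ext.mk₀_comp_mk₀]
  rfl

lemma π_comp_ξ {a b : G.E} (h : G.Rel a b) :
    (Ext.mk₀ (G.π a)).comp (G.ξ b) (zero_add 1) =
      (G.η h).comp (Ext.mk₀ (G.π b)) (add_zero 1) := G.π_comp_ξ_of_rel h b

/-- There are two reasons for vanishing: either the syzygy of aA is cA with `c ≠ b`, on which `φ b`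
is zero, or aA is projective. -/
lemma π_comp_ξ_eq_zero {a b : G.E} (h : ¬ G.Rel a b) :
    (Ext.mk₀ (G.π a)).comp (G.ξ b) (zero_add 1) = 0 := by
  by_cases hc : ∃ c, G.Rel a c
  · obtain ⟨c, hc⟩ := hc
    have hne : c ≠ b := by rintro rfl; exact h hc
    rw [G.π_comp_ξ_of_rel hc, G.φ_inclJ_of_ne hne, ModuleCat.ofHom_zero, Ext.mk₀_zero,
      Ext.comp_zero]
  · push Not at hc
    have := G.projective_MC hc
    exact Ext.eq_zero_of_projective (n := 0) _

/-- The product of the degree one classes attached to a list of arrows. -/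
noncomputable def ξl : (l : List G.E) → Ext.{u} G.D G.D l.length
  | [] => Ext.mk₀ (𝟙 G.D)
  | a :: l => (G.ξ a).comp (ξl l) (by rw [List.length_cons, add_comm])

/-- The classes restricted to the right ideal generated by an arrow. -/
noncomputable def πξ (a : G.E) (l : List G.E) (m : ℕ) (h : l.length = m) :
    Ext.{u} (G.MC a) G.D m :=
  (Ext.mk₀ (G.π a)).comp (G.ξl l) (by omega)

lemma πξ_nil (a : G.E) (h : ([] : List G.E).length = 0) : G.πξ a [] 0 h = Ext.mk₀ (G.π a) := by
  simp [πξ, ξl]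

lemma πξ_cons {a b : G.E} (hab : G.Rel a b) (l : List G.E) (m : ℕ) (h : l.length = m)
    (h' : (b :: l).length = m + 1) :
    G.πξ a (b :: l) (m + 1) h' = (G.η hab).comp (G.πξ b l m h) (add_comm _ _) := by
  subst h
  rw [πξ, ξl, πξ, ← Ext.comp_assoc _ _ _ (zero_add 1) _ (by omega), π_comp_ξ G hab,
    Ext.comp_assoc _ _ _ (add_zero 1) (zero_add _) (by omega)]

/-- A map out of aA is determined by the image of the generator, which is fixed by `e (t a)` and so
lies on the corresponding line of A/J. -/
lemma exists_smul_π {a : G.E} (f : G.MC a ⟶ G.D) : ∃ c : k, Ext.mk₀ f = c • Ext.mk₀ (G.π a) := by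
  obtain ⟨w, hw⟩ := G.J.mkQ_surjective (f.hom ⟨G.x a, G.x_mem_M a⟩)
  refine ⟨G.coordV (G.t a) w, ?_⟩
  rw [← Ext.mk₀_smul]
  congr 1
  apply ModuleCat.hom_ext
  refine LinearMap.ext ?_
  rintro ⟨y, hy⟩
  obtain ⟨z, rfl⟩ : ∃ z, G.x a * z = y := hy
  have h1 : f.hom ⟨G.x a * z, G.x_mul_mem_M a z⟩ = G.J.mkQ (w * G.e (G.t a) * z) := by
    have : (⟨G.x a * z, G.x_mul_mem_M a z⟩ : G.M a) =
        op (G.e (G.t a) * z) • ⟨G.x a, G.x_mem_M a⟩ := by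
      refine Subtype.ext ?_
      change G.x a * z = G.x a * (G.e (G.t a) * z)
      rw [← mul_assoc, x_mul_e]
    rw [this, map_smul, ← hw, op_smul_mkQ, mul_assoc]
  refine h1.trans ?_
  change _ = op (algebraMap k A (G.coordV (G.t a) w)) • (G.π a).hom ⟨G.x a * z, G.x_mul_mem_M a z⟩
  rw [π_apply_x_mul]
  rw [op_smul_mkQ, mul_algebraMap, mk_eq_mk]
  intro i
  rw [coordV_mul, coordV_mul, map_smul, map_smul, smul_eq_mul, smul_eq_mul]
  classical
  rw [coordV_e]
  split_ifs with hi
  · rw [hi]; ring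
  · simp

/-- Dimension shifting along `sesM` lowers the degree until only the line Hom(cA, A/J) remains. If
the chain of relations ends too early, projectivity makes the Ext group zero. -/
lemma mem_span_πξ (m : ℕ) (a : G.E) (y : Ext.{u} (G.MC a) G.D m) :
    y ∈ Submodule.span k {z | ∃ (l : List G.E) (h : l.length = m), (a :: l).IsChain G.Rel ∧
      z = G.πξ a l m h} := by
  induction m generalizing a with
  | zero =>
    obtain ⟨f, rfl⟩ := Ext.mk₀_bijective _ _ |>.2 y
    obtain ⟨c, hc⟩ := G.exists_smul_π f
    rw [hc]
    exact Submodule.smul_mem _ _ (Submodule.subset_span ⟨[], rfl, by simp, (G.πξ_nil a _).symm⟩)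
  | succ m ih =>
    by_cases hb : ∃ b, G.Rel a b
    · obtain ⟨b, hb⟩ := hb
      obtain ⟨y', rfl⟩ := Ext.contravariant_sequence_exact₃ (G.sesM_shortExact hb) G.D y
        (Ext.eq_zero_of_projective _) (add_comm 1 m)
      change (G.η hb).comp (y' : Ext.{u} (G.MC b) G.D m) _ ∈ _
      induction ih b y' using Submodule.span_induction with
      | mem z hz =>
        obtain ⟨l, hl, hc, rfl⟩ := hz
        exact Submodule.subset_span ⟨b :: l, by simp [hl], List.isChain_cons_cons.2 ⟨hb, hc⟩,
          (G.πξ_cons hb l m hl _).symm⟩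
      | zero => rw [Ext.comp_zero]; exact Submodule.zero_mem _
      | add y z _ _ hy hz => rw [Ext.comp_add]; exact Submodule.add_mem _ hy hz
      | smul c y _ hy => rw [Ext.comp_smul]; exact Submodule.smul_mem _ _ hy
    · push Not at hb
      have := G.projective_MC hb
      rw [Ext.eq_zero_of_projective (n := m) y]
      exact Submodule.zero_mem _

lemma π_ne_zero (a : G.E) : G.π a ≠ 0 := by
  classical
  intro h
  have h1 := G.π_apply_x_mul a 1 (G.x_mul_mem_M a 1)
  rw [h] at h1
  have h2 := (G.mk_eq_mk (y := 0)).1 ((map_zero _).trans h1) (G.t a)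
  simp [coordV_one, coordV_e] at h2

/-- Minimality of the resolution: the syzygy lies in the radical, which every map to the semisimple
module A/J kills. -/
lemma syzygy_comp_eq_zero {a b : G.E} (h : G.Rel a b)
    (g : ModuleCat.of Aᵐᵒᵖ (G.Pe (G.t a)) ⟶ G.D) : ModuleCat.ofHom (G.syzygy h) ≫ g = 0 := by
  apply ModuleCat.hom_ext
  refine LinearMap.ext fun y => ?_
  change g.hom (G.syzygy h y) = 0
  have hy : G.syzygy h y = op (y : A) • (⟨G.e (G.t a), ⟨1, by simp⟩⟩ : G.Pe (G.t a)) :=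
    Subtype.ext (G.mem_Pe.1 (G.syzygy h y).2).symm
  obtain ⟨w, hw⟩ := G.J.mkQ_surjective (g.hom (⟨G.e (G.t a), ⟨1, by simp⟩⟩ : G.Pe (G.t a)))
  rw [hy, map_smul, ← hw, op_smul_mkQ, Submodule.mkQ_apply, Submodule.Quotient.mk_eq_zero]
  exact G.mul_mem_J_left w (G.M_le_J b y.2)

/-- Composition with `η` is injective: its kernel comes from the Ext group of the projective middle
term, which vanishes in positive degree and contributes nothing in degree zero by minimality. -/
lemma πξ_ne_zero (l : List G.E) (a : G.E) (m : ℕ) (h : l.length = m)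
    (hc : (a :: l).IsChain G.Rel) : G.πξ a l m h ≠ 0 := by
  induction l generalizing a m with
  | nil =>
    obtain rfl : 0 = m := h
    rw [πξ_nil, Ne, Ext.mk₀_eq_zero_iff]
    exact G.π_ne_zero a
  | cons b l ih =>
    obtain rfl : l.length + 1 = m := h
    rw [List.isChain_cons_cons] at hc
    rw [G.πξ_cons hc.1 l _ rfl]
    intro h0
    obtain ⟨y, hy⟩ := Ext.contravariant_sequence_exact₁ (G.sesM_shortExact hc.1) G.D _
      (add_comm 1 _) h0
    refine ih b _ rfl hc.2 ?_
    rw [← hy]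
    cases l with
    | nil =>
      obtain ⟨g, rfl⟩ := Ext.mk₀_bijective _ _ |>.2 y
      exact (Ext.mk₀_comp_mk₀ _ _).trans ((congrArg Ext.mk₀ (G.syzygy_comp_eq_zero hc.1 g)).trans
        (Ext.mk₀_zero _ _))
    | cons c l =>
      rw [Ext.eq_zero_of_projective (n := l.length) y]
      exact Ext.comp_zero ..

/-- Composition with the class of `0 → J → A → A/J → 0`. -/
noncomputable def δcomp (m : ℕ) : Ext.{u} G.JC G.D m →ₗ[k] Ext.{u} G.D G.D (m + 1) :=
  Ext.bilinearCompOfLinear k G.D G.JC G.D 1 m (m + 1) (add_comm _ _) G.δ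

lemma δcomp_apply (m : ℕ) (y : Ext.{u} G.JC G.D m) :
    G.δcomp m y = G.δ.comp y (add_comm _ _) := rfl

lemma subtype_comp_eq_zero (g : ModuleCat.of Aᵐᵒᵖ A ⟶ G.D) :
    ModuleCat.ofHom G.J.subtype ≫ g = 0 := by
  apply ModuleCat.hom_ext
  refine LinearMap.ext fun y => ?_
  change g.hom (y : A) = 0
  obtain ⟨w, hw⟩ := G.J.mkQ_surjective (g.hom (1 : A))
  have hy : (y : A) = op (y : A) • (1 : A) := by simp
  rw [hy, map_smul, ← hw, op_smul_mkQ, Submodule.mkQ_apply, Submodule.Quotient.mk_eq_zero]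
  exact G.mul_mem_J_left w y.2

/-- The same dimension shift for 0 → J → A → A/J → 0. Degree zero needs a separate argument: maps A
→ A/J exist, but they vanish on J. -/
lemma δcomp_bijective (m : ℕ) : Function.Bijective (G.δcomp m) := by
  constructor
  · rw [injective_iff_map_eq_zero]
    intro y hy
    obtain ⟨z, rfl⟩ := Ext.contravariant_sequence_exact₁ G.sesJ_shortExact G.D y (add_comm 1 m) hy
    cases m with
    | zero =>
      obtain ⟨g, rfl⟩ := Ext.mk₀_bijective _ _ |>.2 z
      exact (Ext.mk₀_comp_mk₀ _ _).trans ((congrArg Ext.mk₀ (G.subtype_comp_eq_zero g)).trans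
        (Ext.mk₀_zero _ _))
    | succ m =>
      rw [Ext.eq_zero_of_projective (n := m) z]
      exact Ext.comp_zero ..
  · intro y
    exact Ext.contravariant_sequence_exact₃ G.sesJ_shortExact G.D y
      (Ext.eq_zero_of_projective _) (add_comm 1 m)

/-- The inverse of dimension shifting, followed by restriction to an arrow. -/
noncomputable def res (a : G.E) (m : ℕ) : Ext.{u} G.D G.D (m + 1) →ₗ[k] Ext.{u} (G.MC a) G.D m :=
  (Ext.bilinearCompOfLinear k (G.MC a) G.JC G.D 0 m m (zero_add m)
    (Ext.mk₀ (ModuleCat.ofHom (G.inclJ a)))) ∘ₗ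
    (LinearEquiv.ofBijective (G.δcomp m) (G.δcomp_bijective m)).symm.toLinearMap

lemma res_ξl (a b : G.E) (l : List G.E) :
    G.res a l.length (G.ξl (b :: l)) =
      (Ext.mk₀ (ModuleCat.ofHom (G.φ b ∘ₗ G.inclJ a) : G.MC a ⟶ G.D)).comp (G.ξl l)
        (zero_add l.length) := by
  have h : G.ξl (b :: l) = G.δcomp l.length
      ((Ext.mk₀ (ModuleCat.ofHom (G.φ b) : G.JC ⟶ G.D)).comp (G.ξl l) (zero_add l.length)) := by
    rw [δcomp_apply, ξl, ξ, Ext.comp_assoc _ _ _ (add_zero 1) (zero_add l.length)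
      (by rw [List.length_cons]; omega)]
  rw [h, res, LinearMap.comp_apply, LinearEquiv.coe_coe,
    ← LinearEquiv.ofBijective_apply (G.δcomp l.length) (hf := G.δcomp_bijective _),
    LinearEquiv.symm_apply_apply]
  exact Ext.mk₀_comp_mk₀_assoc _ _ _

lemma res_ξl_same (a : G.E) (l : List G.E) :
    G.res a l.length (G.ξl (a :: l)) = G.πξ a l _ rfl := G.res_ξl a a l

lemma res_ξl_of_ne {a b : G.E} (h : a ≠ b) (l : List G.E) :
    G.res a l.length (G.ξl (b :: l)) = 0 := by
  rw [res_ξl, φ_inclJ_of_ne _ h, ModuleCat.ofHom_zero, Ext.mk₀_zero, Ext.zero_comp]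

lemma ξl_eq_zero {l : List G.E} (h : ¬ l.IsChain G.Rel) : G.ξl l = 0 := by
  induction l with
  | nil => simp at h
  | cons a l ih =>
    cases l with
    | nil => simp at h
    | cons b l =>
      rw [List.isChain_cons_cons, not_and_or] at h
      rcases h with h | h
      · have h2 : (G.ξ a).comp (G.ξ b) (rfl : 1 + 1 = 2) = 0 := by
          -- The class `ξ a` factors through the top of aA, so that `π_comp_ξ_eq_zero` becomes
          -- applicable.
          have h3 : G.ξ a = (G.δ.comp (Ext.mk₀ (ModuleCat.ofHom (G.prJ a) : G.JC ⟶ G.MC a))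
              (add_zero 1)).comp (Ext.mk₀ (G.π a)) (add_zero 1) := by
            rw [Ext.comp_assoc _ _ _ (add_zero 1) (add_zero 0) (by omega), Ext.mk₀_comp_mk₀, π,
              ← ModuleCat.ofHom_comp, φ_inclJ_prJ, ξ]
          rw [h3, Ext.comp_assoc _ _ _ (add_zero 1) (zero_add 1) (by omega),
            G.π_comp_ξ_eq_zero h, Ext.comp_zero]
        rw [ξl, ξl, ← Ext.comp_assoc _ _ _ (rfl : 1 + 1 = 2) _ (by simp; omega), h2, Ext.zero_comp]
      · rw [ξl, ih h, Ext.comp_zero]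

lemma ξl_ne_zero {a : G.E} {l : List G.E} (h : (a :: l).IsChain G.Rel) : G.ξl (a :: l) ≠ 0 := by
  intro h0
  apply G.πξ_ne_zero l a _ rfl h
  rw [← res_ξl_same, h0, map_zero]

/-- After the shift by `δ`, the identity of J is split into arrow summands and `mem_span_πξ` treats
each of them. Composing with the identity of A/J only transports a class from degree `l.length` to
degree `m + 1`. -/
lemma mem_span_ξl (m : ℕ) (y : Ext.{u} G.D G.D (m + 1)) :
    y ∈ Submodule.span k {z | ∃ (l : List G.E) (h : l.length = m + 1), l.IsChain G.Rel ∧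
      z = (Ext.mk₀ (𝟙 G.D)).comp (G.ξl l) (by omega)} := by
  have := Fintype.ofFinite G.E
  obtain ⟨z, rfl⟩ := (G.δcomp_bijective m).2 y
  have hid : (∑ a, (ModuleCat.ofHom (G.prJ a) ≫ ModuleCat.ofHom (G.inclJ a))) = 𝟙 G.JC := by
    apply ModuleCat.hom_ext
    simp only [ModuleCat.hom_sum, ModuleCat.hom_comp, ModuleCat.hom_ofHom, ModuleCat.hom_id]
    exact G.sum_inclJ_prJ
  rw [← Ext.mk₀_id_comp z, ← hid, Ext.mk₀_sum, Ext.sum_comp, map_sum]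
  refine Submodule.sum_mem _ fun a _ => ?_
  rw [← Ext.mk₀_comp_mk₀_assoc]
  have hz := G.mem_span_πξ m a ((Ext.mk₀ (ModuleCat.ofHom (G.inclJ a))).comp z (zero_add m))
  generalize (Ext.mk₀ (ModuleCat.ofHom (G.inclJ a))).comp z (zero_add m) = w at hz ⊢
  induction hz using Submodule.span_induction with
  | mem z hz =>
    obtain ⟨l, rfl, hc, rfl⟩ := hz
    refine Submodule.subset_span ⟨a :: l, rfl, hc, ?_⟩
    rw [Ext.mk₀_id_comp, δcomp_apply, πξ, Ext.mk₀_comp_mk₀_assoc, ξl, ξ,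
      ← Ext.comp_assoc _ _ _ (add_zero 1) (add_comm _ _) (by omega), π, ← ModuleCat.ofHom_comp,
      φ_inclJ_prJ]
  | zero => rw [Ext.comp_zero, map_zero]; exact Submodule.zero_mem _
  | add y z _ _ hy hz => rw [Ext.comp_add, map_add]; exact Submodule.add_mem _ hy hz
  | smul c y _ hy => rw [Ext.comp_smul, map_smul]; exact Submodule.smul_mem _ _ hy

theorem le_gldim [Nonempty G.V] {l : List G.E} (h : l.IsChain G.Rel) :
    (l.length : WithBot ℕ∞) ≤ gldim A := by
  refine le_trans ?_ (le_iSup (fun X : ModuleCat.{u} Aᵐᵒᵖ => projectiveDimension X) G.D)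
  have hcast : ((l.length : ℕ∞) : WithBot ℕ∞) = ((l.length : ℕ) : WithBot ℕ∞) := rfl
  rw [projectiveDimension_ge_iff]
  intro hpd
  -- The empty chain only requires A/J to be nonzero, which is where a vertex is needed; longer
  -- chains give nonzero Ext classes.
  cases l with
  | nil =>
    have h0 := (ModuleCat.isZero_of_iff_subsingleton (M := G.D)).1
      ((hasProjectiveDimensionLT_zero_iff_isZero _).1 hpd)
    obtain ⟨i⟩ := ‹Nonempty G.V›
    have h1 := G.mk_eq_mk.1 (h0.elim (G.J.mkQ 1) (G.J.mkQ 0)) i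
    simp [coordV_one] at h1
  | cons a l =>
    exact G.ξl_ne_zero h (Ext.eq_zero_of_hasProjectiveDimensionLT _ _ le_rfl)

end GentleFrame

/-! ### Homogeneous elements and components of Yoneda algebras -/

section Yoneda

open Abelian

variable {C : Type*} [Category* C] [Abelian C] [HasExt.{w} C] (X : C)
  {k : Type*} [Field k] [Linear k C]

/-- A homogeneous element of the Yoneda algebra. -/
noncomputable def YonedaAlgebra.of (n : ℕ) : Ext.{w} X X n →ₗ[k] YonedaAlgebra.{w} X :=
  DirectSum.lof k ℕ (fun n => Ext.{w} X X n) n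

/-- A homogeneous component of an element of the Yoneda algebra. -/
noncomputable def YonedaAlgebra.component (n : ℕ) : YonedaAlgebra.{w} X →ₗ[k] Ext.{w} X X n :=
  DirectSum.component k ℕ (fun n => Ext.{w} X X n) n

namespace YonedaAlgebra

lemma component_of (n : ℕ) (x : Ext.{w} X X n) :
    component X (k := k) n (of X (k := k) n x) = x := DirectSum.component.lof_self k n x

lemma component_of_ne {m n : ℕ} (h : m ≠ n) (x : Ext.{w} X X m) :
    component X (k := k) n (of X (k := k) m x) = 0 := by
  refine (DirectSum.component.of (R := k) n m x).trans ?_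
  rw [dif_neg h]

lemma of_mul_of {m n p : ℕ} (h : n + m = p) (x : Ext.{w} X X m) (y : Ext.{w} X X n) :
    of X (k := k) m x * of X (k := k) n y = of X (k := k) p (y.comp x h) := by
  subst h
  refine (DirectSum.of_mul_of (A := fun n => Ext.{w} X X n) x y).trans ?_
  exact DirectSum.of_eq_of_gradedMonoid_eq (mk_comp_eq X y x _ _)

lemma one_eq : (1 : YonedaAlgebra.{w} X) = of X (k := k) 0 (Ext.mk₀ (𝟙 X)) := rfl

lemma of_cast {m n : ℕ} (h : m = n) (h' : 0 + m = n) (x : Ext.{w} X X m) :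
    of X (k := k) n ((Ext.mk₀ (𝟙 X)).comp x h') = of X (k := k) m x := by
  subst h
  rw [Ext.mk₀_id_comp]

lemma mem_span {S : Submodule k (YonedaAlgebra.{w} X)} (h : ∀ n x, of X (k := k) n x ∈ S)
    (y : YonedaAlgebra.{w} X) : y ∈ S := by
  classical
  refine DirectSum.induction_on (motive := fun y : YonedaAlgebra.{w} X => y ∈ S) y ?_ ?_ ?_
  · exact S.zero_mem
  · intro n x; exact h n x
  · intro y z hy hz; exact S.add_mem hy hz

end YonedaAlgebra

end Yoneda

/-- A family is linearly independent if every member is separated from the others by a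
subspace. -/
lemma linearIndependent_of_separating {k ι M : Type*} [Field k] [AddCommGroup M] [Module k M]
    (f : ι → M) (h : ∀ i, ∃ S : Submodule k M, f i ∉ S ∧ ∀ j, j ≠ i → f j ∈ S) :
    LinearIndependent k f := by
  classical
  rw [linearIndependent_iff']
  intro s g hg i hi
  obtain ⟨S, h1, h2⟩ := h i
  by_contra h0
  apply h1
  rw [← Finset.add_sum_erase _ _ hi, add_eq_zero_iff_eq_neg] at hg
  rw [← S.smul_mem_iff h0, hg]
  exact S.neg_mem (S.sum_mem fun j hj => S.smul_mem _ (h2 j (Finset.ne_of_mem_erase hj)))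

/-- Two chains of the same length with the same first entry agree if successors are unique. -/
lemma List.IsChain.eq_of_length {E : Type*} {R : E → E → Prop}
    (hR : ∀ {a b c}, R a b → R a c → b = c) {a : E} {l m : List E} (hl : (a :: l).IsChain R)
    (hm : (a :: m).IsChain R) (h : l.length = m.length) : l = m := by
  induction l generalizing a m with
  | nil => exact (List.length_eq_zero_iff.1 h.symm).symm
  | cons b l ih =>
    cases m with
    | nil => simp at h
    | cons c m =>
      rw [List.isChain_cons_cons] at hl hm
      obtain rfl := hR hl.1 hm.1
      rw [ih hl.2 hm.2 (by simpa using h)]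

/-! ### Monomial basis of the Koszul dual and the dual frame -/

namespace GentleFrame

open Abelian MulOpposite

variable {k : Type v} {A : Type u} [Field k] [Ring A] [Algebra k A] (G : GentleFrame k A)

/-- The Yoneda algebra of the degree zero part. -/
abbrev Y : Type u := YonedaAlgebra.{u} G.D

/-- Idempotents of the Yoneda algebra. -/
noncomputable def Ye (i : G.V) : G.Y := YonedaAlgebra.of G.D (k := k) 0 (Ext.mk₀ (ModuleCat.ofHom (G.ψ i)))

/-- Arrows of the Yoneda algebra. -/
noncomputable def Yx (a : G.E) : G.Y := YonedaAlgebra.of G.D (k := k) 1 (G.ξ a)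

/-- Words of the Yoneda algebra. -/
noncomputable def Yl (l : List G.E) : G.Y := YonedaAlgebra.of G.D (k := k) l.length (G.ξl l)

/-- The Yoneda algebra multiplies from right to left while `ξl` composes from left to right; this is
why the dual frame reverses the arrows. -/
lemma Yl_cons (a : G.E) (l : List G.E) : G.Yl (a :: l) = G.Yl l * G.Yx a := by
  rw [Yl, Yl, Yx, YonedaAlgebra.of_mul_of G.D 
    (show 1 + l.length = (a :: l).length by rw [List.length_cons, add_comm]), ξl]

lemma prod_map_Yx (l : List G.E) : (l.reverse.map G.Yx).prod = G.Yl l := by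
  induction l with
  | nil => exact YonedaAlgebra.one_eq G.D
  | cons a l ih => rw [List.reverse_cons, List.map_append, List.prod_append, ih, Yl_cons]; simp

lemma prod_map_Yx' (l : List G.E) : (l.map G.Yx).prod = G.Yl l.reverse := by
  rw [← prod_map_Yx, List.reverse_reverse]

lemma Yl_eq_zero {l : List G.E} (h : ¬ l.IsChain G.Rel) : G.Yl l = 0 := by
  rw [Yl, G.ξl_eq_zero h, map_zero]

lemma of_injective (n : ℕ) : Function.Injective (YonedaAlgebra.of G.D (k := k) n) := by
  intro x y h
  rw [← YonedaAlgebra.component_of G.D (k := k) n x, h, YonedaAlgebra.component_of]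

lemma Yl_ne_zero {a : G.E} {l : List G.E} (h : (a :: l).IsChain G.Rel) : G.Yl (a :: l) ≠ 0 := by
  rw [Yl, Ne, map_eq_zero_iff _ (G.of_injective _)]
  exact G.ξl_ne_zero h

lemma Yx_mul_Yx (a b : G.E) : G.Yx a * G.Yx b = G.Yl [b, a] := by
  rw [← prod_map_Yx]; simp

lemma Yx_mul_Yx_ne_zero_iff {a b : G.E} : G.Yx a * G.Yx b ≠ 0 ↔ G.Rel b a := by
  rw [Yx_mul_Yx]
  constructor
  · intro h
    by_contra h'
    exact h (G.Yl_eq_zero (by simpa using h'))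
  · intro h
    exact G.Yl_ne_zero (by simpa using h)

lemma isChain_Yx_iff {l : List G.E} :
    l.IsChain (fun a b => G.Yx a * G.Yx b ≠ 0) ↔ l.reverse.IsChain G.Rel := by
  rw [List.isChain_reverse]
  exact List.IsChain.iff fun a b => G.Yx_mul_Yx_ne_zero_iff

lemma Ye_mul_Ye (i j : G.V) :
    G.Ye i * G.Ye j = YonedaAlgebra.of G.D (k := k) 0 (Ext.mk₀ (ModuleCat.ofHom (G.ψ i ∘ₗ G.ψ j))) := by
  rw [Ye, Ye, YonedaAlgebra.of_mul_of G.D (zero_add 0), Ext.mk₀_comp_mk₀, ModuleCat.ofHom_comp]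

lemma Ye_mul_self (i : G.V) : G.Ye i * G.Ye i = G.Ye i := by
  rw [Ye_mul_Ye, Ye]
  congr 3
  refine LinearMap.ext fun y => ?_
  obtain ⟨y, rfl⟩ := G.J.mkQ_surjective y
  rw [LinearMap.comp_apply, ψ_mkQ, ψ_mkQ, ← mul_assoc, e_mul_self]

lemma Ye_mul_Ye_of_ne {i j : G.V} (h : i ≠ j) : G.Ye i * G.Ye j = 0 := by
  have : G.ψ i ∘ₗ G.ψ j = 0 := by
    refine LinearMap.ext fun y => ?_
    obtain ⟨y, rfl⟩ := G.J.mkQ_surjective y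
    rw [LinearMap.comp_apply, ψ_mkQ, ψ_mkQ, ← mul_assoc, G.e_mul_e _ _ h, zero_mul]
    rfl
  rw [Ye_mul_Ye, this, ModuleCat.ofHom_zero, Ext.mk₀_zero, map_zero]

lemma sum_Ye : ∑ i, G.Ye i = 1 := by
  unfold Ye
  rw [← map_sum, ← Ext.mk₀_sum, YonedaAlgebra.one_eq G.D (k := k)]
  congr 2
  apply ModuleCat.hom_ext
  simp only [ModuleCat.hom_sum, ModuleCat.hom_ofHom, ModuleCat.hom_id]
  refine LinearMap.ext fun y => ?_
  obtain ⟨y, rfl⟩ := G.J.mkQ_surjective y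
  rw [LinearMap.sum_apply]
  simp_rw [ψ_mkQ]
  rw [← map_sum, ← Finset.sum_mul, sum_e, one_mul]
  rfl

lemma Ye_mul_Yx (a : G.E) : G.Ye (G.t a) * G.Yx a = G.Yx a := by
  rw [Ye, Yx, YonedaAlgebra.of_mul_of G.D (add_zero 1), ξ,
    Ext.comp_assoc _ _ _ (add_zero 1) (add_zero 0) (by omega), Ext.mk₀_comp_mk₀,
    ← ModuleCat.ofHom_comp, ψ_φ]

lemma ψ_comp_δ (i : G.V) :
    (Ext.mk₀ (ModuleCat.ofHom (G.ψ i) : G.D ⟶ G.D)).comp G.δ (zero_add 1) =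
      G.δ.comp (Ext.mk₀ (ModuleCat.ofHom (G.ψJ i) : G.JC ⟶ G.JC)) (add_zero 1) := by
  let f : G.sesJ ⟶ G.sesJ :=
    { τ₁ := ModuleCat.ofHom (G.ψJ i)
      τ₂ := ModuleCat.ofHom (LinearMap.mulLeft Aᵐᵒᵖ (G.e i))
      τ₃ := ModuleCat.ofHom (G.ψ i)
      comm₁₂ := rfl
      comm₂₃ := rfl }
  exact (ShortComplex.ShortExact.extClass_naturality G.sesJ_shortExact G.sesJ_shortExact f).symm

lemma Yx_mul_Ye (a : G.E) : G.Yx a * G.Ye (G.s a) = G.Yx a := by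
  rw [Ye, Yx, YonedaAlgebra.of_mul_of G.D (zero_add 1), ξ,
    ← Ext.comp_assoc _ _ _ (zero_add 1) (add_zero 1) (by omega), ψ_comp_δ,
    Ext.comp_assoc _ _ _ (add_zero 1) (add_zero 0) (by omega), Ext.mk₀_comp_mk₀,
    ← ModuleCat.ofHom_comp, φ_ψJ]

/-- The coefficient of an idempotent in the degree zero part. -/
noncomputable def coordVQ (i : G.V) : (A ⧸ G.J) → k :=
  fun q => Quotient.liftOn' q (G.coordV i) fun y z h => by
    have := (G.J.quotientRel_def.1 h) i
    rwa [map_sub, sub_eq_zero] at this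

lemma coordVQ_mkQ (i : G.V) (y : A) : G.coordVQ i (G.J.mkQ y) = G.coordV i y := rfl

/-- The coefficient of an idempotent in the degree zero endomorphisms. -/
noncomputable def coordHom (i : G.V) : Ext.{u} G.D G.D 0 →ₗ[k] k where
  toFun f := G.coordVQ i ((Ext.homEquiv₀ f).hom (G.J.mkQ 1))
  map_add' f g := by
    obtain ⟨f, rfl⟩ := Ext.mk₀_bijective _ _ |>.2 f
    obtain ⟨g, rfl⟩ := Ext.mk₀_bijective _ _ |>.2 g
    rw [← Ext.mk₀_add]
    have h (f : G.D ⟶ G.D) : Ext.homEquiv₀ (Ext.mk₀ f) = f := Ext.homEquiv₀.right_inv f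
    rw [h, h, h, ModuleCat.hom_add, LinearMap.add_apply]
    obtain ⟨y, hy⟩ := G.J.mkQ_surjective (f.hom (G.J.mkQ 1))
    obtain ⟨z, hz⟩ := G.J.mkQ_surjective (g.hom (G.J.mkQ 1))
    rw [← hy, ← hz, ← map_add, coordVQ_mkQ, coordVQ_mkQ, coordVQ_mkQ, map_add]
  map_smul' c f := by
    obtain ⟨f, rfl⟩ := Ext.mk₀_bijective _ _ |>.2 f
    rw [← Ext.mk₀_smul]
    have h (f : G.D ⟶ G.D) : Ext.homEquiv₀ (Ext.mk₀ f) = f := Ext.homEquiv₀.right_inv f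
    rw [h, h]
    change G.coordVQ i (op (algebraMap k A c) • f.hom (G.J.mkQ 1)) = _
    obtain ⟨y, hy⟩ := G.J.mkQ_surjective (f.hom (G.J.mkQ 1))
    rw [← hy, op_smul_mkQ, mul_algebraMap, coordVQ_mkQ, coordVQ_mkQ, map_smul]
    rfl

lemma coordHom_mk₀ (i : G.V) (f : G.D ⟶ G.D) :
    G.coordHom i (Ext.mk₀ f) = G.coordVQ i (f.hom (G.J.mkQ 1)) := by
  have h : Ext.homEquiv₀ (Ext.mk₀ f) = f := Ext.homEquiv₀.right_inv f
  change G.coordVQ i ((Ext.homEquiv₀ (Ext.mk₀ f)).hom (G.J.mkQ 1)) = _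
  rw [h]

/-- An endomorphism of A/J is left multiplication by the image of 1, and modulo J that image is a
combination of idempotents. -/
lemma mk₀_eq_sum (f : G.D ⟶ G.D) :
    Ext.mk₀ f = ∑ i, G.coordHom i (Ext.mk₀ f) • Ext.mk₀ (ModuleCat.ofHom (G.ψ i)) := by
  simp_rw [coordHom_mk₀, ← Ext.mk₀_smul]
  rw [← Ext.mk₀_sum]
  congr 1
  apply ModuleCat.hom_ext
  rw [ModuleCat.hom_sum]
  refine LinearMap.ext fun y => ?_
  obtain ⟨y, rfl⟩ := G.J.mkQ_surjective y
  obtain ⟨w, hw⟩ := G.J.mkQ_surjective (f.hom (G.J.mkQ 1))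
  have h1 : f.hom (G.J.mkQ y) = G.J.mkQ (w * y) := by
    have : G.J.mkQ y = op y • G.J.mkQ 1 := by rw [op_smul_mkQ, one_mul]
    rw [this, map_smul, ← hw, op_smul_mkQ]
  rw [h1, LinearMap.sum_apply]
  have h2 (i : G.V) (c : k) : op (algebraMap k A c) • G.J.mkQ (G.e i * y) =
      G.J.mkQ (c • (G.e i * y)) := by rw [op_smul_mkQ, mul_algebraMap]
  refine Eq.trans ?_ (Finset.sum_congr rfl fun i _ => (h2 i _).symm)
  rw [← map_sum, mk_eq_mk]
  intro j
  classical
  rw [← hw, coordV_mul, map_sum, Finset.sum_eq_single j]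
  · rw [map_smul, coordV_mul, coordV_e, if_pos rfl, one_mul, coordVQ_mkQ, smul_eq_mul]
  · intro i _ hi
    rw [map_smul, coordV_mul, coordV_e, if_neg hi.symm, zero_mul, smul_zero]
  · simp

open Classical in
lemma coordHom_ψ (i j : G.V) :
    G.coordHom i (Ext.mk₀ (ModuleCat.ofHom (G.ψ j))) = if i = j then 1 else 0 := by
  rw [coordHom_mk₀, ModuleCat.hom_ofHom, ψ_mkQ, mul_one, coordVQ_mkQ, coordV_e]

/-- The basis family of the Yoneda algebra. -/
noncomputable def Yfamily : G.V ⊕ {l : List G.E // l ≠ [] ∧ l.IsChain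
    (fun a b => G.Yx a * G.Yx b ≠ 0)} → G.Y :=
  Sum.elim G.Ye (fun l => (l.1.map G.Yx).prod)

lemma Yfamily_inl (i : G.V) : G.Yfamily (Sum.inl i) = G.Ye i := rfl

lemma Yfamily_inr (l) : G.Yfamily (Sum.inr l) = (l.1.map G.Yx).prod := rfl

/-- A word is separated from the others by its degree and by restriction to its first arrow. These
suffice because `Rel`-chains of equal length with the same first arrow coincide. -/
lemma linearIndependent_Yfamily : LinearIndependent k G.Yfamily := by
  classical
  apply linearIndependent_of_separating
  rintro (i | ⟨l, hl, hc⟩)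
  · refine ⟨LinearMap.ker ((G.coordHom i) ∘ₗ YonedaAlgebra.component G.D (k := k) 0), ?_, ?_⟩
    · rw [LinearMap.mem_ker, LinearMap.comp_apply, Yfamily_inl, Ye, YonedaAlgebra.component_of, coordHom_ψ, if_pos rfl]
      exact one_ne_zero
    · rintro (j | ⟨m, hm, hm'⟩) hj
      · rw [LinearMap.mem_ker, LinearMap.comp_apply, Yfamily_inl, Ye, YonedaAlgebra.component_of, coordHom_ψ, if_neg]
        rintro rfl; exact hj rfl
      · rw [LinearMap.mem_ker, LinearMap.comp_apply, Yfamily_inr, prod_map_Yx', Yl, YonedaAlgebra.component_of_ne,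
          map_zero]
        simpa using hm
  · rw [isChain_Yx_iff] at hc
    obtain ⟨a, r, hr⟩ := List.exists_cons_of_ne_nil (l := l.reverse) (by simpa using hl)
    refine ⟨LinearMap.ker
      ((G.res a r.length) ∘ₗ YonedaAlgebra.component G.D (k := k) (r.length + 1)), ?_, ?_⟩
    · rw [LinearMap.mem_ker, LinearMap.comp_apply, Yfamily_inr, prod_map_Yx', hr]
      change G.res a r.length (YonedaAlgebra.component G.D (a :: r).length _) ≠ 0
      rw [Yl, YonedaAlgebra.component_of, res_ξl_same]
      exact G.πξ_ne_zero r a _ rfl (hr ▸ hc)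
    · rintro (j | ⟨m, hm, hm'⟩) hj
      · rw [LinearMap.mem_ker, LinearMap.comp_apply, Yfamily_inl, Ye, YonedaAlgebra.component_of_ne _ (by omega),
          map_zero]
      · rw [isChain_Yx_iff] at hm'
        obtain ⟨b, q, hq⟩ := List.exists_cons_of_ne_nil (l := m.reverse) (by simpa using hm)
        rw [LinearMap.mem_ker, LinearMap.comp_apply, Yfamily_inr, prod_map_Yx', hq]
        by_cases hlen : q.length = r.length
        · rw [← hlen]
          change G.res a q.length (YonedaAlgebra.component G.D (b :: q).length _) = 0
          rw [Yl, YonedaAlgebra.component_of, res_ξl_of_ne]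
          rintro rfl
          apply hj
          have : r = q := List.IsChain.eq_of_length (R := G.Rel)
            (fun h h' => G.rel_right h.1 h.2 h'.1 h'.2) (hr ▸ hc) (hq ▸ hm') hlen.symm
          rw [this, ← hq, List.reverse_inj] at hr
          subst hr; rfl
        · rw [Yl, YonedaAlgebra.component_of_ne, map_zero]
          simpa using hlen

lemma span_Yfamily : ⊤ ≤ Submodule.span k (Set.range G.Yfamily) := by
  rintro y -
  refine YonedaAlgebra.mem_span G.D (fun n x => ?_) y
  cases n with
  | zero =>
    obtain ⟨f, rfl⟩ := Ext.mk₀_bijective _ _ |>.2 x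
    rw [mk₀_eq_sum, map_sum]
    refine Submodule.sum_mem _ fun i _ => ?_
    rw [map_smul]
    exact Submodule.smul_mem _ _ (Submodule.subset_span ⟨Sum.inl i, rfl⟩)
  | succ n =>
    induction G.mem_span_ξl n x using Submodule.span_induction with
    | mem x hx =>
      obtain ⟨l, hl, hc, rfl⟩ := hx
      rw [YonedaAlgebra.of_cast G.D hl]
      refine Submodule.subset_span ⟨Sum.inr ⟨l.reverse, ?_, ?_⟩, ?_⟩
      · intro h
        rw [List.reverse_eq_nil_iff] at h
        subst h; simp at hl
      · rw [isChain_Yx_iff, List.reverse_reverse]; exact hc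
      · rw [Yfamily_inr, prod_map_Yx', List.reverse_reverse]; rfl
    | zero => rw [map_zero]; exact Submodule.zero_mem _
    | add y z _ _ hy hz => rw [map_add]; exact Submodule.add_mem _ hy hz
    | smul c y _ hy => rw [map_smul]; exact Submodule.smul_mem _ _ hy

lemma Yx_rel {a b : G.E} (h : G.s a = G.t b) (h0 : G.Yx a * G.Yx b = 0) : G.Nz b a := by
  refine (G.nz_or_rel h.symm).resolve_right fun h' => ?_
  exact G.Yx_mul_Yx_ne_zero_iff.2 h' h0

/-- The frame of the Yoneda algebra of the degree zero part. -/
noncomputable def dual : GentleFrame k G.Y where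
  V := G.V
  E := G.E
  s := G.t
  t := G.s
  e := G.Ye
  x := G.Yx
  e_mul_self := G.Ye_mul_self
  e_mul_e _ _ h := G.Ye_mul_Ye_of_ne h
  sum_e := G.sum_Ye
  e_mul_x := G.Ye_mul_Yx
  x_mul_e := G.Yx_mul_Ye
  linearIndependent := G.linearIndependent_Yfamily
  span_eq_top := G.span_Yfamily
  card_in := G.card_out
  card_out := G.card_in
  nz_right h h' := by
    rw [Yx_mul_Yx_ne_zero_iff] at h h'
    exact G.rel_left h.1 h.2 h'.1 h'.2
  nz_left h h' := by
    rw [Yx_mul_Yx_ne_zero_iff] at h h'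
    exact G.rel_right h.1 h.2 h'.1 h'.2
  rel_right h1 h2 h3 h4 := G.nz_left (G.Yx_rel h1 h2) (G.Yx_rel h3 h4)
  rel_left h1 h2 h3 h4 := G.nz_right (G.Yx_rel h1 h2) (G.Yx_rel h3 h4)

lemma dual_nz {a b : G.E} : G.dual.Nz a b ↔ G.Rel b a := G.Yx_mul_Yx_ne_zero_iff

lemma dual_rel {a b : G.E} : G.dual.Rel a b ↔ G.Nz b a := by
  constructor
  · intro h; exact G.Yx_rel h.1 h.2
  · intro h
    refine ⟨(Nz.t_eq_s G h).symm, ?_⟩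
    by_contra h'
    exact h (G.Yx_mul_Yx_ne_zero_iff.1 h').2

end GentleFrame

/-! ## Lists of arrows of paths -/

section Arrows

variable {V : Type} [Quiver.{0} V]

/-- The list of arrows of a path. -/
def Quiver.Path.arrows {i : V} : ∀ {j : V}, Quiver.Path i j → List (Σ i j : V, (i ⟶ j))
  | _, .nil => []
  | _, .cons p a => p.arrows ++ [⟨_, _, a⟩]

namespace Quiver.Path

@[simp] lemma arrows_nil {i : V} : (nil : Path i i).arrows = [] := rfl

@[simp] lemma arrows_cons {i j l : V} (p : Path i j) (a : j ⟶ l) :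
    (p.cons a).arrows = p.arrows ++ [⟨_, _, a⟩] := rfl

@[simp] lemma arrows_comp {i j l : V} (p : Path i j) (q : Path j l) :
    (p.comp q).arrows = p.arrows ++ q.arrows := by
  induction q with
  | nil => simp
  | cons q a ih => simp [ih]

@[simp] lemma length_arrows {i j : V} (p : Path i j) : p.arrows.length = p.length := by
  induction p with
  | nil => rfl
  | cons p a ih => simp [ih]

lemma vertices_eq_arrows {i j : V} (p : Path i j) :
    p.vertices = i :: p.arrows.map (fun a => a.2.1) := by
  induction p with
  | nil => rfl
  | cons p a ih => simp [ih]

/-- Equality of the sources has to be assumed: all trivial paths have the same empty list of arrows.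
-/
lemma eq_of_arrows_eq {i j i' j' : V} (p : Path i j) (q : Path i' j') (hi : i = i')
    (h : p.arrows = q.arrows) :
    (⟨i, j, p⟩ : Σ i j : V, Path i j) = ⟨i', j', q⟩ := by
  subst hi
  induction p generalizing j' with
  | nil =>
    cases q with
    | nil => rfl
    | cons q a => simp at h
  | cons p a ih =>
    cases q with
    | nil => simp at h
    | cons q b =>
      rw [arrows_cons, arrows_cons] at h
      obtain ⟨h1, h2⟩ := List.append_inj' h rfl
      rw [List.cons.injEq] at h2
      have h2 := h2.1
      obtain ⟨rfl, h2⟩ := Sigma.mk.inj h2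
      obtain ⟨rfl, h2⟩ := Sigma.mk.inj (eq_of_heq h2)
      obtain rfl := eq_of_heq h2
      have := ih q h1
      obtain ⟨-, h3⟩ := Sigma.mk.inj this
      obtain ⟨-, h4⟩ := Sigma.mk.inj (eq_of_heq h3)
      obtain rfl := eq_of_heq h4
      rfl

lemma source_eq_of_arrows_cons {i j : V} (p : Path i j) {a : Σ i j : V, (i ⟶ j)}
    {l : List (Σ i j : V, (i ⟶ j))} (h : p.arrows = a :: l) : a.1 = i := by
  induction p generalizing l with
  | nil => simp at h
  | @cons b c p x ih =>
    rw [arrows_cons] at h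
    cases hp : p.arrows with
    | nil =>
      rw [hp] at h
      have : p.length = 0 := by rw [← length_arrows, hp]; rfl
      obtain rfl := eq_of_length_zero p this
      rw [List.nil_append, List.cons.injEq] at h
      rw [← h.1]
    | cons y m =>
      rw [hp, List.cons_append, List.cons.injEq] at h
      exact ih (hp.trans (by rw [h.1]))

lemma exists_arrows_eq (l : List (Σ i j : V, (i ⟶ j))) (hl : l ≠ [])
    (hc : l.IsChain fun a b => a.2.1 = b.1) :
    ∃ (i j : V) (p : Path i j), p.arrows = l ∧ j = (l.getLast hl).2.1 := by
  induction l using List.reverseRecOn with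
  | nil => exact absurd rfl hl
  | append_singleton l a ih =>
    obtain ⟨i, j, a⟩ := a
    by_cases h : l = []
    · subst h
      exact ⟨i, j, a.toPath, rfl, rfl⟩
    · obtain ⟨i', j', p, hp, hj⟩ := ih h hc.left_of_append
      have : j' = i := by
        rw [hj]
        exact hc.rel_getLast_head_of_append h (by simp)
      subst this
      exact ⟨i', j, p.cons a, by rw [arrows_cons, hp], by rw [List.getLast_append_singleton]⟩

end Quiver.Path

end Arrows

/-! ### The frame of a locally gentle presentation -/

namespace QuiverPresentation

variable {k : Type v} {A : Type u} [Field k] [Ring A] [Algebra k A] (P : QuiverPresentation k A)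

/-- The type of all arrows. -/
abbrev Arr : Type := Σ i j : P.V, (i ⟶ j)

lemma ofPath_comp {i j l : P.V} (p : Quiver.Path i j) (q : Quiver.Path j l) :
    P.ofPath (p.comp q) = P.ofPath p * P.ofPath q := by
  rw [ofPath, ofPath, ofPath, ← map_mul, PathAlgebra.ofPath_mul_ofPath]

lemma ofPath_mul_of_ne {i j j' l : P.V} (h : j' ≠ j) (p : Quiver.Path i j) (q : Quiver.Path j' l) :
    P.ofPath p * P.ofPath q = 0 := by
  rw [ofPath, ofPath, ← map_mul, PathAlgebra.ofPath_mul_ofPath_of_ne _ _ h, map_zero]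

lemma ofPath_cons {i j l : P.V} (p : Quiver.Path i j) (a : j ⟶ l) :
    P.ofPath (p.cons a) = P.ofPath p * P.ofArrow a := by
  rw [ofArrow, ← ofPath_comp, Quiver.Path.comp_toPath_eq_cons]

/-- The class of an arrow in the algebra. -/
noncomputable def arrow (a : P.Arr) : A := P.ofArrow a.2.2

/-- The idempotent of a vertex. -/
noncomputable def idem (i : P.V) : A := P.ofPath (Quiver.Path.nil : Quiver.Path i i)

lemma idem_mul_ofPath {i j : P.V} (p : Quiver.Path i j) : P.idem i * P.ofPath p = P.ofPath p := by
  rw [idem, ← ofPath_comp, Quiver.Path.nil_comp]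

lemma ofPath_mul_idem {i j : P.V} (p : Quiver.Path i j) : P.ofPath p * P.idem j = P.ofPath p := by
  rw [idem, ← ofPath_comp, Quiver.Path.comp_nil]

lemma ofPath_eq_idem_mul {i j : P.V} (p : Quiver.Path i j) :
    P.ofPath p = P.idem i * (p.arrows.map P.arrow).prod := by
  induction p with
  | nil => simp [idem]
  | cons p a ih => rw [ofPath_cons, ih]; simp [arrow, mul_assoc]

lemma ofPath_eq_prod {i j : P.V} (p : Quiver.Path i j) (h : p.arrows ≠ []) :
    P.ofPath p = (p.arrows.map P.arrow).prod := by
  rw [ofPath_eq_idem_mul]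
  obtain ⟨a, l, hl⟩ := List.exists_cons_of_ne_nil h
  obtain rfl := p.source_eq_of_arrows_cons hl
  rw [hl, List.map_cons, List.prod_cons, ← mul_assoc]
  congr 1
  exact P.idem_mul_ofPath _

lemma arrow_mul_arrow_ne_zero {a b : P.Arr} (h : P.arrow a * P.arrow b ≠ 0) : a.2.1 = b.1 := by
  by_contra hne
  exact h (P.ofPath_mul_of_ne (Ne.symm hne) _ _)

/-- A path is good if consecutive arrows have nonzero product. -/
def Good {i j : P.V} (p : Quiver.Path i j) : Prop :=
  p.arrows.IsChain fun a b => P.arrow a * P.arrow b ≠ 0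

/-- The span of the paths which are not good. -/
noncomputable def badSpan : Submodule k (PathAlgebra k P.V) :=
  Submodule.span k {x | ∃ (i j : P.V) (p : Quiver.Path i j), ¬ P.Good p ∧ x = PathAlgebra.ofPath p}

/-- Extending a path at either end cannot repair a zero product inside it, so these paths span an
ideal. -/
lemma mul_mem_badSpan (x : PathAlgebra k P.V) {y : PathAlgebra k P.V} (hy : y ∈ P.badSpan) :
    x * y ∈ P.badSpan ∧ y * x ∈ P.badSpan := by
  induction hy using Submodule.span_induction with
  | zero => simp
  | add y z _ _ hy hz =>
    rw [mul_add, add_mul]; exact ⟨Submodule.add_mem _ hy.1 hz.1, Submodule.add_mem _ hy.2 hz.2⟩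
  | smul c y _ hy =>
    rw [mul_smul_comm, smul_mul_assoc]
    exact ⟨Submodule.smul_mem _ _ hy.1, Submodule.smul_mem _ _ hy.2⟩
  | mem y hy =>
    obtain ⟨i, j, p, hp, rfl⟩ := hy
    induction x using PathAlgebra.induction with
    | zero => simp
    | add y z hy hz =>
      rw [mul_add, add_mul]; exact ⟨Submodule.add_mem _ hy.1 hz.1, Submodule.add_mem _ hy.2 hz.2⟩
    | smul c y hy =>
      rw [mul_smul_comm, smul_mul_assoc]
      exact ⟨Submodule.smul_mem _ _ hy.1, Submodule.smul_mem _ _ hy.2⟩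
    | path a b q =>
      constructor
      · by_cases h : i = b
        · subst h
          rw [PathAlgebra.ofPath_mul_ofPath]
          refine Submodule.subset_span ⟨_, _, _, fun hg => hp ?_, rfl⟩
          rw [Good, Quiver.Path.arrows_comp] at hg
          exact hg.right_of_append
        · rw [PathAlgebra.ofPath_mul_ofPath_of_ne _ _ h]; exact Submodule.zero_mem _
      · by_cases h : a = j
        · subst h
          rw [PathAlgebra.ofPath_mul_ofPath]
          refine Submodule.subset_span ⟨_, _, _, fun hg => hp ?_, rfl⟩
          rw [Good, Quiver.Path.arrows_comp] at hg
          exact hg.left_of_append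
        · rw [PathAlgebra.ofPath_mul_ofPath_of_ne _ _ h]; exact Submodule.zero_mem _

variable {P}

/-- The generators of I are paths of length two that vanish in A, hence not good themselves; the
ideal `badSpan` therefore contains I. -/
lemma IsLocallyGentle.mem_badSpan (hP : P.IsLocallyGentle) {x : PathAlgebra k P.V}
    (hx : P.π x = 0) : x ∈ P.badSpan := by
  obtain ⟨R, hR, h⟩ := hP.quadratic
  let I : TwoSidedIdeal (PathAlgebra k P.V) := TwoSidedIdeal.mk' P.badSpan
    (Submodule.zero_mem _) (Submodule.add_mem _) (Submodule.neg_mem _)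
    (fun hy => (P.mul_mem_badSpan _ hy).1) (fun hy => (P.mul_mem_badSpan _ hy).2)
  have hI : ∀ y, y ∈ I ↔ y ∈ P.badSpan := fun y => TwoSidedIdeal.mem_mk' ..
  have hle : TwoSidedIdeal.span ((fun p : Σ i j : P.V, Quiver.Path i j =>
      (PathAlgebra.ofPath p.2.2 : PathAlgebra k P.V)) '' R) ≤ I := by
    rw [TwoSidedIdeal.span_le]
    rintro _ ⟨⟨i, j, p⟩, hp, rfl⟩
    rw [SetLike.mem_coe, hI]
    refine Submodule.subset_span ⟨i, j, p, fun hg => ?_, rfl⟩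
    have h0 : P.ofPath p = 0 := (h _).2 (TwoSidedIdeal.subset_span ⟨_, hp, rfl⟩)
    have hlen : p.arrows.length = 2 := by rw [Quiver.Path.length_arrows]; exact hR _ hp
    obtain ⟨a, b, hab⟩ := List.length_eq_two.1 hlen
    rw [ofPath_eq_prod _ _ (by simp [hab]), hab] at h0
    rw [Good, hab] at hg
    simp at hg h0
    exact hg h0
  exact (hI x).1 (hle ((h x).1 hx))

lemma repr_eq_zero_of_mem_badSpan {x : PathAlgebra k P.V} (hx : x ∈ P.badSpan)
    (p : Σ i j : P.V, Quiver.Path i j) (hp : P.Good p.2.2) : PathAlgebra.basis.repr x p = 0 := by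
  classical
  induction hx using Submodule.span_induction with
  | zero => simp
  | add y z _ _ hy hz => simp [hy, hz]
  | smul c y _ hy => simp [hy]
  | mem y hy =>
    obtain ⟨i, j, q, hq, rfl⟩ := hy
    rw [PathAlgebra.ofPath, Module.Basis.repr_self, Finsupp.single_apply, if_neg]
    rintro rfl
    exact hq hp

lemma exists_path (w : P.V ⊕ {l : List P.Arr // l ≠ [] ∧ l.IsChain
      (fun a b => P.arrow a * P.arrow b ≠ 0)}) :
    ∃ q : Σ i j : P.V, Quiver.Path i j, P.Good q.2.2 ∧
      (∀ i, w = Sum.inl i → q = ⟨i, i, .nil⟩) ∧ (∀ l, w = Sum.inr l → q.2.2.arrows = l.1) ∧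
      P.ofPath q.2.2 = Sum.elim P.idem (fun l => (l.1.map P.arrow).prod) w := by
  rcases w with i | ⟨l, hl, hc⟩
  · exact ⟨⟨i, i, .nil⟩, by simp [Good], by simp, by simp, rfl⟩
  · obtain ⟨i, j, p, hp, -⟩ := Quiver.Path.exists_arrows_eq l hl
      (hc.imp fun a b hab => P.arrow_mul_arrow_ne_zero hab)
    refine ⟨⟨i, j, p⟩, ?_, by simp, ?_, ?_⟩
    · rw [Good, hp]; exact hc
    · rintro m hm
      rw [hp]; exact congrArg Subtype.val (Sum.inr.inj hm)
    · rw [ofPath_eq_prod _ _ (by rw [hp]; exact hl), hp]; rfl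

/-- A vanishing combination lifts to a combination of good paths lying in I. Elements of I have no
component along good paths, so all coefficients are zero. -/
lemma IsLocallyGentle.linearIndependent (hP : P.IsLocallyGentle) :
    LinearIndependent k (Sum.elim P.idem (fun l : {l : List P.Arr // l ≠ [] ∧ l.IsChain
      (fun a b => P.arrow a * P.arrow b ≠ 0)} => (l.1.map P.arrow).prod)) := by
  classical
  choose q hgood hinl hinr hq using fun w => exists_path (P := P) w
  have hinj : Function.Injective q := by
    rintro (i | l) (j | m) h
    · have := hinl _ i rfl
      rw [h, hinl _ j rfl] at this
      rw [(Sigma.mk.inj this).1]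
    · have h1 := hinr _ m rfl
      rw [← h, hinl _ i rfl] at h1
      exact absurd h1.symm m.2.1
    · have h1 := hinr _ l rfl
      rw [h, hinl _ j rfl] at h1
      exact absurd h1.symm l.2.1
    · have h1 := hinr _ l rfl
      rw [h, hinr _ m rfl] at h1
      rw [Subtype.ext h1.symm]
  rw [linearIndependent_iff']
  intro s g hg w hw
  have h0 : P.π (∑ w ∈ s, g w • PathAlgebra.ofPath (q w).2.2) = 0 := by
    rw [map_sum]
    refine Eq.trans (Finset.sum_congr rfl fun w _ => ?_) hg
    rw [map_smul, ← hq w]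
    rfl
  have h1 := repr_eq_zero_of_mem_badSpan (hP.mem_badSpan h0) (q w) (hgood w)
  rw [map_sum, Finsupp.finsetSum_apply, Finset.sum_eq_single w] at h1
  · have : PathAlgebra.basis.repr (PathAlgebra.ofPath (k := k) (q w).2.2) (q w) = 1 := by
      rw [PathAlgebra.ofPath, Module.Basis.repr_self, Finsupp.single_eq_same]
    rwa [map_smul, Finsupp.smul_apply, this, smul_eq_mul, mul_one] at h1
  · intro w' _ hne
    rw [map_smul, Finsupp.smul_apply, PathAlgebra.ofPath, Module.Basis.repr_self,
      Finsupp.single_apply, if_neg, smul_zero]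
    intro h; exact hne (hinj h)
  · intro h; exact absurd hw h

lemma span_eq_top : ⊤ ≤ Submodule.span k (Set.range (Sum.elim P.idem
    (fun l : {l : List P.Arr // l ≠ [] ∧ l.IsChain
      (fun a b => P.arrow a * P.arrow b ≠ 0)} => (l.1.map P.arrow).prod))) := by
  rintro y -
  obtain ⟨x, rfl⟩ := P.surjective y
  induction x using PathAlgebra.induction with
  | zero => rw [map_zero]; exact Submodule.zero_mem _
  | add y z hy hz => rw [map_add]; exact Submodule.add_mem _ hy hz
  | smul c y hy => rw [map_smul]; exact Submodule.smul_mem _ _ hy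
  | path i j p =>
    change P.ofPath p ∈ _
    by_cases h : p.arrows = []
    · have hlen : p.length = 0 := by rw [← Quiver.Path.length_arrows, h]; rfl
      obtain rfl := p.eq_of_length_zero hlen
      obtain rfl := p.eq_nil_of_length_zero hlen
      exact Submodule.subset_span ⟨Sum.inl i, rfl⟩
    · rw [ofPath_eq_prod _ _ h]
      by_cases hc : p.arrows.IsChain fun a b => P.arrow a * P.arrow b ≠ 0
      · exact Submodule.subset_span ⟨Sum.inr ⟨_, h, hc⟩, rfl⟩
      · rw [List.isChain_iff_forall_rel_of_append_cons_cons] at hc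
        push Not at hc
        obtain ⟨a, b, l, m, hl, h0⟩ := hc
        rw [hl]
        simp only [List.map_append, List.map_cons, List.prod_append, List.prod_cons]
        rw [← mul_assoc (P.arrow a), h0, zero_mul, mul_zero]
        exact Submodule.zero_mem _

/-- The frame of a locally gentle presentation. -/
noncomputable def IsLocallyGentle.frame (hP : P.IsLocallyGentle) : GentleFrame k A where
  V := P.V
  E := P.Arr
  s a := a.1
  t a := a.2.1
  e := P.idem
  x := P.arrow
  e_mul_self i := P.idem_mul_ofPath _
  e_mul_e i j h := P.ofPath_mul_of_ne h.symm _ _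
  sum_e := by
    have := map_one P.π
    rwa [PathAlgebra.one_def, map_sum] at this
  e_mul_x a := P.idem_mul_ofPath _
  x_mul_e a := P.ofPath_mul_idem _
  linearIndependent := hP.linearIndependent
  span_eq_top := span_eq_top
  card_in i := by
    refine le_trans ?_ (hP.card_in i)
    refine Nat.card_le_card_of_surjective
      (fun b : Σ j : P.V, (j ⟶ i) => (⟨⟨b.1, i, b.2⟩, rfl⟩ : {a : P.Arr // a.2.1 = i})) ?_
    rintro ⟨⟨i, j, a⟩, rfl⟩
    exact ⟨⟨i, a⟩, rfl⟩
  card_out i := by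
    refine le_trans ?_ (hP.card_out i)
    refine Nat.card_le_card_of_surjective
      (fun b : Σ j : P.V, (i ⟶ j) => (⟨⟨i, b.1, b.2⟩, rfl⟩ : {a : P.Arr // a.1 = i})) ?_
    rintro ⟨⟨i, j, a⟩, rfl⟩
    exact ⟨⟨j, a⟩, rfl⟩
  nz_right {a b c} h h' := by
    have h1 := P.arrow_mul_arrow_ne_zero h
    have h2 := P.arrow_mul_arrow_ne_zero h'
    obtain ⟨i, j, a⟩ := a
    obtain ⟨j1, l, b⟩ := b
    obtain ⟨j2, m, c⟩ := c
    dsimp only at h1 h2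
    subst h1; subst h2
    have : (⟨l, b⟩ : Σ l, (j ⟶ l)) = ⟨m, c⟩ := hP.right_notMem a h h'
    obtain ⟨rfl, hab⟩ := Sigma.mk.inj this
    obtain rfl := eq_of_heq hab
    rfl
  nz_left {a b c} h h' := by
    have h1 := P.arrow_mul_arrow_ne_zero h
    have h2 := P.arrow_mul_arrow_ne_zero h'
    obtain ⟨i, i1, a⟩ := a
    obtain ⟨j, j1, b⟩ := b
    obtain ⟨l, m, c⟩ := c
    dsimp only at h1 h2
    subst h1; subst h2
    have : (⟨i, a⟩ : Σ i, (i ⟶ _)) = ⟨j, b⟩ := hP.left_notMem c h h'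
    obtain ⟨rfl, hab⟩ := Sigma.mk.inj this
    obtain rfl := eq_of_heq hab
    rfl
  rel_right {a b c} h1 h h2 h' := by
    obtain ⟨i, j, a⟩ := a
    obtain ⟨j1, l, b⟩ := b
    obtain ⟨j2, m, c⟩ := c
    dsimp only at h1 h2
    subst h1; subst h2
    have : (⟨l, b⟩ : Σ l, (j ⟶ l)) = ⟨m, c⟩ := hP.right_mem a h h'
    obtain ⟨rfl, hab⟩ := Sigma.mk.inj this
    obtain rfl := eq_of_heq hab
    rfl
  rel_left {a b c} h1 h h2 h' := by
    obtain ⟨i, i1, a⟩ := a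
    obtain ⟨j, j1, b⟩ := b
    obtain ⟨l, m, c⟩ := c
    dsimp only at h1 h2
    subst h1; subst h2
    have : (⟨i, a⟩ : Σ i, (i ⟶ _)) = ⟨j, b⟩ := hP.left_mem c h h'
    obtain ⟨rfl, hab⟩ := Sigma.mk.inj this
    obtain rfl := eq_of_heq hab
    rfl

/-- This identifies the module defining the Koszul dual with the quotient A/J computed from the
frame. -/
lemma IsLocallyGentle.J_eq_positivePart (hP : P.IsLocallyGentle) :
    P.positivePart = hP.frame.J := by
  apply le_antisymm
  · rw [positivePart, Submodule.span_le]
    rintro _ ⟨i, j, p, hp, rfl⟩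
    have hne : p.arrows ≠ [] := by
      rw [← List.length_pos_iff_ne_nil, Quiver.Path.length_arrows]; exact hp
    rw [ofPath_eq_prod _ _ hne]
    exact hP.frame.W_mem_J hne
  · intro y hy
    refine hP.frame.J_induction (p := fun y => y ∈ P.positivePart) (Submodule.zero_mem _)
      (fun y z hy hz => Submodule.add_mem _ hy hz) ?_ ?_ hy
    · intro c y hy
      have : c • y = MulOpposite.op (algebraMap k A c) • y := by
        rw [MulOpposite.smul_eq_mul_unop, MulOpposite.unop_op, ← Algebra.commutes,
          Algebra.smul_def]
      rw [this]
      exact Submodule.smul_mem _ _ hy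
    · intro l hl hc
      obtain ⟨q, -, -, hq, hq'⟩ := exists_path (P := P) (Sum.inr ⟨l, hl, hc⟩)
      have := hq _ rfl
      refine Submodule.subset_span ⟨q.1, q.2.1, q.2.2, ?_, hq'.symm⟩
      rw [← Quiver.Path.length_arrows, this]
      exact List.length_pos_iff_ne_nil.2 hl

end QuiverPresentation

/-! ## The presentation of a frame -/

namespace GentleFrame

variable {k : Type v} {A : Type u} [Field k] [Ring A] [Algebra k A] (G : GentleFrame k A)

/-- The quiver of a frame. -/
instance quiverV : Quiver.{0} G.V := ⟨fun i j => {a : G.E // G.s a = i ∧ G.t a = j}⟩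

/-- The product of the arrows along a path. -/
noncomputable def pathVal {i : G.V} : ∀ {j : G.V}, Quiver.Path i j → A
  | _, .nil => G.e i
  | _, .cons p a => pathVal p * G.x a.1

lemma pathVal_nil (i : G.V) : G.pathVal (.nil : Quiver.Path i i) = G.e i := rfl

lemma pathVal_cons {i j l : G.V} (p : Quiver.Path i j) (a : j ⟶ l) :
    G.pathVal (p.cons a) = G.pathVal p * G.x a.1 := rfl

lemma pathVal_mul_e {i j : G.V} (p : Quiver.Path i j) : G.pathVal p * G.e j = G.pathVal p := by
  cases p with
  | nil => exact G.e_mul_self _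
  | cons p a =>
    obtain ⟨a, rfl, rfl⟩ := a
    rw [pathVal_cons, mul_assoc, G.x_mul_e]

lemma e_mul_pathVal {i j : G.V} (p : Quiver.Path i j) : G.e i * G.pathVal p = G.pathVal p := by
  induction p with
  | nil => exact G.e_mul_self _
  | cons p a ih => rw [pathVal_cons, ← mul_assoc, ih]

lemma pathVal_comp {i j l : G.V} (p : Quiver.Path i j) (q : Quiver.Path j l) :
    G.pathVal (p.comp q) = G.pathVal p * G.pathVal q := by
  induction q with
  | nil => rw [Quiver.Path.comp_nil, pathVal_nil, pathVal_mul_e]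
  | cons q a ih => rw [Quiver.Path.comp_cons, pathVal_cons, ih, pathVal_cons, mul_assoc]

lemma pathVal_mul_of_ne {i j i' j' : G.V} (h : i' ≠ j) (p : Quiver.Path i j)
    (q : Quiver.Path i' j') : G.pathVal p * G.pathVal q = 0 := by
  rw [← pathVal_mul_e, ← e_mul_pathVal G q, ← mul_assoc, mul_assoc (G.pathVal p),
    G.e_mul_e _ _ h.symm, mul_zero, zero_mul]

/-- The projection from the path algebra as a linear map. -/
noncomputable def projLin : PathAlgebra k G.V →ₗ[k] A :=
  PathAlgebra.basis.constr k fun p => G.pathVal p.2.2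

lemma projLin_ofPath {i j : G.V} (p : Quiver.Path i j) :
    G.projLin (PathAlgebra.ofPath p) = G.pathVal p := by
  rw [projLin, PathAlgebra.ofPath, Module.Basis.constr_basis]

/-- The projection from the path algebra. -/
noncomputable def proj : PathAlgebra k G.V →ₐ[k] A :=
  AlgHom.ofLinearMap G.projLin
    (by
      rw [PathAlgebra.one_def, map_sum, ← G.sum_e]
      exact Finset.sum_congr rfl fun i _ => G.projLin_ofPath _)
    (by
      intro y z
      induction y using PathAlgebra.induction with
      | zero => rw [zero_mul, map_zero, zero_mul]
      | add y y' hy hy' => rw [add_mul, map_add, hy, hy', map_add, add_mul]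
      | smul c y hy => rw [smul_mul_assoc, map_smul, hy, map_smul, smul_mul_assoc]
      | path i j p =>
      induction z using PathAlgebra.induction with
      | zero => rw [mul_zero, map_zero, mul_zero]
      | add y y' hy hy' => rw [mul_add, map_add, hy, hy', map_add, mul_add]
      | smul c y hy => rw [mul_smul_comm, map_smul, hy, map_smul, mul_smul_comm]
      | path i' j' q =>
        by_cases h : i' = j
        · subst h
          rw [PathAlgebra.ofPath_mul_ofPath, projLin_ofPath, projLin_ofPath, projLin_ofPath,
            pathVal_comp]
        · rw [PathAlgebra.ofPath_mul_ofPath_of_ne _ _ h, projLin_ofPath, projLin_ofPath,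
            pathVal_mul_of_ne _ h, map_zero])

lemma proj_ofPath {i j : G.V} (p : Quiver.Path i j) :
    G.proj (PathAlgebra.ofPath p) = G.pathVal p := G.projLin_ofPath p

/-- An arrow of a frame as an arrow of its quiver. -/
def toArr (a : G.E) : Σ i j : G.V, (i ⟶ j) := ⟨G.s a, G.t a, ⟨a, rfl, rfl⟩⟩

lemma toArr_val (a : Σ i j : G.V, (i ⟶ j)) : G.toArr a.2.2.1 = a := by
  obtain ⟨i, j, a, rfl, rfl⟩ := a; rfl

lemma map_toArr_map_val (l : List (Σ i j : G.V, (i ⟶ j))) :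
    (l.map fun a => a.2.2.1).map G.toArr = l := by
  rw [List.map_map]
  exact (List.map_congr_left fun a _ => G.toArr_val a).trans (List.map_id l)

lemma map_val_map_toArr (l : List G.E) :
    (l.map G.toArr).map (fun a => a.2.2.1) = l := by
  rw [List.map_map]
  exact List.map_id l

lemma pathVal_eq {i j : G.V} (p : Quiver.Path i j) :
    G.pathVal p = G.e i * G.W (p.arrows.map fun a => a.2.2.1) := by
  induction p with
  | nil => rw [pathVal_nil]; simp
  | cons p a ih => rw [pathVal_cons, ih]; simp [W_append, mul_assoc]

lemma pathVal_eq_W {i j : G.V} (p : Quiver.Path i j) (h : p.arrows ≠ []) :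
    G.pathVal p = G.W (p.arrows.map fun a => a.2.2.1) := by
  rw [pathVal_eq]
  obtain ⟨a, l, hl⟩ := List.exists_cons_of_ne_nil h
  have := p.source_eq_of_arrows_cons hl
  rw [hl, List.map_cons, e_mul_W]
  rw [← this]
  exact a.2.2.2.1

lemma exists_path {l : List G.E} (hl : l ≠ []) (hc : l.IsChain fun a b => G.t a = G.s b) :
    ∃ (i j : G.V) (p : Quiver.Path i j), p.arrows = l.map G.toArr := by
  obtain ⟨i, j, p, hp, -⟩ := Quiver.Path.exists_arrows_eq (l.map G.toArr) (by simpa using hl)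
    (by rw [List.isChain_map]; exact hc)
  exact ⟨i, j, p, hp⟩

lemma surjective_proj : Function.Surjective G.proj := by
  intro y
  induction y using G.induction with
  | zero => exact ⟨0, map_zero _⟩
  | add y z hy hz =>
    obtain ⟨⟨y, rfl⟩, ⟨z, rfl⟩⟩ := hy, hz
    exact ⟨y + z, map_add _ _ _⟩
  | smul c y hy =>
    obtain ⟨y, rfl⟩ := hy
    exact ⟨c • y, map_smul _ _ _⟩
  | idem i => exact ⟨_, G.proj_ofPath (.nil : Quiver.Path i i)⟩
  | word l hl hc =>
    obtain ⟨i, j, p, hp⟩ := G.exists_path hl (hc.imp fun a b h => Nz.t_eq_s G h)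
    refine ⟨PathAlgebra.ofPath p, ?_⟩
    rw [proj_ofPath, pathVal_eq_W _ _ (by rw [hp]; simpa using hl), hp, map_val_map_toArr]

/-- The quiver presentation of a frame. -/
noncomputable abbrev toPres : QuiverPresentation k A where
  V := G.V
  quiver := G.quiverV
  finiteHom _ _ := Subtype.finite
  π := G.proj
  surjective := G.surjective_proj

lemma toPres_ofPath {i j : G.toPres.V} (p : Quiver.Path i j) :
    G.toPres.ofPath p = G.pathVal p := G.proj_ofPath p

lemma toPres_arrow (a : G.toPres.Arr) : G.toPres.arrow a = G.x a.2.2.1 := by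
  obtain ⟨i, j, a, rfl, rfl⟩ := a
  refine (G.proj_ofPath _).trans ?_
  change G.e _ * G.x a = _
  exact G.e_mul_x a

lemma toPres_ofArrow {i j : G.toPres.V} (a : i ⟶ j) : G.toPres.ofArrow a = G.x a.1 :=
  G.toPres_arrow ⟨i, j, a⟩

lemma good_iff {i j : G.toPres.V} (p : Quiver.Path i j) :
    G.toPres.Good p ↔ (p.arrows.map fun a => a.2.2.1).IsChain G.Nz := by
  rw [QuiverPresentation.Good, List.isChain_map]
  refine List.IsChain.iff fun {a b} => ?_
  rw [toPres_arrow, toPres_arrow]; rfl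

lemma linearIndependent_good :
    LinearIndependent k (fun p : {p : Σ i j : G.toPres.V, Quiver.Path i j // G.toPres.Good p.2.2} =>
      G.toPres.ofPath p.1.2.2) := by
  classical
  let f : {p : Σ i j : G.toPres.V, Quiver.Path i j // G.toPres.Good p.2.2} → G.V ⊕ G.Word :=
    fun p => if h : p.1.2.2.arrows = [] then Sum.inl p.1.1 else
      Sum.inr ⟨_, by simpa using h, (G.good_iff _).1 p.2⟩
  have hf : Function.Injective f := by
    rintro ⟨⟨i, j, p⟩, hp⟩ ⟨⟨i', j', q⟩, hq⟩ h
    apply Subtype.ext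
    dsimp only [f] at h
    split_ifs at h with h1 h2 h2
    · exact Quiver.Path.eq_of_arrows_eq p q (Sum.inl.inj h) (h1.trans h2.symm)
    · have h3 := congrArg (List.map G.toArr) (congrArg Subtype.val (Sum.inr.inj h))
      dsimp only at h3
      rw [map_toArr_map_val, map_toArr_map_val] at h3
      refine Quiver.Path.eq_of_arrows_eq p q ?_ h3
      obtain ⟨a, l, hl⟩ := List.exists_cons_of_ne_nil h1
      rw [← p.source_eq_of_arrows_cons hl, ← q.source_eq_of_arrows_cons (h3.symm.trans hl)]
  have := G.basis.linearIndependent.comp f hf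
  convert this using 1
  funext ⟨⟨i, j, p⟩, hp⟩
  rw [toPres_ofPath, Function.comp_apply]
  dsimp only [f]
  split_ifs with h
  · rw [basis_inl]
    rw [pathVal_eq, h]; simp
  · rw [basis_inr, pathVal_eq_W _ _ h]

/-- If the path without its last arrow is still not good, induction applies. Otherwise the last two
arrows have product zero and form a relation of length two. -/
lemma ofPath_mem_of_not_good (I : TwoSidedIdeal (PathAlgebra k G.toPres.V))
    (hI : ∀ {i j : G.toPres.V} (p : Quiver.Path i j), p.length = 2 → G.toPres.ofPath p = 0 →
      PathAlgebra.ofPath p ∈ I) {i j : G.toPres.V} (p : Quiver.Path i j)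
    (hp : ¬ G.toPres.Good p) : PathAlgebra.ofPath p ∈ I := by
  induction p with
  | nil => exact absurd (by simp [QuiverPresentation.Good]) hp
  | cons p a ih =>
    by_cases h : G.toPres.Good p
    · cases p with
      | nil => exact absurd (by simp [QuiverPresentation.Good]) hp
      | cons q b =>
        have h0 : G.toPres.ofArrow b * G.toPres.ofArrow a = 0 := by
          by_contra h0
          apply hp
          rw [QuiverPresentation.Good] at h ⊢
          rw [Quiver.Path.arrows_cons, List.isChain_append]
          refine ⟨h, by simp, ?_⟩
          intro x hx y hy
          simp only [Quiver.Path.arrows_cons, List.getLast?_append, List.getLast?_singleton,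
            Option.some_or, Option.mem_def, Option.some.injEq, List.head?_cons] at hx hy
          subst hx; subst hy
          exact h0
        have h1 : (q.cons b).cons a = q.comp ((b.toPath).cons a) := by simp
        rw [h1, ← PathAlgebra.ofPath_mul_ofPath]
        refine I.mul_mem_left _ _ (hI _ rfl ?_)
        rw [QuiverPresentation.ofPath_cons]
        exact h0
    · rw [← Quiver.Path.comp_toPath_eq_cons, ← PathAlgebra.ofPath_mul_ofPath]
      exact I.mul_mem_right _ _ (ih h)

lemma quadratic : ∃ R : Set (Σ i j : G.toPres.V, Quiver.Path i j), (∀ p ∈ R, p.2.2.length = 2) ∧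
    ∀ y : PathAlgebra k G.toPres.V, G.toPres.π y = 0 ↔
      y ∈ TwoSidedIdeal.span ((fun p => PathAlgebra.ofPath p.2.2) '' R) := by
  refine ⟨{p | p.2.2.length = 2 ∧ G.toPres.ofPath p.2.2 = 0}, fun p hp => hp.1, fun y => ⟨?_, ?_⟩⟩
  · generalize hI : TwoSidedIdeal.span ((fun p : Σ i j : G.toPres.V, Quiver.Path i j =>
      (PathAlgebra.ofPath p.2.2 : PathAlgebra k G.toPres.V)) ''
        {p | p.2.2.length = 2 ∧ G.toPres.ofPath p.2.2 = 0}) = I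
    have hI0 : ∀ z ∈ I, G.toPres.π z = 0 := by
      intro z hz
      have : I ≤ TwoSidedIdeal.ker G.toPres.π := by
        rw [← hI, TwoSidedIdeal.span_le]
        rintro _ ⟨p, hp, rfl⟩
        exact (TwoSidedIdeal.mem_ker _).2 hp.2
      exact (TwoSidedIdeal.mem_ker _).1 (this hz)
    have hI1 := fun {i j : G.toPres.V} (p : Quiver.Path i j) => G.ofPath_mem_of_not_good I
      (fun p hp h0 => hI ▸ TwoSidedIdeal.subset_span ⟨⟨_, _, p⟩, ⟨hp, h0⟩, rfl⟩) p
    -- Modulo I every element is a combination of good paths, and good paths have linearly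
    -- independent images in A. Hence the kernel is no larger than I.
    have key : ∃ z ∈ Submodule.span k (Set.range
        (fun p : {p : Σ i j : G.toPres.V, Quiver.Path i j // G.toPres.Good p.2.2} =>
          (PathAlgebra.ofPath p.1.2.2 : PathAlgebra k G.toPres.V))), y - z ∈ I := by
      induction y using PathAlgebra.induction with
      | zero => exact ⟨0, Submodule.zero_mem _, by rw [sub_zero]; exact I.zero_mem⟩
      | add y z hy hz =>
        obtain ⟨y', hy1, hy2⟩ := hy
        obtain ⟨z', hz1, hz2⟩ := hz
        exact ⟨y' + z', Submodule.add_mem _ hy1 hz1, by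
          rw [add_sub_add_comm]; exact I.add_mem hy2 hz2⟩
      | smul c y hy =>
        obtain ⟨y', hy1, hy2⟩ := hy
        refine ⟨c • y', Submodule.smul_mem _ _ hy1, ?_⟩
        rw [← smul_sub, Algebra.smul_def]
        exact I.mul_mem_left _ _ hy2
      | path i j p =>
        by_cases h : G.toPres.Good p
        · exact ⟨_, Submodule.subset_span ⟨⟨⟨i, j, p⟩, h⟩, rfl⟩, by
            rw [sub_self]; exact I.zero_mem⟩
        · exact ⟨0, Submodule.zero_mem _, by rw [sub_zero]; exact hI1 p h⟩
    intro h0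
    obtain ⟨z, hz, hyz⟩ := key
    obtain ⟨c, rfl⟩ := (Finsupp.mem_span_range_iff_exists_finsupp).1 hz
    have h1 := hI0 _ hyz
    rw [map_sub, h0, zero_sub, neg_eq_zero, Finsupp.sum, map_sum] at h1
    have h2 := (linearIndependent_iff.1 G.linearIndependent_good) c (by
      rw [Finsupp.linearCombination_apply, Finsupp.sum, ← h1]
      exact Finset.sum_congr rfl fun p _ => (map_smul _ _ _).symm)
    rw [h2, Finsupp.sum_zero_index, sub_zero] at hyz
    exact hyz
  · intro hy
    have : TwoSidedIdeal.span ((fun p : Σ i j : G.toPres.V, Quiver.Path i j =>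
      (PathAlgebra.ofPath p.2.2 : PathAlgebra k G.toPres.V)) ''
        {p | p.2.2.length = 2 ∧ G.toPres.ofPath p.2.2 = 0}) ≤ TwoSidedIdeal.ker G.toPres.π := by
      rw [TwoSidedIdeal.span_le]
      rintro _ ⟨p, hp, rfl⟩
      exact (TwoSidedIdeal.mem_ker _).2 hp.2
    exact (TwoSidedIdeal.mem_ker _).1 (this hy)

lemma toPres_isLocallyGentle : G.toPres.IsLocallyGentle where
  card_in i := by
    refine le_trans ?_ (G.card_in i)
    refine Nat.card_le_card_of_surjective
      (fun a : {a : G.E // G.t a = i} => (⟨G.s a.1, a.1, rfl, a.2⟩ : Σ j : G.V, (j ⟶ i))) ?_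
    rintro ⟨j, a, rfl, h⟩
    exact ⟨⟨a, h⟩, rfl⟩
  card_out i := by
    refine le_trans ?_ (G.card_out i)
    refine Nat.card_le_card_of_surjective
      (fun a : {a : G.E // G.s a = i} => (⟨G.t a.1, a.1, a.2, rfl⟩ : Σ j : G.V, (i ⟶ j))) ?_
    rintro ⟨j, a, h, rfl⟩
    exact ⟨⟨a, h⟩, rfl⟩
  quadratic := G.quadratic
  right_mem := by
    rintro i j a ⟨l, b, hb, rfl⟩ h ⟨m, c, hc, rfl⟩ h'
    rw [Set.mem_ofPred_eq, toPres_ofArrow, toPres_ofArrow] at h h'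
    obtain rfl := G.rel_right (a.2.2.trans hb.symm) h (a.2.2.trans hc.symm) h'
    rfl
  left_mem := by
    rintro i j a ⟨l, b, rfl, hb⟩ h ⟨m, c, rfl, hc⟩ h'
    rw [Set.mem_ofPred_eq, toPres_ofArrow, toPres_ofArrow] at h h'
    obtain rfl := G.rel_left (hb.trans a.2.1.symm) h (hc.trans a.2.1.symm) h'
    rfl
  right_notMem := by
    rintro i j a ⟨l, b, hb, rfl⟩ h ⟨m, c, hc, rfl⟩ h'
    rw [Set.mem_ofPred_eq, toPres_ofArrow, toPres_ofArrow] at h h'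
    obtain rfl := G.nz_right h h'
    rfl
  left_notMem := by
    rintro i j a ⟨l, b, rfl, hb⟩ h ⟨m, c, rfl, hc⟩ h'
    rw [Set.mem_ofPred_eq, toPres_ofArrow, toPres_ofArrow] at h h'
    obtain rfl := G.nz_left h h'
    rfl

end GentleFrame

/-! ## Chains of bounded length -/

section Chains

variable {α : Type*} {R : α → α → Prop}

/-- Running around a cycle repeatedly would produce chains of any length. -/
lemma not_transGen_self_of_bounded {L : ℕ} (h : ∀ l : List α, l.length = L → ¬ l.IsChain R)
    (a : α) : ¬ Relation.TransGen R a a := by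
  intro ha
  have key : ∀ n, ∃ l : List α, n ≤ l.length ∧ (a :: l).IsChain R := by
    intro n
    induction n with
    | zero => exact ⟨[], by simp, by simp⟩
    | succ n ih =>
      obtain ⟨l, hl, hc⟩ := ih
      obtain ⟨b, hab, hba⟩ := Relation.TransGen.head'_iff.1 ha
      obtain ⟨m, hm, hlast⟩ := List.exists_isChain_cons_of_relationReflTransGen hba
      have h1 : ((a :: b :: m).dropLast ++ [a]).IsChain R := by
        have h2 : (a :: b :: m).getLast (by simp) = a := by
          rw [List.getLast_cons (by simp)]; exact hlast
        have h3 := List.dropLast_append_getLast (l := a :: b :: m) (by simp)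
        rw [h2] at h3
        rw [h3]
        exact List.isChain_cons_cons.2 ⟨hab, hm⟩
      have h4 := List.IsChain.append_overlap h1 (l₃ := l) (by simpa using hc) (by simp)
      rw [List.dropLast_cons_of_ne_nil (by simp), List.cons_append, List.cons_append] at h4
      exact ⟨_, by simp; omega, h4⟩
  obtain ⟨l, hl, hc⟩ := key L
  refine h ((a :: l).take L) (by simp; omega) (hc.take _)

lemma List.IsChain.nodup_of_bounded {L : ℕ} (h : ∀ l : List α, l.length = L → ¬ l.IsChain R)
    {l : List α} (hl : l.IsChain R) : l.Nodup := by
  have h1 : l.IsChain (Relation.TransGen R) := hl.imp fun _ _ h => Relation.TransGen.single h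
  refine h1.pairwise.imp ?_
  rintro a b hab rfl
  exact not_transGen_self_of_bounded h a hab

end Chains

/-! ## Faces and types of quasi-diagrams -/

namespace QuasiDiagram

open Equiv.Perm

variable {N : ℕ} (α : Equiv.Perm (Fin (N + 1)))

/-- The arrow `j` starts at the other position of the end vertex of the arrow `i`. -/
def Next (i j : Fin N) : Prop := α i.succ = j.castSucc ∧ j.castSucc ≠ i.succ

/-- The permutation `αζ`, conjugate to `ζα`. -/
def rot : Equiv.Perm (Fin (N + 1)) := α * finRotate (N + 1)

lemma rot_castSucc (i : Fin N) : rot α i.castSucc = α i.succ := by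
  rw [rot, Equiv.Perm.mul_apply, finRotate_apply, Fin.coeSucc_eq_succ]

lemma rot_last : rot α (Fin.last N) = α 0 := by
  rw [rot, Equiv.Perm.mul_apply, finRotate_last]

lemma sameCycle_iff (i j : Fin (N + 1)) :
    SameCycle (finRotate (N + 1) * α) i j ↔ SameCycle (rot α) (α i) (α j) := by
  have : rot α = α * (finRotate (N + 1) * α) * α⁻¹ := by rw [rot]; group
  rw [this, sameCycle_conj]
  simp

lemma isMaximal_iff : IsMaximal α ↔ (rot α).IsCycleOn Set.univ := by
  rw [IsMaximal, Nat.card_eq_one_iff_unique, IsCycleOn]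
  constructor
  · rintro ⟨h, -⟩
    refine ⟨Set.bijOn_univ.2 (rot α).bijective, fun i _ j _ => ?_⟩
    have := (sameCycle_iff α (α⁻¹ i) (α⁻¹ j)).1
      (Quotient.exact (s := SameCycle.setoid _) (h.elim (Quotient.mk _ (α⁻¹ i)) (Quotient.mk _ (α⁻¹ j))))
    simpa using this
  · rintro ⟨-, h⟩
    refine ⟨⟨fun x y => ?_⟩, ⟨Quotient.mk _ 0⟩⟩
    induction x using Quotient.inductionOn with | _ i => ?_
    induction y using Quotient.inductionOn with | _ j => ?_
    exact Quotient.sound (s := SameCycle.setoid _)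
      ((sameCycle_iff α i j).2 (h (Set.mem_univ _) (Set.mem_univ _)))

variable {α}

/-- The hypothesis makes the last position a fixed point of `rot α`, a face of its own, so there are
two faces exactly when the other positions form one cycle. -/
lemma card_face_eq_two_iff (hN : N ≠ 0) (h0 : α 0 = Fin.last N) :
    Nat.card (Face α) = 2 ↔ (rot α).IsCycleOn {Fin.last N}ᶜ := by
  have hfix : rot α (Fin.last N) = Fin.last N := by rw [rot_last, h0]
  have hbij : Set.BijOn (rot α) {Fin.last N}ᶜ {Fin.last N}ᶜ := by
    refine ⟨fun i hi h => hi ?_, (rot α).injective.injOn, fun i hi => ⟨(rot α)⁻¹ i, ?_, by simp⟩⟩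
    · rw [Set.mem_singleton_iff] at h ⊢
      rw [← hfix] at h
      exact (rot α).injective h
    · intro h
      rw [Set.mem_singleton_iff, Equiv.Perm.inv_eq_iff_eq, hfix] at h
      exact hi h
  -- Before conjugation by α this one-point face is {0}, because α sends 0 to the last position and
  -- ζ returns it to 0.
  have hne : ∀ i, SameCycle (finRotate (N + 1) * α) i 0 ↔ i = 0 := by
    intro i
    rw [sameCycle_iff, h0]
    constructor
    · intro h
      have := SameCycle.eq_of_right h hfix
      rw [← h0] at this
      exact α.injective this
    · rintro rfl; rw [h0]
  rw [@Nat.card_eq_two_iff' (Face α) (Quotient.mk _ 0), IsCycleOn]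
  constructor
  · intro h
    refine ⟨hbij, fun i hi j hj => ?_⟩
    have aux : ∀ i ∈ ({Fin.last N}ᶜ : Set (Fin (N + 1))),
        (Quotient.mk _ (α⁻¹ i) : Face α) ≠ Quotient.mk _ 0 := by
      intro i hi h
      have := (hne _).1 (Quotient.exact (s := SameCycle.setoid _) h)
      rw [Equiv.Perm.inv_eq_iff_eq, h0] at this
      exact hi this
    have := (sameCycle_iff α (α⁻¹ i) (α⁻¹ j)).1
      (Quotient.exact (s := SameCycle.setoid _) (h.unique (aux i hi) (aux j hj)))
    simpa using this
  · rintro ⟨-, h⟩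
    refine ⟨Quotient.mk _ (Fin.last N), fun h => ?_, ?_⟩
    · have := (hne _).1 (Quotient.exact (s := SameCycle.setoid _) h)
      exact hN (by simpa using congrArg Fin.val this)
    · intro y hy
      induction y using Quotient.inductionOn with | _ j => ?_
      refine Quotient.sound (s := SameCycle.setoid _) ((sameCycle_iff α _ _).2 (h ?_ ?_))
      · intro hj
        rw [Set.mem_singleton_iff, ← h0] at hj
        exact hy (congrArg _ (α.injective hj))
      · intro hj
        exact hN (by simpa using congrArg Fin.val (α.injective (hj.trans h0.symm)))

/-! ### Signs -/

/-- Here `c` is the number of chords: the involution is a product of that many disjoint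
transpositions. -/
lemma sign_of_involutive (hα : ∀ i, α (α i) = i) :
    ∃ c : ℕ, 2 * c + (Finset.univ.filter fun i => α i = i).card = N + 1 ∧ sign α = (-1) ^ c := by
  have h2 : α ^ 2 = 1 := by ext i; rw [pow_two]; simp [hα]
  have hall : ∀ m ∈ α.cycleType, m = 2 := by
    intro m hm
    have h3 := two_le_of_mem_cycleType hm
    have h4 := (dvd_of_mem_cycleType hm).trans (orderOf_dvd_of_pow_eq_one h2)
    have := Nat.le_of_dvd (by norm_num) h4
    omega
  have hrep := Multiset.eq_replicate_card.2 hall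
  have hsum : α.cycleType.sum = 2 * Multiset.card α.cycleType := by
    conv_lhs => rw [hrep]
    rw [Multiset.sum_replicate, smul_eq_mul, mul_comm]
  refine ⟨Multiset.card α.cycleType, ?_, ?_⟩
  · rw [← hsum, sum_cycleType]
    have : (Finset.univ.filter fun i => α i = i) = α.supportᶜ := by
      ext i; simp
    rw [this, Finset.card_add_card_compl, Fintype.card_fin]
  · rw [sign_of_cycleType, hsum, pow_add, pow_mul]; simp

lemma sign_of_isCycleOn {s : Finset (Fin (N + 1))} (hs : (rot α).IsCycleOn s)
    (hs' : ∀ i ∉ s, rot α i = i) (hne : s.Nonempty) : sign (rot α) = (-1) ^ (s.card - 1) := by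
  -- The identity is not a cycle in the sense of `IsCycle`, so one-point sets are treated
  -- separately.
  by_cases h : s.card ≤ 1
  · have h1 : s.card = 1 := le_antisymm h hne.card_pos
    obtain ⟨a, rfl⟩ := Finset.card_eq_one.1 h1
    have : rot α = 1 := by
      ext i
      by_cases hi : i = a
      · subst hi
        rw [Finset.coe_singleton, isCycleOn_singleton] at hs
        rw [hs]; rfl
      · rw [hs' i (by simpa using hi)]; rfl
    rw [this]; simp
  · have hnt : (s : Set (Fin (N + 1))).Nontrivial := by
      rw [Finset.nontrivial_coe, ← Finset.one_lt_card_iff_nontrivial]; omega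
    have hsupp : (rot α).support = s := by
      ext i
      rw [mem_support]
      constructor
      · intro h; by_contra hi; exact h (hs' i hi)
      · intro hi; exact hs.apply_ne hnt hi
    have hcyc : (rot α).IsCycle := by
      obtain ⟨a, ha⟩ := hne
      refine ⟨a, hs.apply_ne hnt ha, fun y hy => hs.2 ha ?_⟩
      rw [← hsupp]; exact mem_support.2 hy
    rw [hcyc.sign, hsupp]
    obtain ⟨m, hm⟩ : ∃ m, s.card = m + 1 := ⟨s.card - 1, by omega⟩
    rw [hm, pow_succ]; simp

lemma sign_rot : sign (rot α) = sign α * (-1) ^ N := by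
  rw [rot, Equiv.Perm.sign_mul, sign_finRotate]; rfl

lemma neg_one_pow_eq {a b : ℕ} (h : ((-1) ^ a : ℤˣ) = (-1) ^ b) : a % 2 = b % 2 := by
  rcases Nat.even_or_odd a with ha | ha <;> rcases Nat.even_or_odd b with hb | hb
  · rw [Nat.even_iff] at ha hb; omega
  · rw [ha.neg_one_pow, hb.neg_one_pow] at h; exact absurd h (by decide)
  · rw [ha.neg_one_pow, hb.neg_one_pow] at h; exact absurd h (by decide)
  · rw [Nat.odd_iff] at ha hb; omega

/-- One face makes `rot α` an (N + 1)-cycle of sign (-1)^N, whereas its sign as a product is (-1)^(c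
+ N). -/
lemma even_of_isMaximal (h : IsMaximal α) {c : ℕ} (hc : sign α = (-1) ^ c) : c % 2 = 0 := by
  have h1 := sign_of_isCycleOn (α := α) (s := Finset.univ)
    (by rw [Finset.coe_univ]; exact (isMaximal_iff α).1 h) (by simp) Finset.univ_nonempty
  rw [Finset.card_univ, Fintype.card_fin, sign_rot, hc, ← pow_add] at h1
  have := neg_one_pow_eq h1
  omega

lemma TypeA.mod_four (h : TypeA α) (hα : ∀ i, α (α i) = i) : (N + 1) % 4 = 0 := by
  obtain ⟨c, hc, hs⟩ := sign_of_involutive hα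
  have := even_of_isMaximal h.1 hs
  have h0 : (Finset.univ.filter fun i => α i = i).card = 0 := by
    rw [Finset.card_eq_zero, Finset.filter_eq_empty_iff]
    intro i _; exact h.2 i
  omega

lemma TypeB.mod_four (h : TypeB α) (hα : ∀ i, α (α i) = i) :
    (N + 1) % 4 = 1 ∨ (N + 1) % 4 = 2 := by
  obtain ⟨c, hc, hs⟩ := sign_of_involutive hα
  have := even_of_isMaximal h.1 hs
  obtain ⟨i, hi⟩ := h.2.1
  have h0 : 0 < (Finset.univ.filter fun i => α i = i).card :=
    Finset.card_pos.2 ⟨i, by simpa using hi⟩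
  have h1 : (Finset.univ.filter fun i => α i = i).card ≤ 2 := by
    refine (Finset.card_le_card (t := {0, Fin.last N}) ?_).trans Finset.card_le_two
    intro j hj
    rw [Finset.mem_insert, Finset.mem_singleton]
    exact (h.2.2 j (by simpa using hj)).imp (fun h' => Fin.ext h')
      (fun h' => Fin.ext (by simpa using h'))
  omega

lemma TypeC.chord (h : TypeC α) : N ≠ 0 ∧ α 0 = Fin.last N ∧ α (Fin.last N) = 0 := by
  obtain ⟨⟨i, j, hi, hj, hij, h1, h2⟩, -⟩ := h
  obtain rfl : i = 0 := Fin.ext hi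
  obtain rfl : j = Fin.last N := Fin.ext (by simpa using hj)
  refine ⟨?_, h1, h2⟩
  rintro rfl
  exact hij rfl

lemma TypeC.isCycleOn (h : TypeC α) : (rot α).IsCycleOn {Fin.last N}ᶜ :=
  (card_face_eq_two_iff h.chord.1 h.chord.2.1).1 h.2.2

/-- Now `rot α` is an N-cycle, of sign (-1)^(N - 1), so the number c of chords is odd, and N + 1 =
2c + 1. -/
lemma TypeC.mod_four (h : TypeC α) (hα : ∀ i, α (α i) = i) : (N + 1) % 4 = 3 := by
  obtain ⟨c, hc, hs⟩ := sign_of_involutive hα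
  obtain ⟨hN, hl, hl'⟩ := h.chord
  obtain ⟨f, hf, hf'⟩ := h.2.1
  have h0 : (Finset.univ.filter fun i => α i = i).card = 1 := by
    rw [Finset.card_eq_one]
    refine ⟨f, ?_⟩
    ext i
    simp only [Finset.mem_filter, Finset.mem_univ, true_and, Finset.mem_singleton]
    exact ⟨hf' i, fun h => h ▸ hf⟩
  have hcard : ({Fin.last N}ᶜ : Finset (Fin (N + 1))).card = N := by
    rw [Finset.card_compl, Finset.card_singleton, Fintype.card_fin]; rfl
  have h1 := sign_of_isCycleOn (α := α) (s := {Fin.last N}ᶜ)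
    (by rw [Finset.coe_compl, Finset.coe_singleton]; exact h.isCycleOn)
    (by
      intro i hi
      simp only [Finset.mem_compl, Finset.mem_singleton, not_not] at hi
      rw [hi, rot_last, hl]) (Finset.card_pos.1 (by omega))
  rw [hcard, sign_rot, hs, ← pow_add] at h1
  have := neg_one_pow_eq h1
  omega

end QuasiDiagram

namespace QuasiDiagram

open Equiv.Perm

variable {N : ℕ} {α : Equiv.Perm (Fin (N + 1))}

/-! ### Chains of arrows of quasi-diagrams -/

/-- An arrow is identified with its starting position; a chain is then a segment of an orbit of `rot
α`, determined by its first entry. -/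
lemma getElem_castSucc_eq {l : List (Fin N)} (hl : l.IsChain (Next α)) (m : ℕ)
    (hm : m < l.length) :
    (l[m]).castSucc = (rot α ^ m) (l[0]'(by omega)).castSucc := by
  induction m with
  | zero => rfl
  | succ m ih =>
    rw [pow_succ', Equiv.Perm.mul_apply, ← ih (by omega), rot_castSucc]
    exact (List.isChain_iff_getElem.1 hl m hm).1.symm

/-- The chain consists of the N points following `b` in its orbit. They must avoid the last
position, which starts no arrow, and only the final arrow may end at an isolated point. -/
lemma exists_chain (b : Fin (N + 1)) (h : ∀ m, 1 ≤ m → m ≤ N → (rot α ^ m) b ≠ Fin.last N)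
    (h' : ∀ m, 1 ≤ m → m < N → ∀ i : Fin N, (rot α ^ m) b = i.castSucc → α i.succ ≠ i.succ) :
    ∃ l : List (Fin N), l.length = N ∧ l.IsChain (Next α) := by
  let f : Fin N → Fin N := fun m => ((rot α ^ (m.val + 1)) b).castPred (h _ (by omega) m.2)
  have hf : ∀ m, (f m).castSucc = (rot α ^ (m.val + 1)) b := fun m => Fin.castSucc_castPred _ _
  refine ⟨List.ofFn f, List.length_ofFn, List.isChain_ofFn.2 fun m hm => ?_⟩
  have h1 : α (f ⟨m, by omega⟩).succ = (f ⟨m + 1, hm⟩).castSucc := by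
    rw [← rot_castSucc, hf, hf, ← Equiv.Perm.mul_apply, ← pow_succ']
  refine ⟨h1, ?_⟩
  rw [← h1]
  exact h' (m + 1) (by omega) hm _ (hf ⟨m, by omega⟩).symm

/-- The single cycle of length N + 1 is cut open at the last position, leaving the N positions that
start arrows. A longer chain would have to meet the last position. -/
lemma IsMaximal.chains (h : IsMaximal α)
    (hf : ∀ i : Fin (N + 1), α i = i → i.val = 0 ∨ i.val + 1 = N + 1) :
    (∃ l : List (Fin N), l.length = N ∧ l.IsChain (Next α)) ∧
      ∀ l : List (Fin N), l.length = N + 1 → ¬ l.IsChain (Next α) := by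
  have hc := (isMaximal_iff α).1 h
  rw [← Finset.coe_univ] at hc
  have hcard : (Finset.univ : Finset (Fin (N + 1))).card = N + 1 := by simp
  have hne : ∀ m, 1 ≤ m → m ≤ N → (rot α ^ m) (Fin.last N) ≠ Fin.last N := by
    intro m h1 h2 h3
    have := Nat.le_of_dvd (by omega) ((hc.pow_apply_eq (Finset.mem_univ _)).1 h3)
    omega
  constructor
  · refine exists_chain (Fin.last N) hne fun m h1 h2 i hi hfix => ?_
    have h3 := hf _ hfix
    have h4 : i.succ = Fin.last N := Fin.ext (by simp at h3 ⊢; omega)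
    apply hne (m + 1) (by omega) (by omega)
    rw [pow_succ', Equiv.Perm.mul_apply, hi, rot_castSucc, hfix, h4]
  · intro l hl hch
    obtain ⟨m, hm, he⟩ := hc.exists_pow_eq (Finset.mem_univ (l[0]'(by omega)).castSucc)
      (Finset.mem_univ (Fin.last N))
    rw [← getElem_castSucc_eq hch m (by omega)] at he
    exact Fin.castSucc_ne_last _ he

/-- The positions that start arrows form one N-cycle, cut open after the arrow `b` that ends at the
isolated point. A longer chain would have to continue past `b`. -/
lemma TypeC.chains (h : TypeC α) :
    (∃ l : List (Fin N), l.length = N ∧ l.IsChain (Next α)) ∧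
      ∀ l : List (Fin N), l.length = N + 1 → ¬ l.IsChain (Next α) := by
  obtain ⟨hN, h0, h0'⟩ := h.chord
  have hc := h.isCycleOn
  rw [← Finset.coe_singleton, ← Finset.coe_compl] at hc
  have hcard : ({Fin.last N}ᶜ : Finset (Fin (N + 1))).card = N := by
    rw [Finset.card_compl, Finset.card_singleton, Fintype.card_fin]; rfl
  obtain ⟨f, hf, hf'⟩ := h.2.1
  obtain ⟨b, rfl⟩ : ∃ b : Fin N, f = b.succ := by
    refine Fin.exists_succ_eq.2 ?_ |>.imp fun _ h => h.symm
    rintro rfl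
    rw [h0] at hf
    exact hN (by simpa using congrArg Fin.val hf)
  have hmem : ∀ i : Fin N, i.castSucc ∈ ({Fin.last N}ᶜ : Finset (Fin (N + 1))) := by
    intro i; simp
  constructor
  · refine exists_chain b.castSucc (fun m _ _ h1 => ?_) fun m h1 h2 i hi hfix => ?_
    · have := hc.1.mapsTo.perm_pow m (hmem b)
      rw [h1] at this
      simp at this
    · have h3 := hf' _ hfix
      rw [Fin.succ_inj] at h3
      subst h3
      have := Nat.le_of_dvd (by omega) ((hc.pow_apply_eq (hmem i)).1 hi)
      omega
  · intro l hl hch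
    obtain ⟨m, hm, he⟩ := hc.exists_pow_eq (hmem (l[0]'(by omega))) (hmem b)
    rw [hcard] at hm
    rw [← getElem_castSucc_eq hch m (by omega), Fin.castSucc_inj] at he
    obtain ⟨h1, h2⟩ := List.isChain_iff_getElem.1 hch m (by omega)
    rw [he, hf] at h1
    exact h2 (by rw [he, h1])

/-- A chain of N distinct arrows contains them all, so all positions but the last lie in one cycle
of `rot α`. Type C, or a single point, arises when the last position is fixed; otherwise it joins
that cycle and there is one face. -/
lemma type_of_chains (hα : ∀ i, α (α i) = i) {l : List (Fin N)} (hl : l.length = N)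
    (hch : l.IsChain (Next α)) (hb : ∀ l : List (Fin N), l.length = N + 1 → ¬ l.IsChain (Next α)) :
    TypeA α ∨ TypeB α ∨ TypeC α := by
  have hnodup := hch.nodup_of_bounded hb
  have hmem : ∀ i, ∃ m, ∃ hm : m < l.length, l[m] = i := by
    intro i
    have h1 : l.toFinset = Finset.univ := by
      rw [← Finset.card_eq_iff_eq_univ, List.toFinset_card_of_nodup hnodup, hl, Fintype.card_fin]
    exact List.getElem_of_mem (List.mem_toFinset.1 (h1 ▸ Finset.mem_univ i))
  -- only the end of the last arrow and the first vertex can be isolated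
  have hfix : ∀ (m : ℕ) (hm : m < l.length), α (l[m]).succ = (l[m]).succ → m + 1 = N := by
    intro m hm h1
    by_contra hne
    obtain ⟨h2, h3⟩ := List.isChain_iff_getElem.1 hch m (by omega)
    exact h3 (h2.symm.trans h1)
  have hsame : ∀ i j : Fin N, SameCycle (rot α) i.castSucc j.castSucc := by
    intro i j
    obtain ⟨m, hm, rfl⟩ := hmem i
    obtain ⟨m', hm', rfl⟩ := hmem j
    rw [getElem_castSucc_eq hch m hm, getElem_castSucc_eq hch m' hm']
    exact (sameCycle_pow_right.2 (sameCycle_pow_left.2 (SameCycle.refl _ _)))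
  by_cases h0 : rot α (Fin.last N) = Fin.last N
  · rcases Nat.eq_zero_or_pos N with rfl | hN
    · right; left
      have : Subsingleton (Fin (0 + 1)) := inferInstanceAs (Subsingleton (Fin 1))
      refine ⟨?_, ⟨0, Subsingleton.elim _ _⟩, fun i _ => Or.inl (by omega)⟩
      rw [isMaximal_iff]
      exact isCycleOn_of_subsingleton _ _
    · right; right
      rw [rot_last] at h0
      have h0' : α (Fin.last N) = 0 := by rw [← h0, hα]
      refine ⟨⟨0, Fin.last N, rfl, by simp, ?_, h0, h0'⟩, ?_, ?_⟩
      · intro h; have := congrArg Fin.val h; simp at this; omega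
      -- If the end of the final arrow were not isolated, the arrow starting at its partner would
      -- prolong the chain. The partner is not the last position, which is matched with 0.
      · have hlast : α (l[N - 1]'(by omega)).succ = (l[N - 1]'(by omega)).succ := by
          by_contra hne
          obtain ⟨j, hj⟩ : ∃ j : Fin N, j.castSucc = α (l[N - 1]'(by omega)).succ := by
            refine Fin.exists_castSucc_eq.2 fun h => ?_
            rw [← h0] at h
            exact Fin.succ_ne_zero _ (α.injective h)
          refine hb (l ++ [j]) (by simp [hl]) ?_
          rw [List.isChain_append]
          refine ⟨hch, by simp, fun x hx y hy => ?_⟩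
          rw [List.getLast?_eq_getElem?, List.getElem?_eq_getElem (by omega), Option.mem_def,
            Option.some.injEq] at hx
          simp only [List.head?_cons, Option.mem_def, Option.some.injEq] at hy
          simp only [hl] at hx
          subst hx; subst hy
          exact ⟨hj.symm, by rw [hj]; exact hne⟩
        refine ⟨_, hlast, fun y hy => ?_⟩
        obtain ⟨i, rfl⟩ : ∃ i : Fin N, i.succ = y := by
          refine Fin.exists_succ_eq.2 ?_
          rintro rfl
          rw [h0] at hy
          have := congrArg Fin.val hy
          simp at this; omega
        obtain ⟨m, hm, rfl⟩ := hmem i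
        have := hfix m hm hy
        obtain rfl : m = N - 1 := by omega
        rfl
      · rw [card_face_eq_two_iff (by omega) h0]
        refine ⟨?_, ?_⟩
        · have hfix : rot α (Fin.last N) = Fin.last N := by rw [rot_last, h0]
          refine ⟨fun i hi h => hi ?_, (rot α).injective.injOn,
            fun i hi => ⟨(rot α)⁻¹ i, ?_, by simp⟩⟩
          · rw [Set.mem_singleton_iff] at h ⊢
            rw [← hfix] at h
            exact (rot α).injective h
          · intro h
            rw [Set.mem_singleton_iff, Equiv.Perm.inv_eq_iff_eq, hfix] at h
            exact hi h
        · intro i hi j hj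
          obtain ⟨i, rfl⟩ := Fin.exists_castSucc_eq.2 hi
          obtain ⟨j, rfl⟩ := Fin.exists_castSucc_eq.2 hj
          exact hsame i j
  · have hlast : ∃ i : Fin N, rot α (Fin.last N) = i.castSucc := by
      obtain ⟨i, hi⟩ := Fin.exists_castSucc_eq.2 h0
      exact ⟨i, hi.symm⟩
    obtain ⟨i₀, hi₀⟩ := hlast
    have hsame' : ∀ i, SameCycle (rot α) i i₀.castSucc := by
      intro i
      by_cases hi : i = Fin.last N
      · subst hi; rw [← hi₀, sameCycle_apply_right]
      · obtain ⟨i, rfl⟩ := Fin.exists_castSucc_eq.2 hi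
        exact hsame i i₀
    have hmax : IsMaximal α := by
      rw [isMaximal_iff]
      exact ⟨Set.bijOn_univ.2 (rot α).bijective, fun i _ j _ => (hsame' i).trans (hsame' j).symm⟩
    have hiso : ∀ i : Fin (N + 1), α i = i → i.val = 0 ∨ i.val + 1 = N + 1 := by
      intro i hi
      rcases Fin.eq_zero_or_eq_succ i with rfl | ⟨j, rfl⟩
      · left; rfl
      · right
        obtain ⟨m, hm, rfl⟩ := hmem j
        have hmN := hfix m hm hi
        -- The arrow mapped by `rot α` to the last position has no successor, so it is the final
        -- arrow of the chain. Hence an isolated end of the final arrow can only be the last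
        -- position.
        obtain ⟨j, hj⟩ : ∃ j : Fin N, j.castSucc = (rot α)⁻¹ (Fin.last N) := by
          refine Fin.exists_castSucc_eq.2 fun h => h0 ?_
          rw [Equiv.Perm.inv_eq_iff_eq] at h
          exact h.symm
        obtain ⟨m', hm', rfl⟩ := hmem j
        rw [Equiv.Perm.eq_inv_iff_eq, rot_castSucc] at hj
        by_cases hmm : m' + 1 < l.length
        · obtain ⟨h2, h3⟩ := List.isChain_iff_getElem.1 hch m' hmm
          exact absurd (h2.symm.trans hj) (Fin.castSucc_ne_last _)
        · obtain rfl : m' = m := by omega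
          rw [hi] at hj
          rw [hj]; simp
    by_cases hex : ∃ i, α i = i
    · exact Or.inr (Or.inl ⟨hmax, hex, hiso⟩)
    · push Not at hex
      exact Or.inl ⟨hmax, hex⟩

theorem type_iff (hα : ∀ i, α (α i) = i) :
    (TypeA α ∨ TypeB α ∨ TypeC α) ↔
      (∃ l : List (Fin N), l.length = N ∧ l.IsChain (Next α)) ∧
        ∀ l : List (Fin N), l.length = N + 1 → ¬ l.IsChain (Next α) := by
  constructor
  · rintro (h | h | h)
    · exact h.1.chains fun i hi => absurd hi (h.2 i)
    · exact h.1.chains h.2.2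
    · exact h.chains
  · rintro ⟨⟨l, hl, hch⟩, hb⟩
    exact type_of_chains hα hl hch hb

/-- The type only depends on the number of points. -/
theorem type_congr {β : Equiv.Perm (Fin (N + 1))} (hα : ∀ i, α (α i) = i) (hβ : ∀ i, β (β i) = i)
    (h : TypeA α ∨ TypeB α ∨ TypeC α) (h' : TypeA β ∨ TypeB β ∨ TypeC β) :
    (TypeA α ↔ TypeA β) ∧ (TypeB α ↔ TypeB β) ∧ (TypeC α ↔ TypeC β) := by
  -- The residues modulo 4 of the common size are 0, then 1 or 2, then 3: they are disjoint and
  -- determine the type.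
  have a1 := fun h : TypeA α => h.mod_four hα
  have a2 := fun h : TypeB α => h.mod_four hα
  have a3 := fun h : TypeC α => h.mod_four hα
  have b1 := fun h : TypeA β => h.mod_four hβ
  have b2 := fun h : TypeB β => h.mod_four hβ
  have b3 := fun h : TypeC β => h.mod_four hβ
  generalize TypeA α = x1 at *
  generalize TypeB α = x2 at *
  generalize TypeC α = x3 at *
  generalize TypeA β = y1 at *
  generalize TypeB β = y2 at *
  generalize TypeC β = y3 at *
  rcases h with h | h | h <;> rcases h' with h' | h' | h' <;> grind

end QuasiDiagram

namespace GentleFrame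

variable {k : Type v} {A : Type u} [Field k] [Ring A] [Algebra k A] (G : GentleFrame k A)

/-! ## Finite dimension and bounded words -/

lemma exists_bound [Module.Finite k A] : ∃ L, ∀ l : List G.E, l.length = L → ¬ l.IsChain G.Nz := by
  by_contra h
  push Not at h
  choose f hf hc using h
  have hfin : Finite (G.V ⊕ G.Word) := Module.Finite.finite_basis G.basis
  have : Function.Injective fun L : ℕ => (Sum.inr ⟨f (L + 1),
      List.ne_nil_of_length_eq_add_one (hf _), hc _⟩ : G.V ⊕ G.Word) := by
    intro L M h
    have := congrArg List.length (congrArg Subtype.val (Sum.inr.inj h))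
    rw [hf, hf] at this
    omega
  exact not_injective_infinite_finite _ this

lemma length_lt_of_bound {E : Type*} {R : E → E → Prop} {L : ℕ}
    (hL : ∀ l : List E, l.length = L → ¬ l.IsChain R) {l : List E} (hl : l.IsChain R) :
    l.length < L := by
  by_contra h
  exact hL (l.take L) (by simp; omega) (hl.take _)

lemma moduleFinite_of_bound {L : ℕ} (hL : ∀ l : List G.E, l.length = L → ¬ l.IsChain G.Nz) :
    Module.Finite k A := by
  have h1 : Finite {l : List G.E // l.length < L} := (List.finite_length_lt G.E L).to_subtype
  have h2 : Finite G.Word := by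
    refine Finite.of_injective
      (fun l : G.Word => (⟨l.1, length_lt_of_bound hL l.2.2⟩ : {l : List G.E // l.length < L})) ?_
    intro l m h
    exact Subtype.ext (congrArg (fun l => l.1) h)
  exact Module.Finite.of_basis G.basis

/-! ## Coordinates with respect to paths -/

/-- The element given by a vertex and a list of arrows. -/
noncomputable def val (i : G.V) (l : List G.E) : A := G.e i * G.W l

/-- The vertex `i` and the list `l` of arrows describe a path which is nonzero in the algebra. -/
def IsPath (i : G.V) (l : List G.E) : Prop := l.IsChain G.Nz ∧ ∀ a ∈ l.head?, G.s a = i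

variable {G}

lemma IsPath.val_eq {i : G.V} {l : List G.E} (h : G.IsPath i l) (hl : l ≠ []) :
    G.val i l = G.W l := by
  obtain ⟨a, l, rfl⟩ := List.exists_cons_of_ne_nil hl
  exact G.e_mul_W (h.2 a (by simp))

lemma val_nil (i : G.V) : G.val i [] = G.e i := by rw [val, W_nil, mul_one]

lemma IsPath.val_ne_zero {i : G.V} {l : List G.E} (h : G.IsPath i l) : G.val i l ≠ 0 := by
  by_cases hl : l = []
  · subst hl; rw [val_nil]; exact G.e_ne_zero i
  · rw [h.val_eq hl]; exact G.W_ne_zero hl h.1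

lemma isPath_of_val_ne_zero {i : G.V} {l : List G.E} (h : G.val i l ≠ 0) : G.IsPath i l := by
  refine ⟨G.isChain_of_W_ne_zero fun h0 => h (by rw [val, h0, mul_zero]), ?_⟩
  intro a ha
  by_contra hne
  obtain ⟨m, rfl⟩ : ∃ m, l = a :: m := by
    cases l with
    | nil => simp at ha
    | cons b m => simp at ha; exact ⟨m, by rw [ha]⟩
  exact h (G.e_mul_W_of_ne hne)

lemma val_mul_x (i : G.V) (l : List G.E) (a : G.E) : G.val i l * G.x a = G.val i (l ++ [a]) := by
  rw [val, val, W_append, mul_assoc, W_cons, W_nil, mul_one]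

lemma x_mul_val (a : G.E) (l : List G.E) : G.x a * G.val (G.t a) l = G.val (G.s a) (a :: l) := by
  rw [val, val, W_cons, ← mul_assoc, ← mul_assoc, G.x_mul_e, G.e_mul_x]

lemma x_mul_val_of_ne {a : G.E} {i : G.V} (h : G.t a ≠ i) (l : List G.E) :
    G.x a * G.val i l = 0 := by
  rw [val, ← mul_assoc, G.x_mul_e_of_ne h, zero_mul]

variable (G) in
/-- The coefficient of a path. -/
noncomputable def coordP (i : G.V) (l : List G.E) : A →ₗ[k] k :=
  match l with
  | [] => G.coordV i
  | l => G.coordW l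

lemma coordP_nil (i : G.V) : G.coordP i [] = G.coordV i := rfl

lemma coordP_of_ne_nil (i : G.V) {l : List G.E} (hl : l ≠ []) : G.coordP i l = G.coordW l := by
  cases l with
  | nil => exact absurd rfl hl
  | cons a l => rfl

open Classical in
lemma coordP_val {i j : G.V} {l m : List G.E} (hl : G.IsPath i l) (hm : G.IsPath j m) :
    G.coordP i l (G.val j m) = if i = j ∧ l = m then 1 else 0 := by
  by_cases h1 : l = []
  · subst h1
    by_cases h2 : m = []
    · subst h2
      rw [coordP_nil, val_nil, coordV_e]
      simp
    · rw [coordP_nil, hm.val_eq h2, G.coordV_W _ h2, if_neg]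
      rintro ⟨-, h⟩; exact h2 h.symm
  · rw [coordP_of_ne_nil _ h1]
    by_cases h2 : m = []
    · subst h2
      rw [val_nil, coordW_e, if_neg]
      rintro ⟨-, h⟩; exact h1 h
    · rw [hm.val_eq h2, coordW_W _ h2 hm.1]
      by_cases h : l = m
      · subst h
        obtain ⟨a, l, rfl⟩ := List.exists_cons_of_ne_nil h1
        have : i = j := (hl.2 a (by simp)).symm.trans (hm.2 a (by simp))
        simp [this]
      · simp [h]

lemma ext_coordP {y z : A} (h : ∀ i l, G.IsPath i l → G.coordP i l y = G.coordP i l z) : y = z := by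
  refine G.ext_coord (fun i => h i [] ⟨by simp, by simp⟩) fun l hl hc => ?_
  obtain ⟨a, l, rfl⟩ := List.exists_cons_of_ne_nil hl
  exact h (G.s a) (a :: l) ⟨hc, by simp⟩

theorem path_induction {p : A → Prop} (zero : p 0) (add : ∀ y z, p y → p z → p (y + z))
    (smul : ∀ (c : k) y, p y → p (c • y)) (path : ∀ i l, G.IsPath i l → p (G.val i l)) (y : A) :
    p y := by
  refine G.induction zero add smul (fun i => ?_) (fun l hl hc => ?_) y
  · rw [← val_nil]; exact path _ _ ⟨by simp, by simp⟩
  · obtain ⟨a, l, rfl⟩ := List.exists_cons_of_ne_nil hl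
    have : G.IsPath (G.s a) (a :: l) := ⟨hc, by simp⟩
    rw [← this.val_eq hl]; exact path _ _ this

lemma coordP_mul_x {i : G.V} {l : List G.E} {a : G.E} (h : G.IsPath i (l ++ [a]))
    (hl : G.IsPath i l) (y : A) : G.coordP i (l ++ [a]) (y * G.x a) = G.coordP i l y := by
  classical
  induction y using G.path_induction with
  | zero => simp
  | add y z hy hz => rw [add_mul, map_add, hy, hz, map_add]
  | smul c y hy => rw [smul_mul_assoc, map_smul, hy, map_smul]
  | path j m hm =>
    rw [val_mul_x, coordP_val hl hm]
    by_cases hz : G.val j (m ++ [a]) = 0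
    · rw [hz, map_zero, if_neg]
      rintro ⟨rfl, rfl⟩
      exact h.val_ne_zero hz
    · rw [coordP_val h (isPath_of_val_ne_zero hz)]
      simp

lemma coordP_x_mul {a : G.E} {l : List G.E} (h : G.IsPath (G.s a) (a :: l))
    (hl : G.IsPath (G.t a) l) (y : A) :
    G.coordP (G.s a) (a :: l) (G.x a * y) = G.coordP (G.t a) l y := by
  classical
  induction y using G.path_induction with
  | zero => simp
  | add y z hy hz => rw [mul_add, map_add, hy, hz, map_add]
  | smul c y hy => rw [mul_smul_comm, map_smul, hy, map_smul]
  | path j m hm =>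
    rw [coordP_val hl hm]
    by_cases hj : G.t a = j
    · subst hj
      rw [x_mul_val]
      by_cases hz : G.val (G.s a) (a :: m) = 0
      · rw [hz, map_zero, if_neg]
        rintro ⟨-, rfl⟩
        exact h.val_ne_zero hz
      · rw [coordP_val h (isPath_of_val_ne_zero hz)]
        simp
    · rw [x_mul_val_of_ne hj, map_zero, if_neg]
      rintro ⟨h, -⟩; exact hj h

/-! ## Maximal paths -/

variable (G) in
/-- Nonzero elements annihilated by all arrows from both sides. -/
def IsMaxElt (y : A) : Prop := y ≠ 0 ∧ ∀ a, y * G.x a = 0 ∧ G.x a * y = 0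

variable (G) in
/-- There is at most one maximal path. -/
def UniqueMax : Prop :=
  ∀ i l j m, G.IsMaxElt (G.val i l) → G.IsMaxElt (G.val j m) → i = j ∧ l = m

lemma IsMaxElt.isPath {i : G.V} {l : List G.E} (h : G.IsMaxElt (G.val i l)) : G.IsPath i l :=
  isPath_of_val_ne_zero h.1

/-- Multiplication by an arrow sends the paths it does not kill to distinct paths, so nothing
cancels and every path in the support of `y` is itself maximal. -/
lemma isMaxElt_val_of_coordP_ne_zero {y : A} (hy : ∀ a, y * G.x a = 0 ∧ G.x a * y = 0) {i : G.V}
    {l : List G.E} (hl : G.IsPath i l) (h : G.coordP i l y ≠ 0) : G.IsMaxElt (G.val i l) := by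
  refine ⟨hl.val_ne_zero, fun a => ⟨?_, ?_⟩⟩
  · by_contra hne
    rw [val_mul_x] at hne
    have := coordP_mul_x (isPath_of_val_ne_zero hne) hl y
    rw [(hy a).1, map_zero] at this
    exact h this.symm
  · by_contra hne
    obtain rfl : G.t a = i := by
      by_contra h'; exact hne (G.x_mul_val_of_ne h' _)
    rw [x_mul_val] at hne
    have := coordP_x_mul (isPath_of_val_ne_zero hne) hl y
    rw [(hy a).2, map_zero] at this
    exact h this.symm

/-- With one maximal path, the elements killed by all arrows on both sides form a line. In this form
uniqueness can be transferred to another frame. -/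
lemma UniqueMax.exists_smul_eq (hG : G.UniqueMax) {y z : A} (hy : G.IsMaxElt y)
    (hz : G.IsMaxElt z) : ∃ c : k, z = c • y := by
  classical
  have aux : ∀ y, G.IsMaxElt y → ∃ i l, G.IsMaxElt (G.val i l) ∧ ∃ c : k, c ≠ 0 ∧
      y = c • G.val i l := by
    intro y hy
    obtain ⟨i, l, hl, hne⟩ : ∃ i l, G.IsPath i l ∧ G.coordP i l y ≠ 0 := by
      by_contra h
      push Not at h
      exact hy.1 (G.ext_coordP fun i l hl => by rw [h i l hl, map_zero])
    have hmax := isMaxElt_val_of_coordP_ne_zero hy.2 hl hne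
    refine ⟨i, l, hmax, G.coordP i l y, hne, G.ext_coordP fun j m hm => ?_⟩
    rw [map_smul, coordP_val hm hl, smul_eq_mul, mul_ite, mul_one, mul_zero]
    split_ifs with h
    · rw [h.1, h.2]
    · by_contra hne'
      exact h (hG _ _ _ _ (isMaxElt_val_of_coordP_ne_zero hy.2 hm hne') hmax)
  obtain ⟨i, l, h1, c, hc, rfl⟩ := aux y hy
  obtain ⟨j, m, h2, d, hd, rfl⟩ := aux z hz
  obtain ⟨rfl, rfl⟩ := hG _ _ _ _ h1 h2
  exact ⟨d * c⁻¹, by rw [smul_smul, inv_mul_cancel_right₀ hc]⟩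

/-- Being killed by all arrows is the same as being killed by the radical. -/
lemma IsMaxElt.of_J_eq {y : A} (hy : G.IsMaxElt y) (G' : GentleFrame k A)
    (hJ : ∀ z, z ∈ G'.J → z ∈ G.J) : G'.IsMaxElt y := by
  have key : ∀ z ∈ G.J, y * z = 0 ∧ z * y = 0 := by
    intro z hz
    refine G.J_induction (p := fun z => y * z = 0 ∧ z * y = 0) (by simp) ?_ ?_ ?_ hz
    · intro z z' h h'; rw [mul_add, add_mul, h.1, h.2, h'.1, h'.2]; simp
    · intro c z h; rw [mul_smul_comm, smul_mul_assoc, h.1, h.2]; simp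
    · intro l hl _
      constructor
      · obtain ⟨a, l, rfl⟩ := List.exists_cons_of_ne_nil hl
        rw [W_cons, ← mul_assoc, (hy.2 a).1, zero_mul]
      · obtain ⟨m, a, rfl⟩ : ∃ m a, l = m ++ [a] :=
          ⟨_, _, (List.dropLast_append_getLast hl).symm⟩
        rw [W_append, mul_assoc, W_cons, W_nil, mul_one, (hy.2 a).2, mul_zero]
  exact ⟨hy.1, fun a => key _ (hJ _ (G'.x_mem_J a))⟩

lemma UniqueMax.of_J_eq (hG : G.UniqueMax) (G' : GentleFrame k A) (hJ : ∀ z, z ∈ G'.J ↔ z ∈ G.J) :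
    G'.UniqueMax := by
  classical
  intro i l j m h h'
  obtain ⟨c, hc⟩ := hG.exists_smul_eq (h.of_J_eq G fun z hz => (hJ z).2 hz)
    (h'.of_J_eq G fun z hz => (hJ z).2 hz)
  have h1 := congrArg (G'.coordP i l) hc
  rw [map_smul, coordP_val h.isPath h.isPath, coordP_val h.isPath h'.isPath] at h1
  by_contra hne
  rw [if_neg hne, if_pos ⟨rfl, rfl⟩, smul_eq_mul, mul_one] at h1
  rw [← h1, zero_smul] at hc
  exact h'.1 hc

/-- The path is prolonged at either end for as long as possible; the bound on lengths makes this
stop, and no arrow is lost. -/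
lemma exists_isMaxElt {L : ℕ} (hL : ∀ l : List G.E, l.length = L → ¬ l.IsChain G.Nz) {i : G.V}
    {l : List G.E} (hl : G.IsPath i l) :
    ∃ j m, G.IsMaxElt (G.val j m) ∧ ∀ a ∈ l, a ∈ m := by
  obtain ⟨d, hd⟩ : ∃ d, L ≤ l.length + d := ⟨L, by omega⟩
  induction d generalizing i l with
  | zero => exact absurd (length_lt_of_bound hL hl.1) (by omega)
  | succ d ih =>
    by_cases h : G.IsMaxElt (G.val i l)
    · exact ⟨i, l, h, fun _ h => h⟩
    · rw [IsMaxElt, not_and] at h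
      have h := h hl.val_ne_zero
      push Not at h
      obtain ⟨a, ha⟩ := h
      by_cases h0 : G.val i l * G.x a = 0
      · have h1 := ha h0
        obtain rfl : G.t a = i := by
          by_contra h'; exact h1 (x_mul_val_of_ne h' _)
        rw [x_mul_val] at h1
        obtain ⟨j, m, hm, hmem⟩ := ih (isPath_of_val_ne_zero h1) (by simp; omega)
        exact ⟨j, m, hm, fun b hb => hmem b (List.mem_cons_of_mem _ hb)⟩
      · rw [val_mul_x] at h0
        obtain ⟨j, m, hm, hmem⟩ := ih (isPath_of_val_ne_zero h0) (by simp; omega)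
        exact ⟨j, m, hm, fun b hb => hmem b (List.mem_append_left _ hb)⟩

/-! ## Nilpotent elements and products of elements of the radical -/

lemma prod_mem_span {ys : List A} (h : ∀ y ∈ ys, y ∈ G.J) :
    ys.prod ∈ Submodule.span k {z | ∃ l : List G.E, ys.length ≤ l.length ∧ z = G.W l} := by
  induction ys with
  | nil => exact Submodule.subset_span ⟨[], le_rfl, rfl⟩
  | cons y ys ih =>
    rw [List.prod_cons]
    have hys := ih fun z hz => h z (by simp [hz])
    refine G.J_induction (p := fun y => y * ys.prod ∈ Submodule.span k
      {z | ∃ l : List G.E, (y :: ys).length ≤ l.length ∧ z = G.W l}) ?_ ?_ ?_ ?_ (h y (by simp))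
    · rw [zero_mul]; exact Submodule.zero_mem _
    · intro z z' hz hz'; rw [add_mul]; exact Submodule.add_mem _ hz hz'
    · intro c z hz; rw [smul_mul_assoc]; exact Submodule.smul_mem _ _ hz
    · intro l hl _
      have hl' : 1 ≤ l.length := List.length_pos_iff_ne_nil.2 hl
      generalize ys.prod = z at hys
      induction hys using Submodule.span_induction with
      | zero => rw [mul_zero]; exact Submodule.zero_mem _
      | add z z' _ _ hz hz' => rw [mul_add]; exact Submodule.add_mem _ hz hz'
      | smul c z _ hz => rw [mul_smul_comm]; exact Submodule.smul_mem _ _ hz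
      | mem z hz =>
        obtain ⟨m, hm, rfl⟩ := hz
        exact Submodule.subset_span ⟨l ++ m, by simp; omega, (G.W_append l m).symm⟩

lemma prod_eq_zero {L : ℕ} (hL : ∀ l : List G.E, l.length = L → ¬ l.IsChain G.Nz) {ys : List A}
    (h : ∀ y ∈ ys, y ∈ G.J) (hys : ys.length = L) : ys.prod = 0 := by
  have h1 : Submodule.span k {z | ∃ l : List G.E, ys.length ≤ l.length ∧ z = G.W l} = ⊥ := by
    rw [Submodule.span_eq_bot]
    rintro _ ⟨l, hl, rfl⟩
    refine G.W_eq_zero fun hc => ?_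
    have := length_lt_of_bound hL hc
    omega
  have := prod_mem_span h
  rwa [h1, Submodule.mem_bot] at this

/-- This characterises J without reference to a frame: J is nilpotent when words are bounded, and
the quotient k^V has no nilpotent elements. -/
lemma mem_J_iff_isNilpotent {L : ℕ} (hL : ∀ l : List G.E, l.length = L → ¬ l.IsChain G.Nz)
    (y : A) : y ∈ G.J ↔ IsNilpotent y := by
  constructor
  · intro hy
    refine ⟨L, ?_⟩
    rw [← List.prod_replicate]
    exact prod_eq_zero hL (fun z hz => (List.eq_of_mem_replicate hz) ▸ hy) List.length_replicate
  · rintro ⟨m, hm⟩ i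
    have : ∀ m, G.coordV i (y ^ m) = G.coordV i y ^ m := by
      intro m
      induction m with
      | zero => rw [pow_zero, pow_zero, coordV_one]
      | succ m ih => rw [pow_succ, pow_succ, coordV_mul, ih]
    have h := this m
    rw [hm, map_zero] at h
    exact eq_zero_of_pow_eq_zero h.symm

/-- A nonzero word is a nonzero product of elements of J. Expanded in the other frame, such a
product requires a nonzero word with at least as many letters, hence one with exactly as many. -/
lemma exists_chain_of_J_eq (G' : GentleFrame k A) (hJ : ∀ z, z ∈ G'.J ↔ z ∈ G.J) {l : List G.E}
    (hl : l.IsChain G.Nz) : ∃ m : List G'.E, m.length = l.length ∧ m.IsChain G'.Nz := by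
  by_contra h
  push Not at h
  by_cases h0 : l = []
  · subst h0
    exact h [] rfl (by simp)
  · have := prod_eq_zero (G := G') h (ys := l.map G.x)
      (fun y hy => by
        obtain ⟨a, -, rfl⟩ := List.mem_map.1 hy
        exact (hJ _).2 (G.x_mem_J a)) (by simp)
    exact G.W_ne_zero h0 hl this

/-! ## Threads -/

variable (G) in
/-- The maximal path runs through all arrows exactly once: `v` lists its vertices and `a` its
arrows. -/
structure IsThread {N : ℕ} (v : Fin (N + 1) → G.V) (a : Fin N → G.E) : Prop where
  s_eq : ∀ i, G.s (a i) = v i.castSucc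
  t_eq : ∀ i, G.t (a i) = v i.succ
  nz_iff : ∀ i j, G.Nz (a i) (a j) ↔ i.val + 1 = j.val
  bijective : Function.Bijective a
  surjective : Function.Surjective v

lemma UniqueMax.mem {L : ℕ} (hL : ∀ l : List G.E, l.length = L → ¬ l.IsChain G.Nz)
    (hU : G.UniqueMax) {i : G.V} {l : List G.E} (h : G.IsMaxElt (G.val i l)) (a : G.E) :
    a ∈ l := by
  obtain ⟨j, m, hm, hmem⟩ := exists_isMaxElt hL (i := G.s a) (l := [a]) ⟨by simp, by simp⟩
  obtain ⟨-, rfl⟩ := hU _ _ _ _ h hm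
  exact hmem a (by simp)

/-- Every arrow extends to a maximal path, so it lies on the only one; boundedness forbids
repetitions. -/
lemma UniqueMax.isThread {L : ℕ} (hL : ∀ l : List G.E, l.length = L → ¬ l.IsChain G.Nz)
    (hU : G.UniqueMax) {i : G.V} {l : List G.E} (h : G.IsMaxElt (G.val i l)) {N : ℕ}
    (hN : l.length = N) {v : Fin (N + 1) → G.V} (hv0 : v 0 = i)
    (hvs : ∀ j : Fin N, v j.succ = G.t (l[j.val]'(by omega))) :
    G.IsThread v (fun j : Fin N => l[j.val]'(by omega)) := by
  have hl := h.isPath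
  have hnodup := hl.1.nodup_of_bounded hL
  have hs : ∀ j : Fin N, G.s (l[j.val]'(by omega)) = v j.castSucc := by
    rintro ⟨j, hj⟩
    cases j with
    | zero =>
      refine (hl.2 _ ?_).trans hv0.symm
      rw [List.head?_eq_getElem?, Option.mem_def, List.getElem?_eq_getElem]
    | succ j =>
      have h1 := List.isChain_iff_getElem.1 hl.1 j (by omega)
      rw [← Nz.t_eq_s G h1]
      exact (hvs ⟨j, by omega⟩).symm
  refine ⟨hs, fun j => (hvs j).symm, fun j j' => ⟨fun hn => ?_, fun hj => ?_⟩, ⟨?_, ?_⟩, ?_⟩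
  · by_cases hj : j.val + 1 < N
    · have h1 := List.isChain_iff_getElem.1 hl.1 j (by omega)
      have h2 := G.nz_right h1 hn
      exact (hnodup.getElem_inj_iff).1 h2
    -- A successor of the final arrow would already occur in `l`, so prolonging `l` by it would give
    -- a chain with a repetition.
    · have h1 : (l ++ [l[j'.val]'(by omega)]).IsChain G.Nz := by
        rw [List.isChain_append]
        refine ⟨hl.1, by simp, fun x hx y hy => ?_⟩
        rw [List.getLast?_eq_getElem?, List.getElem?_eq_getElem (by omega), Option.mem_def,
          Option.some.injEq] at hx
        simp only [List.head?_cons, Option.mem_def, Option.some.injEq] at hy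
        subst hx; subst hy
        convert hn using 2
        omega
      have h2 := h1.nodup_of_bounded hL
      rw [List.nodup_append] at h2
      exact absurd rfl (h2.2.2 (l[j'.val]'(by omega)) (List.getElem_mem _) _ (by simp))
  · have h1 := List.isChain_iff_getElem.1 hl.1 j (by omega)
    have : j'.val = j.val + 1 := hj.symm
    simp only [this]
    exact h1
  · intro j j' hj
    exact Fin.ext ((hnodup.getElem_inj_iff).1 hj)
  · intro a
    obtain ⟨m, hm, rfl⟩ := List.getElem_of_mem (hU.mem hL h a)
    exact ⟨⟨m, by omega⟩, rfl⟩
  · intro j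
    -- A vertex met by no arrow is a trivial maximal path, hence the only one; any other vertex is
    -- an end of an arrow of `l`.
    by_cases hj : G.IsMaxElt (G.val j [])
    · obtain ⟨rfl, rfl⟩ := hU _ _ _ _ h hj
      exact ⟨0, hv0⟩
    · rw [IsMaxElt, val_nil, not_and] at hj
      have hj := hj (G.e_ne_zero j)
      push Not at hj
      obtain ⟨a, ha⟩ := hj
      obtain ⟨m, hm, hma⟩ := List.getElem_of_mem (hU.mem hL h a)
      by_cases h0 : G.s a = j
      · refine ⟨(⟨m, by omega⟩ : Fin N).castSucc, ?_⟩
        rw [← hs]; dsimp only; rw [hma, h0]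
      · have h1 := ha (G.e_mul_x_of_ne h0)
        have h2 : G.t a = j := by
          by_contra h2; exact h1 (G.x_mul_e_of_ne h2)
        refine ⟨(⟨m, by omega⟩ : Fin N).succ, ?_⟩
        rw [hvs]; dsimp only; rw [hma, h2]

end GentleFrame

/-! ### Pairings of the positions along a path -/

lemma length_le_of_bijective {E : Type*} {R : E → E → Prop} {N L : ℕ} {a : Fin N → E}
    (ha : Function.Bijective a) (hL : ∀ l : List E, l.length = L → ¬ l.IsChain R) {l : List E}
    (hl : l.IsChain R) : l.length ≤ N := by
  classical
  have : Fintype E := Fintype.ofBijective a ha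
  have h1 := List.Nodup.length_le_card (hl.nodup_of_bounded hL)
  rwa [← Fintype.card_of_bijective ha, Fintype.card_fin] at h1

/-- `α` exchanges the positions at which `v` has the same value. -/
def IsPairing {N : ℕ} {V : Type*} (v : Fin N → V) (α : Equiv.Perm (Fin N)) : Prop :=
  (∀ i j, i ≠ j → v i = v j → α i = j) ∧ ∀ i, (∀ j, i ≠ j → v i ≠ v j) → α i = i

namespace IsPairing

variable {N : ℕ} {V : Type*} {v : Fin N → V} {α : Equiv.Perm (Fin N)}

lemma apply_eq (h : IsPairing v α) (i : Fin N) : v (α i) = v i := by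
  by_cases hi : ∃ j, i ≠ j ∧ v i = v j
  · obtain ⟨j, hij, hv⟩ := hi
    rw [h.1 i j hij hv, hv]
  · push Not at hi
    rw [h.2 i hi]

lemma involutive (h : IsPairing v α) (i : Fin N) : α (α i) = i := by
  by_cases hi : α i = i
  · rw [hi, hi]
  · exact h.1 _ _ hi (h.apply_eq i)

/-- The hypothesis says that no value is taken three times, so a partner is unique if it exists. -/
lemma exists_of_injective (hv : ∀ i j l : Fin N, i < j → j < l → v i = v j → v j ≠ v l) :
    ∃ α, IsPairing v α := by
  have key : ∀ i, ∃ j, (∀ l, i ≠ l → v i = v l → j = l) ∧ ((∀ l, i ≠ l → v i ≠ v l) → j = i) := by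
    intro i
    by_cases hi : ∃ j, i ≠ j ∧ v i = v j
    · obtain ⟨j, hij, hvj⟩ := hi
      refine ⟨j, fun l hil hvl => ?_, fun h => absurd hvj (h j hij)⟩
      by_contra hjl
      have a1 := hv i j l
      have a2 := hv i l j
      have a3 := hv j i l
      have a4 := hv j l i
      have a5 := hv l i j
      have a6 := hv l j i
      rw [← hvj, ← hvl] at *
      simp only [ne_eq, not_true_eq_false, imp_false, Fin.lt_def, Fin.ext_iff] at *
      omega
    · push Not at hi
      exact ⟨i, fun l h1 h2 => absurd h2 (hi l h1), fun _ => rfl⟩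
  choose f hf hf' using key
  have hinv : Function.Involutive f := by
    intro i
    by_cases hi : ∃ j, i ≠ j ∧ v i = v j
    · obtain ⟨j, hij, hvj⟩ := hi
      rw [hf i j hij hvj]
      exact hf j i hij.symm hvj.symm
    · push Not at hi
      rw [hf' i hi, hf' i hi]
  exact ⟨hinv.toPerm, hf, hf'⟩

end IsPairing

/-! ### Relations along the maximal path -/

namespace GentleFrame

variable {k : Type v} {A : Type u} [Field k] [Ring A] [Algebra k A] {G : GentleFrame k A}

namespace IsThread

variable {N : ℕ} {v : Fin (N + 1) → G.V} {a : Fin N → G.E}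

lemma x_mul_x_eq_zero (T : G.IsThread v a) {i j : Fin N} (h : i.val + 1 ≠ j.val) :
    G.x (a i) * G.x (a j) = 0 := by
  by_contra h0
  exact h ((T.nz_iff i j).1 h0)

/-- Three visits give three arrows ending at one vertex, unless the first visit is the start of the
path. In that case the other two incoming arrows both have product zero with the first arrow,
against `rel_left`. -/
lemma not_three (T : G.IsThread v a) (i j l : Fin (N + 1)) (hij : i < j) (hjl : j < l)
    (h1 : v i = v j) : v j ≠ v l := by
  intro h2
  obtain ⟨j', rfl⟩ : ∃ j' : Fin N, j'.succ = j := Fin.exists_succ_eq.2 (by rintro rfl; simp at hij)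
  obtain ⟨l', rfl⟩ : ∃ l' : Fin N, l'.succ = l := Fin.exists_succ_eq.2 (by rintro rfl; simp at hjl)
  obtain ⟨i', rfl⟩ : ∃ i' : Fin N, i'.castSucc = i :=
    Fin.exists_castSucc_eq.2 (by rintro rfl; exact absurd hij (by simp [Fin.lt_def]))
  obtain ⟨m, hm⟩ : ∃ m : Fin N, m.castSucc = j'.succ :=
    Fin.exists_castSucc_eq.2 (by
      intro h; rw [h] at hjl; exact absurd hjl (by simp [Fin.lt_def]))
  rw [Fin.lt_def, Fin.val_succ, Fin.val_succ] at hjl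
  rw [Fin.lt_def, Fin.val_succ, Fin.val_castSucc] at hij
  have hm' := congrArg Fin.val hm
  rw [Fin.val_succ, Fin.val_castSucc] at hm'
  by_cases hi : i'.val = 0
  · have h3 : G.t (a j') = G.s (a i') := by rw [T.t_eq, T.s_eq, h1]
    have h4 : G.t (a l') = G.s (a i') := by rw [T.t_eq, T.s_eq, h1, h2]
    have := T.bijective.1 (G.rel_left h3 (T.x_mul_x_eq_zero (by omega)) h4
      (T.x_mul_x_eq_zero (by omega)))
    rw [this] at hjl
    exact lt_irrefl _ hjl
  · obtain ⟨b, hb⟩ : ∃ b : Fin N, b.succ = i'.castSucc :=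
      Fin.exists_succ_eq.2 (by intro h; apply hi; simpa using congrArg Fin.val h)
    have hb' := congrArg Fin.val hb
    rw [Fin.val_succ, Fin.val_castSucc] at hb'
    let f : Fin 3 → {c : G.E // G.t c = v j'.succ} :=
      ![⟨a b, by rw [T.t_eq, hb, h1]⟩, ⟨a j', T.t_eq _⟩, ⟨a l', by rw [T.t_eq, h2]⟩]
    have hf : Function.Injective f := by
      have e1 : a b ≠ a j' := fun h => by have := T.bijective.1 h; omega
      have e2 : a b ≠ a l' := fun h => by have := T.bijective.1 h; omega
      have e3 : a j' ≠ a l' := fun h => by have := T.bijective.1 h; omega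
      intro x y hxy
      have hxy := congrArg Subtype.val hxy
      fin_cases x <;> fin_cases y <;> simp [f] at hxy ⊢ <;>
        first | exact absurd hxy e1 | exact absurd hxy e2 | exact absurd hxy e3 |
          exact absurd hxy.symm e1 | exact absurd hxy.symm e2 | exact absurd hxy.symm e3
    have h3 := Nat.card_le_card_of_injective f hf
    rw [Nat.card_fin] at h3
    have := G.card_in (v j'.succ)
    omega

/-- Composable arrows have product zero unless they are consecutive on the maximal path; the second
condition in `Next` excludes precisely the consecutive pairs. -/
lemma rel_iff (T : G.IsThread v a) {α : Equiv.Perm (Fin (N + 1))} (hα : IsPairing v α)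
    (i j : Fin N) : G.Rel (a i) (a j) ↔ QuasiDiagram.Next α i j := by
  have h1 : G.Rel (a i) (a j) ↔ v i.succ = v j.castSucc ∧ i.val + 1 ≠ j.val := by
    rw [Rel, T.t_eq, T.s_eq, Ne, ← T.nz_iff i j, Nz, not_not]
  have h2 : i.val + 1 ≠ j.val ↔ j.castSucc ≠ i.succ := by
    rw [Ne, Ne, Fin.ext_iff, Fin.val_succ, Fin.val_castSucc, eq_comm]
  rw [h1, h2, QuasiDiagram.Next]
  refine and_congr_left fun hne => ⟨fun h => hα.1 _ _ hne.symm h, fun h => ?_⟩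
  rw [← h, hα.apply_eq]

lemma exists_rel_chain_iff (T : G.IsThread v a) {α : Equiv.Perm (Fin (N + 1))}
    (hα : IsPairing v α) (L : ℕ) : (∃ l : List G.E, l.length = L ∧ l.IsChain G.Rel) ↔
      ∃ l : List (Fin N), l.length = L ∧ l.IsChain (QuasiDiagram.Next α) := by
  constructor
  · rintro ⟨l, rfl, hl⟩
    obtain ⟨l, rfl⟩ : ∃ m : List (Fin N), m.map a = l := by
      obtain ⟨f, hf⟩ := T.bijective.2.hasRightInverse
      refine ⟨l.map f, ?_⟩
      rw [List.map_map, (funext hf : a ∘ f = id), List.map_id]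
    rw [List.isChain_map] at hl
    exact ⟨l, by simp, hl.imp fun i j h => (T.rel_iff hα i j).1 h⟩
  · rintro ⟨l, rfl, hl⟩
    refine ⟨l.map a, by simp, ?_⟩
    rw [List.isChain_map]
    exact hl.imp fun i j h => (T.rel_iff hα i j).2 h

lemma isChain_ofFn (T : G.IsThread v a) : (List.ofFn a).IsChain G.Nz :=
  List.isChain_ofFn.2 fun _ _ => (T.nz_iff _ _).2 rfl

lemma isEmpty_or (T : G.IsThread v a) (i : G.V) :
    (N = 0 ∧ i = v 0) ∨ ∃ b, G.s b = i ∨ G.t b = i := by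
  obtain ⟨j, rfl⟩ := T.surjective i
  rcases Fin.eq_zero_or_eq_succ j with rfl | ⟨j, rfl⟩
  · rcases Nat.eq_zero_or_pos N with h | h
    · exact Or.inl ⟨h, rfl⟩
    · exact Or.inr ⟨a ⟨0, h⟩, Or.inl (T.s_eq _)⟩
  · exact Or.inr ⟨a j, Or.inr (T.t_eq _)⟩

end IsThread

lemma gldim_eq_iff [Nonempty G.V] {L : ℕ} (hL : ∀ l : List G.E, l.length = L → ¬ l.IsChain G.Nz)
    (N : ℕ) : gldim A = (N : WithBot ℕ∞) ↔ (∃ l : List G.E, l.length = N ∧ l.IsChain G.Rel) ∧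
      ∀ l : List G.E, l.length = N + 1 → ¬ l.IsChain G.Rel := by
  constructor
  · intro h
    constructor
    · by_contra hne
      push Not at hne
      cases N with
      | zero => exact hne [] rfl (by simp)
      | succ M =>
        have := G.gldim_le hL hne
        rw [h] at this
        have : M + 1 ≤ M := by exact_mod_cast this
        omega
    · intro l hl hc
      have := G.le_gldim hc
      rw [h, hl] at this
      have : N + 1 ≤ N := by exact_mod_cast this
      omega
  · rintro ⟨⟨l, hl, hc⟩, h⟩
    refine le_antisymm (G.gldim_le hL h) ?_
    rw [← hl]
    exact G.le_gldim hc

/-- A chain through all arrows is the only maximal path. -/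
lemma uniqueMax_of_chain {L : ℕ} (hL : ∀ l : List G.E, l.length = L → ¬ l.IsChain G.Nz)
    {c : List G.E} (hc : c.IsChain G.Nz) (hmem : ∀ a, a ∈ c)
    (hV : ∀ i, (∃ b, G.s b = i ∨ G.t b = i) ∨ ∀ j, j = i) : G.UniqueMax := by
  have h0 : ∀ i, G.IsMaxElt (G.val i []) → ∀ j, j = i := by
    intro i hi
    refine (hV i).resolve_left ?_
    rintro ⟨b, hb⟩
    rw [val_nil] at hi
    have hb0 : G.x b ≠ 0 := by
      have := G.W_ne_zero (l := [b]) (by simp) (by simp)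
      simpa using this
    rcases hb with rfl | rfl
    · exact hb0 (by rw [← G.e_mul_x]; exact (hi.2 b).1)
    · exact hb0 (by rw [← G.x_mul_e]; exact (hi.2 b).2)
  have h1 : ∀ i l, G.IsMaxElt (G.val i l) → l = c := by
    intro i l hl
    by_cases hnil : l = []
    · subst hnil
      cases c with
      | nil => rfl
      | cons b c =>
        have e1 := h0 i hl (G.s b)
        rw [val_nil] at hl
        have hb0 : G.x b ≠ 0 := by
          have := G.W_ne_zero (l := [b]) (by simp) (by simp)
          simpa using this
        exact absurd (by rw [← G.e_mul_x, e1]; exact (hl.2 b).1) hb0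
    · obtain ⟨h, l, rfl⟩ := List.exists_cons_of_ne_nil hnil
      have hp := hl.isPath
      obtain ⟨c1, c2, rfl⟩ := List.append_of_mem (hmem h)
      have hi : G.s h = i := hp.2 h (by simp)
      have hc1 : c1 = [] := by
        by_contra hne
        have h2 : G.Nz (c1.getLast hne) h := hc.rel_getLast_head_of_append hne (by simp)
        have h3 := (hl.2 (c1.getLast hne)).2
        rw [← hi, ← Nz.t_eq_s G h2, x_mul_val] at h3
        refine IsPath.val_ne_zero ⟨?_, by simp⟩ h3
        exact List.isChain_cons_cons.2 ⟨h2, hp.1⟩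
      subst hc1
      rw [List.nil_append] at hc ⊢
      -- `l` has no repetitions and `c2` contains all arrows other than `h`, so `l` is not longer.
      -- If it were shorter, the next arrow of the chain would prolong it, against maximality.
      have hlen : l.length = c2.length := by
        apply le_antisymm
        · have hn := hp.1.nodup_of_bounded hL
          have := (hn.subperm (l₂ := h :: c2) fun a _ => by simpa using hmem a).length_le
          simpa using this
        · by_contra hlt
          push Not at hlt
          have e1 : l = c2.take l.length := List.IsChain.eq_of_length (R := G.Nz)
            (fun h h' => G.nz_right h h') hp.1 (by simpa using hc.take (l.length + 1))
            (by simp; omega)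
          have e2 : h :: c2 = (h :: l) ++ c2.drop l.length := by
            conv_lhs => rw [← List.take_append_drop l.length c2, ← e1]
            rfl
          obtain ⟨b, m, hbm⟩ := List.exists_cons_of_ne_nil
            (show c2.drop l.length ≠ [] by
              rw [← List.length_pos_iff_ne_nil, List.length_drop]; omega)
          have h3 := (hl.2 b).1
          rw [val_mul_x] at h3
          refine IsPath.val_ne_zero ⟨?_, by simp [hi]⟩ h3
          rw [e2, hbm] at hc
          have : (h :: l) ++ b :: m = ((h :: l) ++ [b]) ++ m := by simp
          rw [this] at hc
          exact hc.left_of_append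
      rw [List.IsChain.eq_of_length (R := G.Nz) (fun h h' => G.nz_right h h') hp.1 hc hlen]
  intro i l j m hl hm
  have e1 := h1 i l hl
  have e2 := h1 j m hm
  refine ⟨?_, e1.trans e2.symm⟩
  subst e1
  subst e2
  cases m with
  | nil => exact h0 j hm i
  | cons b m => exact (hl.isPath.2 b (by simp)).symm.trans (hm.isPath.2 b (by simp))

end GentleFrame

namespace Quiver.Path

variable {V : Type} [Quiver.{0} V] {i j : V} (p : Path i j)

lemma vertices_getElem_zero (h : 0 < p.vertices.length) : p.vertices[0] = i := by
  rw [List.getElem_of_eq p.vertices_eq_arrows, List.getElem_cons_zero]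

lemma vertices_getElem_succ (m : ℕ) (h : m + 1 < p.vertices.length) (h' : m < p.arrows.length) :
    p.vertices[m + 1] = (p.arrows[m]).2.1 := by
  rw [List.getElem_of_eq p.vertices_eq_arrows, List.getElem_cons_succ, List.getElem_map]

end Quiver.Path

/-! ### Maximal paths and threads of presentations -/

namespace QuiverPresentation

variable {k : Type v} {A : Type u} [Field k] [Ring A] [Algebra k A] {P : QuiverPresentation k A}

lemma IsLocallyGentle.ofPath_eq_val (hP : P.IsLocallyGentle) {i j : P.V} (p : Quiver.Path i j) :
    P.ofPath p = hP.frame.val i p.arrows := P.ofPath_eq_idem_mul p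

lemma IsLocallyGentle.isMaximalPath_iff (hP : P.IsLocallyGentle) {i j : P.V}
    (p : Quiver.Path i j) :
    P.IsMaximalPath ⟨i, j, p⟩ ↔ hP.frame.IsMaxElt (hP.frame.val i p.arrows) := by
  rw [← hP.ofPath_eq_val]
  exact and_congr_right fun _ => ⟨fun h a => h a.2.2, fun h _ _ a => h ⟨_, _, a⟩⟩

lemma IsLocallyGentle.exists_path_of_isPath (hP : P.IsLocallyGentle) {i : P.V} {l : List P.Arr}
    (h : hP.frame.IsPath i l) : ∃ (j : P.V) (p : Quiver.Path i j), p.arrows = l := by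
  by_cases hl : l = []
  · subst hl; exact ⟨i, .nil, rfl⟩
  · obtain ⟨i', j, p, hp, -⟩ := Quiver.Path.exists_arrows_eq l hl
      (h.1.imp fun a b hab => P.arrow_mul_arrow_ne_zero hab)
    obtain ⟨a, l, rfl⟩ := List.exists_cons_of_ne_nil hl
    obtain rfl := (p.source_eq_of_arrows_cons hp).symm.trans (h.2 a rfl)
    exact ⟨j, p, hp⟩

lemma HasQuasiDiagram.eq_succ {n : ℕ} {α : Equiv.Perm (Fin n)} (h : P.HasQuasiDiagram α) :
    ∃ N, n = N + 1 := by
  obtain ⟨-, p, -, -, h, -⟩ := h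
  exact ⟨p.2.2.length, by rw [← h, Quiver.Path.vertices_length]⟩

/-- The frame of a presentation with a quasi-diagram. -/
noncomputable abbrev HasQuasiDiagram.frame {n : ℕ} {α : Equiv.Perm (Fin n)}
    (h : P.HasQuasiDiagram α) : GentleFrame k A := h.1.toIsLocallyGentle.frame

lemma HasQuasiDiagram.exists_bound {n : ℕ} {α : Equiv.Perm (Fin n)} (h : P.HasQuasiDiagram α) :
    ∃ L, ∀ l : List h.frame.E, l.length = L → ¬ l.IsChain h.frame.Nz := by
  have := h.1.finiteDimensional
  exact h.frame.exists_bound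

lemma HasQuasiDiagram.nonempty {n : ℕ} {α : Equiv.Perm (Fin n)} (h : P.HasQuasiDiagram α) :
    Nonempty h.frame.V := by
  obtain ⟨-, p, -⟩ := h
  exact ⟨p.1⟩

lemma HasQuasiDiagram.uniqueMax {n : ℕ} {α : Equiv.Perm (Fin n)} (h : P.HasQuasiDiagram α) :
    h.frame.UniqueMax := by
  have hP := h.1.toIsLocallyGentle
  obtain ⟨-, p, -, huniq, -⟩ := h
  intro i l j m hl hm
  obtain ⟨_, q, rfl⟩ := hP.exists_path_of_isPath hl.isPath
  obtain ⟨_, r, rfl⟩ := hP.exists_path_of_isPath hm.isPath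
  have h1 := huniq _ ((hP.isMaximalPath_iff q).2 hl)
  have h2 := huniq _ ((hP.isMaximalPath_iff r).2 hm)
  have h3 := h1.trans h2.symm
  exact ⟨congrArg Sigma.fst h3,
    congrArg (fun p : Σ i j : P.V, Quiver.Path i j => p.2.2.arrows) h3⟩

lemma HasQuasiDiagram.exists_thread {N : ℕ} {α : Equiv.Perm (Fin (N + 1))}
    (h : P.HasQuasiDiagram α) : ∃ v a, h.frame.IsThread (N := N) v a ∧ IsPairing v α := by
  obtain ⟨L, hL⟩ := h.exists_bound
  have hU := h.uniqueMax
  obtain ⟨⟨i, j, p⟩, hp, -, hlen, h1, h2⟩ := h.2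
  dsimp only at hlen h1 h2
  have hmax := (h.1.toIsLocallyGentle.isMaximalPath_iff p).1 hp
  have hN : p.arrows.length = N := by
    rw [Quiver.Path.vertices_length] at hlen
    rw [Quiver.Path.length_arrows]; omega
  refine ⟨fun m => p.vertices.get (m.cast hlen.symm), _, hU.isThread hL hmax hN ?_ fun m => ?_,
    h1, h2⟩
  · exact p.vertices_getElem_zero _
  · exact p.vertices_getElem_succ m.val _ _

end QuiverPresentation

/-! ### Quasi-diagrams of frames with one maximal path -/

namespace GentleFrame

variable {k : Type v} {A : Type u} [Field k] [Ring A] [Algebra k A] (G : GentleFrame k A)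

lemma toPres_isMaximalPath_iff {i j : G.toPres.V} (p : Quiver.Path i j) :
    G.toPres.IsMaximalPath ⟨i, j, p⟩ ↔
      G.IsMaxElt (G.val i (p.arrows.map fun a => a.2.2.1)) := by
  have h1 : G.toPres.ofPath p = G.val i (p.arrows.map fun a => a.2.2.1) :=
    (G.toPres_ofPath p).trans (G.pathVal_eq p)
  rw [← h1]
  refine and_congr_right fun _ => ⟨fun h a => ?_, fun h _ _ a => ?_⟩
  · have := h (G.toArr a).2.2
    rwa [toPres_ofArrow] at this
  · rw [toPres_ofArrow]; exact h a.1

/-- A frame with exactly one maximal path gives a presentation with a quasi-diagram. -/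
lemma UniqueMax.exists_hasQuasiDiagram {G : GentleFrame k A} [hne : Nonempty G.V] {L : ℕ}
    (hL : ∀ l : List G.E, l.length = L → ¬ l.IsChain G.Nz) (hU : G.UniqueMax) :
    ∃ (n : ℕ) (β : Equiv.Perm (Fin n)), G.toPres.HasQuasiDiagram β := by
  obtain ⟨i₀⟩ := hne
  obtain ⟨i, l, hmax, -⟩ := exists_isMaxElt hL (i := i₀) (l := []) ⟨by simp, by simp⟩
  obtain ⟨j, p, hp⟩ : ∃ (j : G.V) (p : Quiver.Path i j), p.arrows.map (fun a => a.2.2.1) = l := by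
    by_cases hl : l = []
    · subst hl; exact ⟨i, .nil, rfl⟩
    · obtain ⟨i', j, p, hp⟩ := G.exists_path hl (hmax.isPath.1.imp fun a b h => Nz.t_eq_s G h)
      obtain ⟨a, l, rfl⟩ := List.exists_cons_of_ne_nil hl
      obtain rfl := (p.source_eq_of_arrows_cons hp).symm.trans (hmax.isPath.2 a (by simp))
      exact ⟨j, p, by rw [hp, map_val_map_toArr]⟩
  have hlen : p.vertices.length = l.length + 1 := by
    rw [← hp, p.vertices_eq_arrows]; simp
  let v : Fin (l.length + 1) → G.V := fun m => p.vertices.get (m.cast hlen.symm)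
  have T := hU.isThread hL hmax (N := l.length) rfl (v := v)
    (p.vertices_getElem_zero _)
    (by
      intro m
      subst hp
      refine (p.vertices_getElem_succ m.val (by omega) (by simpa using m.2)).trans ?_
      rw [List.getElem_map]
      exact (p.arrows[m.val]).2.2.2.2.symm)
  obtain ⟨β, hβ⟩ := IsPairing.exists_of_injective T.not_three
  refine ⟨_, β, ⟨G.toPres_isLocallyGentle, G.moduleFinite_of_bound hL⟩, ⟨i, j, p⟩,
    (G.toPres_isMaximalPath_iff p).2 (by rw [hp]; exact hmax), ?_, hlen, hβ.1, hβ.2⟩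
  rintro ⟨i', j', q⟩ hq
  obtain ⟨h1, h2⟩ := hU _ _ _ _ ((G.toPres_isMaximalPath_iff q).1 hq) (hp ▸ hmax)
  refine Quiver.Path.eq_of_arrows_eq q p h1 ?_
  have := congrArg (List.map G.toArr) h2
  rwa [map_toArr_map_val, map_toArr_map_val] at this

end GentleFrame

/-! ### Passage to the Koszul dual -/

namespace GentleFrame

variable {k : Type v} {A : Type u} [Field k] [Ring A] [Algebra k A] {G : GentleFrame k A}

lemma isChain_dual_nz {l : List G.E} : l.IsChain G.dual.Nz ↔ l.reverse.IsChain G.Rel := by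
  rw [List.isChain_reverse]
  exact List.IsChain.iff fun {a b} => G.dual_nz

lemma isChain_dual_rel {l : List G.E} : l.IsChain G.dual.Rel ↔ l.reverse.IsChain G.Nz := by
  rw [List.isChain_reverse]
  exact List.IsChain.iff fun {a b} => G.dual_rel

variable {N : ℕ} {v : Fin (N + 1) → G.V} {a : Fin N → G.E}

/-- If the relations form a single path through all arrows, then the dual has a quasi-diagram. -/
lemma IsThread.exists_dual_quasiDiagram (T : G.IsThread v a)
    (h : ∃ l : List G.E, l.length = N ∧ l.IsChain G.Rel)
    (h' : ∀ l : List G.E, l.length = N + 1 → ¬ l.IsChain G.Rel) :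
    ∃ (n : ℕ) (β : Equiv.Perm (Fin n)) (P' : QuiverPresentation k G.Y), P'.HasQuasiDiagram β := by
  classical
  obtain ⟨c, hc, hch⟩ := h
  have hL : ∀ l : List G.dual.E, l.length = N + 1 → ¬ l.IsChain G.dual.Nz := fun l hl hn =>
    h' l.reverse ((List.length_reverse (as := l)).trans hl) (isChain_dual_nz.1 hn)
  have hmem : ∀ b, b ∈ c.reverse := by
    intro b
    have : Fintype G.E := Fintype.ofBijective a T.bijective
    have h1 : c.toFinset = Finset.univ := by
      rw [← Finset.card_eq_iff_eq_univ, List.toFinset_card_of_nodup (hch.nodup_of_bounded h'), hc,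
        ← Fintype.card_of_bijective T.bijective, Fintype.card_fin]
    rw [List.mem_reverse, ← List.mem_toFinset, h1]
    exact Finset.mem_univ b
  have hU : G.dual.UniqueMax := by
    refine uniqueMax_of_chain hL (c := c.reverse)
      (isChain_dual_nz.2 (by rw [List.reverse_reverse]; exact hch)) hmem fun i => ?_
    rcases T.isEmpty_or i with ⟨rfl, rfl⟩ | ⟨b, hb⟩
    · right
      intro j
      obtain ⟨m, rfl⟩ := T.surjective j
      exact congrArg v (Fin.ext (by omega))
    · exact Or.inl ⟨b, hb.symm⟩
  have : Nonempty G.dual.V := ⟨v 0⟩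
  obtain ⟨n, β, hβ⟩ := hU.exists_hasQuasiDiagram hL
  exact ⟨n, β, _, hβ⟩

/-- If the dual has a quasi-diagram, then the relations form a single path through all arrows. -/
lemma IsThread.of_dual_quasiDiagram (T : G.IsThread v a) {L : ℕ}
    (hL : ∀ l : List G.E, l.length = L → ¬ l.IsChain G.Nz) {P' : QuiverPresentation k G.Y} {M : ℕ}
    {β : Equiv.Perm (Fin (M + 1))} (h : P'.HasQuasiDiagram β) :
    M = N ∧ ((∃ l : List G.E, l.length = N ∧ l.IsChain G.Rel) ∧
      ∀ l : List G.E, l.length = N + 1 → ¬ l.IsChain G.Rel) ∧ (∀ i, β (β i) = i) ∧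
      (QuasiDiagram.TypeA β ∨ QuasiDiagram.TypeB β ∨ QuasiDiagram.TypeC β) := by
  have : Nonempty G.dual.V := ⟨v 0⟩
  have := h.nonempty
  have := h.1.finiteDimensional
  obtain ⟨L', hL'⟩ := h.exists_bound
  obtain ⟨L₂, hL₂⟩ := G.dual.exists_bound
  -- The given presentation of the dual need not be the standard one; the two frames share only
  -- their radical, the set of nilpotent elements.
  have hJ : ∀ z, z ∈ h.frame.J ↔ z ∈ G.dual.J := fun z => by
    rw [mem_J_iff_isNilpotent hL', mem_J_iff_isNilpotent hL₂]
  have hU : G.dual.UniqueMax := h.uniqueMax.of_J_eq G.dual fun z => (hJ z).symm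
  obtain ⟨v', a', T', hβ⟩ := h.exists_thread
  obtain ⟨i, l, hmax, -⟩ := exists_isMaxElt hL₂ (i := (v 0 : G.dual.V)) (l := [])
    ⟨by simp, by simp⟩
  have hl := hmax.isPath.1
  have hlen : l.length = N := by
    apply le_antisymm
    · exact length_le_of_bijective T.bijective hL₂ hl
    · have h1 : (List.ofFn a).Nodup := List.nodup_ofFn.2 T.bijective.1
      exact (List.length_ofFn (f := a)).symm.le.trans
        (h1.subperm (l₂ := l) fun b _ => hU.mem hL₂ hmax b).length_le
  have hbound : ∀ l : List G.dual.E, l.length = N + 1 → ¬ l.IsChain G.dual.Nz := by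
    intro l hl hc
    have := length_le_of_bijective T.bijective hL₂ hc
    exact absurd (hl.symm.le.trans this) (by omega)
  have hMN : M = N := by
    apply le_antisymm
    · obtain ⟨m, hm, hm'⟩ := exists_chain_of_J_eq G.dual (fun z => (hJ z).symm) T'.isChain_ofFn
      have := length_le_of_bijective T.bijective hL₂ hm'
      exact (List.length_ofFn (f := a')).symm.le.trans (hm.symm.le.trans this)
    · obtain ⟨m, hm, hm'⟩ := exists_chain_of_J_eq h.frame hJ hl
      have := length_le_of_bijective T'.bijective hL' hm'
      rwa [hm, hlen] at this
  refine ⟨hMN, ⟨⟨l.reverse, ?_, isChain_dual_nz.1 hl⟩, fun m hm hc => ?_⟩, hβ.involutive, ?_⟩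
  · exact (List.length_reverse (as := l)).trans hlen
  · refine hbound m.reverse ?_ (isChain_dual_nz.2 ?_)
    · exact (List.length_reverse (as := m)).trans hm
    · rw [List.reverse_reverse]; exact hc
  · subst hMN
    -- In the dual frame the longest `Rel`-chain is the reversed maximal path of A. Reading the same
    -- global dimension in the frame of `P'` gives the chain condition for β.
    have hgl : gldim G.Y = (M : WithBot ℕ∞) := by
      rw [gldim_eq_iff hL₂]
      refine ⟨⟨(List.ofFn a).reverse, ?_, isChain_dual_rel.2 ?_⟩, fun m hm hc => ?_⟩
      · exact (List.length_reverse (as := List.ofFn a)).trans List.length_ofFn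
      · rw [List.reverse_reverse]; exact T.isChain_ofFn
      · have := length_le_of_bijective T.bijective hL (isChain_dual_rel.1 hc)
        exact absurd (hm.symm.le.trans ((List.length_reverse (as := m)).symm.le.trans this))
          (by omega)
    rw [gldim_eq_iff hL'] at hgl
    rw [QuasiDiagram.type_iff hβ.involutive]
    have e := T'.exists_rel_chain_iff hβ
    refine ⟨(e M).1 hgl.1, fun m hm hc => ?_⟩
    obtain ⟨m', hm', hc'⟩ := (e (M + 1)).2 ⟨m, hm, hc⟩
    exact hgl.2 m' hm' hc'

end GentleFrame

/-! ### The theorem -/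

theorem theorem3p7 {k : Type v} {A : Type u} [Field k] [Ring A] [Algebra k A]
    (P : QuiverPresentation k A) {n : ℕ} (α : Equiv.Perm (Fin n)) (hα : P.HasQuasiDiagram α) :
    List.TFAE [
      ∃ (m : ℕ) (β : Equiv.Perm (Fin m)), P.HasKoszulDualQuasiDiagram β,
      gldim A = ((n - 1 : ℕ) : WithBot ℕ∞),
      QuasiDiagram.TypeA α ∨ QuasiDiagram.TypeB α ∨ QuasiDiagram.TypeC α] ∧
    ∀ (m : ℕ) (β : Equiv.Perm (Fin m)), P.HasKoszulDualQuasiDiagram β →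
      (QuasiDiagram.TypeA α ↔ QuasiDiagram.TypeA β) ∧
      (QuasiDiagram.TypeB α ↔ QuasiDiagram.TypeB β) ∧
      (QuasiDiagram.TypeC α ↔ QuasiDiagram.TypeC β) := by
  obtain ⟨N, rfl⟩ := hα.eq_succ
  obtain ⟨L, hL⟩ := hα.exists_bound
  obtain ⟨v, a, T, hpair⟩ := hα.exists_thread
  have := hα.nonempty
  have hJ : P.positivePart = hα.frame.J := hα.1.toIsLocallyGentle.J_eq_positivePart
  have h23 : gldim A = (N : WithBot ℕ∞) ↔
      (QuasiDiagram.TypeA α ∨ QuasiDiagram.TypeB α ∨ QuasiDiagram.TypeC α) := by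
    rw [GentleFrame.gldim_eq_iff hL, QuasiDiagram.type_iff hpair.involutive,
      T.exists_rel_chain_iff hpair]
    refine and_congr_right fun _ => ?_
    have := T.exists_rel_chain_iff hpair (N + 1)
    constructor
    · intro h l hl hc
      obtain ⟨m, hm, hc'⟩ := this.2 ⟨l, hl, hc⟩
      exact h m hm hc'
    · intro h l hl hc
      obtain ⟨m, hm, hc'⟩ := this.1 ⟨l, hl, hc⟩
      exact h m hm hc'
  have key : (gldim A = (N : WithBot ℕ∞) →
      ∃ (m : ℕ) (β : Equiv.Perm (Fin m)), P.HasKoszulDualQuasiDiagram β) ∧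
      ∀ (m : ℕ) (β : Equiv.Perm (Fin m)), P.HasKoszulDualQuasiDiagram β →
        gldim A = (N : WithBot ℕ∞) ∧ ∃ (h : m = N + 1), (∀ i, β (β i) = i) ∧
          (QuasiDiagram.TypeA β ∨ QuasiDiagram.TypeB β ∨ QuasiDiagram.TypeC β) := by
    -- Once `positivePart` is exposed and replaced by the radical of the frame, the Koszul dual is
    -- literally the Yoneda algebra carrying the dual frame.
    unfold QuiverPresentation.HasKoszulDualQuasiDiagram QuiverPresentation.KoszulDual
      QuiverPresentation.degreeZero
    rw [hJ]
    constructor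
    · intro h
      obtain ⟨h1, h2⟩ := (GentleFrame.gldim_eq_iff hL N).1 h
      exact T.exists_dual_quasiDiagram h1 h2
    · rintro m β ⟨P', hP'⟩
      obtain ⟨M, rfl⟩ := hP'.eq_succ
      obtain ⟨rfl, h1, h2, h3⟩ := T.of_dual_quasiDiagram hL hP'
      exact ⟨(GentleFrame.gldim_eq_iff hL M).2 h1, rfl, h2, h3⟩
  rw [Nat.add_sub_cancel]
  refine ⟨?_, fun m β hβ => ?_⟩
  · tfae_have 1 → 2 := fun ⟨m, β, hβ⟩ => (key.2 m β hβ).1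
    tfae_have 2 → 1 := key.1
    tfae_have 2 ↔ 3 := h23
    tfae_finish
  · obtain ⟨h1, rfl, h2, h3⟩ := key.2 m β hβ
    exact QuasiDiagram.type_congr hpair.involutive h2 (h23.1 h1) h3
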